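/- Let $K$ be a field of characteristic zero, and write $f_t(x)=x^2+t$. For $N\ge 1$ let $\Phi_N(x,t)=\prod_{n\mid N}(f_t^n(x)-x)^{\mu(N/n)}\in\mathbb Z[x,t]$, let $\Phi_{0,N}=\Phi_N$ and $\Phi_{M,N}(x,t)=\Phi_N(f_t^M(x),t)/\Phi_N(f_t^{M-1}(x),t)\in\mathbb Z[x,t]$ for $M\ge1$, and let $R(N)=\frac1N\sum_{n\mid N}\mu(N/n)2^n$. A finite directed graph is \emph{admissible} if every vertex has out-degree $1$ and in-degree $0$ or $2$, and if for every $N\ge 1$ it contains at most $R(N)$ cycles of length $N$ (for $N=1$: at most two fixed points). It is \emph{strongly admissible} if, in addition, it has either zero or two fixed points. For a vertex $P$ of an admissible graph $G$ let $\boldsymbol f(P)$ be the vertex to which $P$ points, let $-P$ be the unique vertex $\ne P$ with $\boldsymbol f(-P)=\boldsymbol f(P)$, and let $\overline{\mathcal O}(P)=\{\pm\boldsymbol f^k(P):k\ge0\}$. The portrait of $P$ is the pair $(M,N)$ consisting of its preperiod and eventual period under $\boldsymbol f$. Vertices $P_1,\dots,P_n$ form a \emph{minimal generating set} if $\bigcup_i\overline{\mathcal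 O}(P_i)$ is the vertex set of $G$ and no set of fewer than $n$ vertices has this property. Given an ordered minimal generating set $P_1,\dots,P_n$ of $G$, with $P_i$ of portrait $(M_i,N_i)$, let $G_i=\bigcup_{j\le i}\overline{\mathcal O}(P_j)$, and let $\mathcal D$ be the set of those $i$ for which no $\boldsymbol f^k(P_i)$ lies in $G_{i-1}$. For $i\notin\mathcal D$ let $\kappa_i$ be the least $k$ with $\boldsymbol f^k(P_i)\in G_{i-1}$, let $j_i$ be the index $j$ with $\boldsymbol f^{\kappa_i}(P_i)\in G_j\setminus G_{j-1}$, and let $\lambda_i$ be the least $\ell$ with $\boldsymbol f^\ell(P_{j_i})=-\boldsymbol f^{\kappa_i}(P_i)$. Let $Y_G\subset\mathbb A^{n+1}_K$ be the zero locus of the polynomials $\Psi_i=\Phi_{M_i,N_i}(x_i,t)$ for $i\in\mathcal D$ and $\Psi_i=f_t^{\kappa_i}(x_i)+f_t^{\lambda_i}(x_{j_i})$ for $i\notin\mathcal D$. Let $Y_1(G)$ be the closure in $\mathbb A^{n+1}_K$, with its reduced structure, of the open subset of $Y_G$ on which $f_t^{M_i}(x_i)\ne f_t^{M_j+k}(x_j)$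 for all $i>j$ in $\mathcal D$ with $N_i=N_j$ and all $0\le k\le N_i-1$. Let $X_1(G)$ be the normalization of the closure of $Y_1(G)$ in $\mathbb P^{n+1}_K$, and let $\pi_G:X_1(G)\to\mathbb P^1_K$ be the morphism that extends $(x_1,\dots,x_n,t)\mapsto t$. A morphism $\pi:X\to Y$ has degree $d$ if there is a dense open subset of $Y$ such that every geometric point in it has exactly $d$ preimages among the geometric points of $X$. \textbf{Proposition.} Let $G$ be an admissible graph and let $H$ be an admissible subgraph of $G$ (each with any ordered minimal generating set). Then there is a dominant morphism $\pi:X_1(G)\to X_1(H)$ satisfying $\pi_G=\pi_H\circ\pi$. This morphism has a degree, and the degree is at least two if and only if $G\ne H$ and $G$ is not obtained from $H$ by adding a second fixed point (that is, it is not the case that $H$ has exactly one fixed point and the vertices of $G$ not in $H$ are a fixed point $Q$ and $-Q$). In particular, if $H$ is strongly admissible and $G\ne H$, then $\deg\pi\ge2$. -/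

import Mathlib

open AlgebraicGeometry CategoryTheory CategoryTheory.Limits

noncomputable section

namespace DynModCurve

universe u v

/-! ### Dynatomic polynomials

`ℤ[t][x]` is `Polynomial (Polynomial ℤ)`: the outer variable is `x`, the inner one is `t`. -/

/-- The iterate `f_t^k(x)` of `f_t(x) = x^2 + t`, evaluated at an element `x` of a ring. -/
def iter {R : Type*} [CommRing R] (t x : R) (k : ℕ) : R :=
  (fun y => y ^ 2 + t)^[k] x

/-- The iterate `f_t^k(x) ∈ ℤ[t][x]` at the variable `x`. -/
def iterPoly (k : ℕ) : Polynomial (Polynomial ℤ) :=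
  iter (Polynomial.C Polynomial.X) Polynomial.X k

/-- The dynatomic polynomial `Φ_N = ∏_{n ∣ N} (f_t^n(x) - x)^{μ(N/n)}`. The factors with exponent
`-1` are monic in `x`, and the division by their product is exact. -/
def dynatomic (N : ℕ) : Polynomial (Polynomial ℤ) :=
  (∏ n ∈ N.divisors with ArithmeticFunction.moebius (N / n) = 1,
      (iterPoly n - Polynomial.X)) /ₘ
    (∏ n ∈ N.divisors with ArithmeticFunction.moebius (N / n) = -1,
      (iterPoly n - Polynomial.X))

/-- The generalized dynatomic polynomial: `Φ_{0,N} = Φ_N` and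
`Φ_{M,N} = Φ_N(f_t^M(x), t) / Φ_N(f_t^{M-1}(x), t)` for `M ≥ 1`. The denominator is monic in `x`,
and the division is exact. -/
def genDynatomic : ℕ → ℕ → Polynomial (Polynomial ℤ)
  | 0, N => dynatomic N
  | M + 1, N =>
    (dynatomic N).comp (iterPoly (M + 1)) /ₘ (dynatomic N).comp (iterPoly M)

/-- `R(N) = (1/N) ∑_{n ∣ N} μ(N/n) 2^n`, the number of `N`-cycles of a general quadratic
polynomial. -/
def numCycles (N : ℕ) : ℚ :=
  (∑ n ∈ N.divisors, (ArithmeticFunction.moebius (N / n) : ℚ) * 2 ^ n) / N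

/-! ### Admissible graphs -/

/-- A directed graph (loops allowed, no multiple edges) whose vertices are taken from `V`. -/
@[ext]
structure DGraph (V : Type v) where
  /-- the vertex set -/
  verts : Set V
  /-- the edge relation: `Adj P Q` is an edge `P → Q` -/
  Adj : V → V → Prop
  left_mem : ∀ {P Q}, Adj P Q → P ∈ verts
  right_mem : ∀ {P Q}, Adj P Q → Q ∈ verts

namespace DGraph

variable {V : Type v} (G : DGraph V)

/-- `H ≤ G`: `H` is a subgraph of `G`. -/
instance : LE (DGraph V) :=
  ⟨fun H G => H.verts ⊆ G.verts ∧ ∀ P Q, H.Adj P Q → G.Adj P Q⟩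

open Classical in
/-- The map `f` on vertices with `f P = Q` iff there is an edge `P → Q` (only meaningful at a
vertex of out-degree one). -/
def next (P : V) : V :=
  if h : ∃ Q, G.Adj P Q then h.choose else P

/-- The set of cycles of length `N`, each cycle being given by its set of vertices. -/
def cycles (N : ℕ) : Set (Set V) :=
  {C | ∃ P ∈ G.verts, Function.minimalPeriod G.next P = N ∧
    C = {Q | ∃ k : ℕ, Q = G.next^[k] P}}

/-- The fixed points of the graph. -/
def fixedVerts : Set V := {P | G.Adj P P}

/-- Admissible graphs. -/
structure Admissible : Prop where
  finite : G.verts.Finite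
  outDegree : ∀ P ∈ G.verts, {Q | G.Adj P Q}.ncard = 1
  inDegree : ∀ Q ∈ G.verts, {P | G.Adj P Q}.ncard = 0 ∨ {P | G.Adj P Q}.ncard = 2
  cycles_le : ∀ N : ℕ, 1 ≤ N → ((G.cycles N).ncard : ℚ) ≤ numCycles N

/-- Strongly admissible graphs: admissible, with zero or two fixed points. -/
structure StronglyAdmissible : Prop where
  admissible : G.Admissible
  fixed : G.fixedVerts.ncard = 0 ∨ G.fixedVerts.ncard = 2

open Classical in
/-- For a vertex `P` of an admissible graph, `-P` is the unique other vertex with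
`f(-P) = f(P)`. -/
def opp (P : V) : V :=
  if h : ∃ Q ∈ G.verts, Q ≠ P ∧ G.next Q = G.next P then h.choose else P

/-- The set `{± f^k(P) : k ≥ 0}`. -/
def bigOrbit (P : V) : Set V :=
  {Q | ∃ k : ℕ, Q = G.next^[k] P ∨ Q = G.opp (G.next^[k] P)}

/-- The preperiod of a vertex. -/
def preperiod (P : V) : ℕ :=
  sInf {m | G.next^[m] P ∈ Function.periodicPts G.next}

/-- The eventual period of a vertex. -/
def eventualPeriod (P : V) : ℕ :=
  Function.minimalPeriod G.next (G.next^[G.preperiod P] P)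

/-- The set `S` of vertices generates `G`. -/
def Generates (S : Set V) : Prop :=
  S ⊆ G.verts ∧ ∀ Q ∈ G.verts, ∃ P ∈ S, Q ∈ G.bigOrbit P

/-- `P₀, …, P_{n-1}` is an (ordered) minimal generating set of `G`: it generates `G`, and every
generating set has at least `n` elements. -/
def MinGenerates {n : ℕ} (P : Fin n → V) : Prop :=
  G.Generates (Set.range P) ∧ ∀ S : Finset V, G.Generates ↑S → n ≤ S.card

/-- `G` is obtained from its subgraph `H` by adding a second fixed point: `H` has exactly one fixed
point, and the new vertices are a fixed point `Q` and its other preimage `-Q`. -/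
def AddsSecondFixedPoint (H G : DGraph V) : Prop :=
  H.fixedVerts.ncard = 1 ∧
    ∃ Q, Q ∉ H.verts ∧ G.Adj Q Q ∧ G.verts = H.verts ∪ {Q, G.opp Q}

section Generators

variable {n : ℕ} (P : Fin n → V)

/-- The vertices of the subgraph generated by the generators preceding the `i`-th one. -/
def before (i : Fin n) : Set V := {Q | ∃ j < i, Q ∈ G.bigOrbit (P j)}

/-- The vertices which are generated by the first generators up to the `i`-th one, but not by those
preceding the `i`-th one. -/
def newVerts (i : Fin n) : Set V := G.bigOrbit (P i) \ G.before P i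

/-- The set `𝒟` of those `i` for which the orbit of `P_i` is disjoint from the subgraph generated by
the preceding generators. -/
def disjointIdx : Set (Fin n) := {i | ∀ k : ℕ, G.next^[k] (P i) ∉ G.before P i}

/-- For `i ∉ 𝒟`: the smallest `k` for which `f^k(P_i)` lies in the subgraph generated by the
preceding generators. -/
def kappa (i : Fin n) : ℕ := sInf {k | G.next^[k] (P i) ∈ G.before P i}

/-- For `i ∉ 𝒟` and `j = j_i`: the smallest `l` with `f^l(P_j) = -f^{κ_i}(P_i)`. -/
def lambda (i j : Fin n) : ℕ :=
  sInf {l | G.next^[l] (P j) = G.opp (G.next^[G.kappa P i] (P i))}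

end Generators

end DGraph

/-! ### The affine curves -/

section Affine

variable (K : Type u) [Field K] {V : Type v} (G : DGraph V) {n : ℕ} (P : Fin n → V)

/-- The coordinate ring `K[x_0, …, x_{n-1}, t]` of `𝔸^{n+1}`; the coordinate `t` has index
`none`. -/
abbrev Coord (n : ℕ) : Type u := MvPolynomial (Option (Fin n)) K

/-- The coordinate `t`. -/
abbrev tVar (n : ℕ) : Coord K n := MvPolynomial.X none

/-- The coordinate `x_i`. -/
abbrev xVar {n : ℕ} (i : Fin n) : Coord K n := MvPolynomial.X (some i)

/-- The equations `Ψ_i` of `Y_G`. In the second set, `j` is the unique index such that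
`f^{κ_i}(P_i)` is one of the new vertices of the `j`-th generator. -/
def equations : Set (Coord K n) :=
  {p | ∃ i ∈ G.disjointIdx P,
    p = Polynomial.aevalAeval (tVar K n) (xVar K i)
      (genDynatomic (G.preperiod (P i)) (G.eventualPeriod (P i)))} ∪
  {p | ∃ i ∉ G.disjointIdx P, ∃ j, G.next^[G.kappa P i] (P i) ∈ G.newVerts P j ∧
    p = iter (tVar K n) (xVar K i) (G.kappa P i) + iter (tVar K n) (xVar K j) (G.lambda P i j)}

/-- The functions whose non-vanishing expresses that generators `P_i`, `P_j` with `i, j ∈ 𝒟` have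
disjoint orbits. -/
def nonEquations : Set (Coord K n) :=
  {p | ∃ i ∈ G.disjointIdx P, ∃ j ∈ G.disjointIdx P, j < i ∧
    G.eventualPeriod (P i) = G.eventualPeriod (P j) ∧ ∃ k < G.eventualPeriod (P i),
    p = iter (tVar K n) (xVar K i) (G.preperiod (P i)) -
      iter (tVar K n) (xVar K j) (G.preperiod (P j) + k)}

/-- The open subset of `Y_G` whose closure is `Y₁(G)`. -/
def openPart : Set (PrimeSpectrum (Coord K n)) :=
  {x | (∀ p ∈ equations K G P, p ∈ x.asIdeal) ∧ ∀ p ∈ nonEquations K G P, p ∉ x.asIdeal}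

/-- The coordinate ring of `Y₁(G)`, the closure (with its reduced structure) of `openPart` in
`𝔸^{n+1}`. -/
abbrev CoordRing : Type u := Coord K n ⧸ PrimeSpectrum.vanishingIdeal (openPart K G P)

/-- The affine curve `Y₁(G)`. -/
abbrev Y₁ : Scheme.{u} := Spec (.of (CoordRing K G P))

end Affine

/-! ### Projective space and the standard affine chart -/

section Proj

attribute [local instance] MvPolynomial.gradedAlgebra

variable (σ : Type) (K : Type u) [Field K]

/-- Projective space over `K` with homogeneous coordinates indexed by `Option σ`; the coordinate
`none` cuts out the hyperplane at infinity. -/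
abbrev ProjSpace : Scheme.{u} := Proj (MvPolynomial.homogeneousSubmodule (Option σ) K)

/-- Dehomogenization `K[X_0, X_σ] → K[X_σ]`, `X_0 ↦ 1`. -/
def dehom : MvPolynomial (Option σ) K →+* MvPolynomial σ K :=
  (MvPolynomial.aeval fun o : Option σ => o.elim 1 MvPolynomial.X).toRingHom

/-- The ring homomorphism `K[X_0, X_σ]_{(X_0)} → K[X_σ]` (an isomorphism) induced by
dehomogenization. -/
def dehomAway :
    HomogeneousLocalization.Away (MvPolynomial.homogeneousSubmodule (Option σ) K)
      (MvPolynomial.X none) →+* MvPolynomial σ K :=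
  (IsLocalization.Away.lift
    (S := Localization.Away (MvPolynomial.X none : MvPolynomial (Option σ) K)) (MvPolynomial.X none) (g := dehom σ K) (by simp [dehom])).comp
    (algebraMap (HomogeneousLocalization.Away (MvPolynomial.homogeneousSubmodule (Option σ) K)
      (MvPolynomial.X none)) _)

/-- The standard affine chart `𝔸^σ → ℙ^σ`, `(x_i) ↦ [1 : x_i]`. -/
def chart : Spec (.of (MvPolynomial σ K)) ⟶ ProjSpace σ K :=
  Spec.map (CommRingCat.ofHom (dehomAway σ K)) ≫
    Proj.awayι (MvPolynomial.homogeneousSubmodule (Option σ) K) (MvPolynomial.X none)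
      (m := 1) (MvPolynomial.isHomogeneous_X K none) one_pos

/-- The projective line over `K`. -/
abbrev P1 : Scheme.{u} := ProjSpace Unit K

end Proj

/-! ### The curves `X₁(G)` -/

section Curves

attribute [local instance] MvPolynomial.gradedAlgebra

variable (K : Type u) [Field K] {V : Type v} (G : DGraph V) {n : ℕ} (P : Fin n → V)

/-- The inclusion `Y₁(G) → 𝔸^{n+1} → ℙ^{n+1}`. -/
def toProjSpace : Y₁ K G P ⟶ ProjSpace (Option (Fin n)) K :=
  Spec.map (CommRingCat.ofHom (Ideal.Quotient.mk _)) ≫ chart (Option (Fin n)) K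

/-- The projective closure of `Y₁(G)`: the scheme-theoretic image of `Y₁(G)` in `ℙ^{n+1}`. -/
abbrev ProjClosure : Scheme.{u} := (toProjSpace K G P).image

/-- The inclusion of `Y₁(G)` into its projective closure. -/
abbrev toProjClosure : Y₁ K G P ⟶ ProjClosure K G P := (toProjSpace K G P).toImage

/-- The disjoint union of the generic points of the projective closure, which is the spectrum of the
total ring of fractions of its dense open affine `Y₁(G)`, with its morphism to the projective
closure. -/
def genericPoints : Spec (.of (FractionRing (CoordRing K G P))) ⟶ ProjClosure K G P :=
  Spec.map (CommRingCat.ofHom (algebraMap (CoordRing K G P) (FractionRing (CoordRing K G P)))) ≫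
    toProjClosure K G P

instance : (ProjClosure K G P).IsSeparated :=
  ⟨by
    rw [← terminal.comp_from (toProjSpace K G P).imageι]
    infer_instance⟩

instance : QuasiCompact (genericPoints K G P) := by
  have : QuasiCompact (genericPoints K G P ≫ terminal.from _) := by
    rw [terminal.comp_from]
    infer_instance
  exact QuasiCompact.of_comp _ (terminal.from _)

instance : QuasiSeparated (genericPoints K G P) := by
  infer_instance

/-- The curve `X₁(G)`: the normalization of the projective closure of `Y₁(G)`. -/
abbrev X₁ : Scheme.{u} := (genericPoints K G P).normalization

/-- The normalization morphism. -/
abbrev normMap : X₁ K G P ⟶ ProjClosure K G P := (genericPoints K G P).fromNormalization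

/-- The morphism `Y₁(G) → 𝔸¹ → ℙ¹`, `(x, t) ↦ t`. -/
def affineProj : Y₁ K G P ⟶ P1 K :=
  Spec.map (CommRingCat.ofHom
    ((MvPolynomial.aeval fun _ : Unit =>
      (Ideal.Quotient.mk _ (tVar K n) : CoordRing K G P)).toRingHom :
      MvPolynomial Unit K →+* CoordRing K G P)) ≫ chart Unit K

/-- `p : X₁(G) → ℙ¹` is the projection to the `t`-coordinate, that is, the (unique) morphism which
on the preimage of `Y₁(G)` is `(x, t) ↦ t`. -/
def IsParamProj (p : X₁ K G P ⟶ P1 K) : Prop :=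
  pullback.fst (normMap K G P) (toProjClosure K G P) ≫ p =
    pullback.snd (normMap K G P) (toProjClosure K G P) ≫ affineProj K G P

/-- The projection to the `t`-coordinate is unique. -/
theorem IsParamProj.unique {p q : X₁ K G P ⟶ P1 K} (hp : IsParamProj K G P p)
    (hq : IsParamProj K G P q) : p = q := by
  have : _root_.IsReduced (CoordRing K G P) :=
    (Ideal.isRadical_iff_quotient_reduced _).mp (PrimeSpectrum.isRadical_vanishingIdeal _)
  have : _root_.IsReduced (FractionRing (CoordRing K G P)) :=
    isReduced_localizationPreserves (nonZeroDivisors (CoordRing K G P)) _ this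
  have : IsReduced (X₁ K G P) := inferInstance
  let l := pullback.lift (f := normMap K G P) (g := toProjClosure K G P)
    (genericPoints K G P).toNormalization
    (Spec.map (CommRingCat.ofHom (algebraMap (CoordRing K G P) (FractionRing (CoordRing K G P)))))
    (Scheme.Hom.toNormalization_fromNormalization (genericPoints K G P))
  have hl : l ≫ pullback.fst _ _ = (genericPoints K G P).toNormalization :=
    pullback.lift_fst ..
  refine ext_of_isDominant (genericPoints K G P).toNormalization ?_
  rw [← hl, Category.assoc, Category.assoc, hp, hq]

end Curves

/-- `π : X → Y` has degree `d`: a typical point of `Y` has exactly `d` preimages, i.e. every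
geometric point of some dense open subset of `Y` has exactly `d` preimages among the geometric
points of `X`. -/
def HasDegree {X Y : Scheme.{u}} (π : X ⟶ Y) (d : ℕ) : Prop :=
  ∃ U : Y.Opens, Dense (U : Set Y) ∧
    ∀ (Ω : Type u) [Field Ω] [IsAlgClosed Ω] (y : Spec (.of Ω) ⟶ Y),
      Set.range y ⊆ U → {x : Spec (.of Ω) ⟶ X | x ≫ π = y}.encard = d

end DynModCurve

end

/-! Call t good if its short cycles consist of simple periodic points and the critical point 0 is
not preperiodic with small preperiod and period. One nonzero polynomial in t cuts out all bad
parameters (`exists_good_poly`).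

Over a good t the geometric points of Y₁(G) are the embeddings of G into the graph of f_t: an
embedding solves the equations (`IsEmb.isSol`), a solution extends generator by generator to an
embedding (`IsSol.exists_isEmb`), and taking the closure adds no point there (`isSol_of_hom`).
Restricting embeddings from G to H is polynomial in the coordinates (`exists_coordRing_hom`), so it
defines a morphism whose fibres are the sets of extensions of an embedding of H to G
(`encard_fibre_coordRing`).

These extensions are counted by adding one big orbit at a time (`exists_extension_count`). The two
preimages of a vertex already present can be placed in 2 ways. A new N-cycle can be started at N
R(N) minus the number of points of exact period N already used, and admissibility makes this at
least N. Hence a factor is 1 only when N = 1 and exactly one fixed point is already used. The count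
depends only on G and H, and it is 1 exactly in the two exceptional cases.

It remains to pass to X₁. The coordinate ring of Y₁(G) is integral over K[t], because every
coordinate is preperiodic, and torsion-free, because Krull's height theorem makes every component
dominate the t-line (`exists_generic_le`). Over good parameters its generators are simple roots, so
it is étale over K[t] there, hence integrally closed (`mem_range_goodToFrac`), and X₁(G) is there
the affine curve itself (`exists_isPullback_goodRing`). The projective closure misses the centre of
the projection to the t-line, so that projection is integral (`exists_projClosure_proj`), and the
universal property of normalization extends the morphism to X₁(G) → X₁(H)
(`exists_normalization_map`). -/

noncomputable section
namespace DynModCurve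

/-! ### Iterates -/

section Iter

variable {R S : Type*} [CommRing R] [CommRing S]

@[simp] lemma iter_zero (t x : R) : iter t x 0 = x := rfl

lemma iter_succ (t x : R) (k : ℕ) : iter t x (k + 1) = iter t x k ^ 2 + t := by
  simp only [iter, Function.iterate_succ_apply']

lemma iter_add (t x : R) (a b : ℕ) : iter t x (a + b) = iter t (iter t x a) b := by
  rw [add_comm]
  simp only [iter, Function.iterate_add_apply]

lemma iter_one (t x : R) : iter t x 1 = x ^ 2 + t := rfl

lemma iter_succ' (t x : R) (k : ℕ) : iter t x (k + 1) = iter t (x ^ 2 + t) k := by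
  rw [add_comm, iter_add, iter_one]

lemma iter_iter (t x : R) (a b : ℕ) : iter t (iter t x a) b = iter t x (a + b) :=
  (iter_add t x a b).symm

lemma map_iter (φ : R →+* S) (t x : R) (k : ℕ) : φ (iter t x k) = iter (φ t) (φ x) k := by
  induction k with
  | zero => rfl
  | succ k ih => simp only [iter_succ, map_add, map_pow, ih]

lemma iter_neg_succ (t x : R) (k : ℕ) : iter t (-x) (k + 1) = iter t x (k + 1) := by
  rw [iter_succ', iter_succ', neg_sq]

/-- The derivative of the `n`-th iterate at `x`. -/
def iterDeriv (t x : R) (n : ℕ) : R := ∏ k ∈ Finset.range n, (2 * iter t x k)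

lemma map_iterDeriv (φ : R →+* S) (t x : R) (n : ℕ) :
    φ (iterDeriv t x n) = iterDeriv (φ t) (φ x) n := by
  simp [iterDeriv, map_prod, map_iter, map_ofNat]

open Polynomial in
lemma derivative_iter (t : R) (n : ℕ) :
    derivative (iter (C t) X n) = iterDeriv (C t) (X : R[X]) n := by
  induction n with
  | zero => simp [iterDeriv]
  | succ n ih =>
    rw [iter_succ, iterDeriv, Finset.prod_range_succ, ← iterDeriv, ← ih]
    simp only [derivative_add, derivative_pow, derivative_C]
    simp only [Nat.cast_ofNat, Nat.add_one_sub_one, pow_one, add_zero, map_ofNat]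
    ring

open Polynomial in
lemma eval_iter (t x : R) (n : ℕ) : (iter (C t) X n).eval x = iter t x n := by
  simpa using map_iter (evalRingHom x) (C t) X n

open Polynomial in
lemma iter_monic_natDegree [Nontrivial R] (t : R) (n : ℕ) :
    (iter (C t) (X : R[X]) n).Monic ∧ (iter (C t) (X : R[X]) n).natDegree = 2 ^ n := by
  induction n with
  | zero => simp [monic_X]
  | succ n ih =>
    obtain ⟨hm, hd⟩ := ih
    have h1 : ((iter (C t) (X : R[X]) n) ^ 2).natDegree = 2 ^ (n + 1) := by
      rw [hm.natDegree_pow, hd, pow_succ, mul_comm]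
    have h2 : (C t : R[X]).degree < ((iter (C t) (X : R[X]) n) ^ 2).degree := by
      refine degree_lt_degree ?_
      rw [h1, natDegree_C]; positivity
    rw [iter_succ]
    refine ⟨(hm.pow 2).add_of_left h2, ?_⟩
    rw [natDegree_add_eq_left_of_degree_lt h2, h1]

open Polynomial in
lemma iter_sub_X_monic_natDegree [Nontrivial R] (t : R) {n : ℕ} (hn : 1 ≤ n) :
    (iter (C t) (X : R[X]) n - X).Monic ∧ (iter (C t) (X : R[X]) n - X).natDegree = 2 ^ n := by
  obtain ⟨hm, hd⟩ := iter_monic_natDegree t n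
  have h2 : (X : R[X]).degree < (iter (C t) (X : R[X]) n).degree := by
    refine degree_lt_degree ?_
    rw [hd, natDegree_X]; exact Nat.one_lt_two_pow (by omega)
  exact ⟨hm.sub_of_left h2, by
    rw [natDegree_sub_eq_left_of_natDegree_lt (natDegree_lt_natDegree (by simp) h2), hd]⟩

end Iter

/-! ### Good parameters -/

/-- The parameter `t` is good up to `B`: the points of period at most `B` are simple, and the
critical point does not run into a cycle of length at most `B` within `B` steps. -/
structure Good (B : ℕ) {Ω : Type*} [Field Ω] (t : Ω) : Prop where
  simple : ∀ n, 1 ≤ n → n ≤ B → ∀ x, iter t x n = x → iterDeriv t x n ≠ 1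
  critical : ∀ b, 1 ≤ b → b ≤ B → iter t 0 (B + b) ≠ iter t 0 B

/-- A coincidence in the critical orbit persists under iteration, so testing it at step `B` alone
excludes all earlier ones. -/
lemma Good.critical' {B : ℕ} {Ω : Type*} [Field Ω] {t : Ω} (h : Good B t) {a b : ℕ} (ha : a ≤ B)
    (hb : 1 ≤ b) (hbB : b ≤ B) : iter t 0 (a + b) ≠ iter t 0 a := by
  intro e
  apply h.critical b hb hbB
  obtain ⟨c, rfl⟩ := Nat.exists_eq_add_of_le ha
  rw [show a + c + b = (a + b) + c by ring, iter_add, e, ← iter_add]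

-- At t = 0 the iterate is X^(2^n), so X^(2^n) - X can be compared with its derivative by hand. This
-- single specialization shows that the discriminant in `exists_simple_poly` is not identically
-- zero.
open Polynomial in
lemma isCoprime_iter_sub_X_derivative_zero {n : ℕ} (hn : 1 ≤ n) :
    IsCoprime (iter (C 0) (X : ℚ[X]) n - X) (derivative (iter (C 0) (X : ℚ[X]) n - X)) := by
  have h0 : ∀ n, iter (C 0) (X : ℚ[X]) n = X ^ 2 ^ n := by
    intro n
    induction n with
    | zero => simp
    | succ n ih => rw [iter_succ, ih]; simp; ring
  have hc : (2 : ℚ) ^ n - 1 ≠ 0 := by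
    have : (1 : ℚ) < 2 ^ n := one_lt_pow₀ (by norm_num) (by omega)
    linarith
  obtain ⟨m, hm⟩ : ∃ m, 2 ^ n = m + 1 := Nat.exists_eq_succ_of_ne_zero (by positivity)
  have hm' : (2 : ℚ) ^ n = m + 1 := by exact_mod_cast hm
  have hD : derivative (iter (C 0) (X : ℚ[X]) n - X) = C ((2 : ℚ) ^ n) * X ^ m - 1 := by
    rw [h0, hm]; simp [hm']
  have hF : iter (C 0) (X : ℚ[X]) n - X = X ^ m * X - X := by rw [h0, hm, pow_succ]
  rw [hD, hF]
  -- `X` is a combination of the two polynomials, hence so is `1`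
  set a : ℚ := ((2 : ℚ) ^ n - 1)⁻¹
  have ha : C a * (C ((2 : ℚ) ^ n) - 1) = (1 : ℚ[X]) := by
    rw [← C_1, ← C_sub, ← C_mul]; simp [a, hc]
  have hm1 : 1 ≤ m := by
    have := Nat.one_lt_two_pow (n := n) (by omega); omega
  obtain ⟨l, rfl⟩ := Nat.exists_eq_add_of_le' hm1
  have hX : (X : ℚ[X]) = (-(C a) * C ((2 : ℚ) ^ n)) * (X ^ (l + 1) * X - X)
      + (C a * X) * (C ((2 : ℚ) ^ n) * X ^ (l + 1) - 1) := by
    linear_combination (-X) * ha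
  refine ⟨C ((2 : ℚ) ^ n) * X ^ l * (-(C a) * C ((2 : ℚ) ^ n)),
    C ((2 : ℚ) ^ n) * X ^ l * (C a * X) - 1, ?_⟩
  linear_combination (-C ((2 : ℚ) ^ n) * X ^ l) * hX

-- The witness is the resultant of f^n(x) - x and its x-derivative. A multiple root over any field
-- makes it vanish through the Bézout identity, and it is nonzero at t = 0.
open Polynomial in
lemma exists_simple_poly {n : ℕ} (hn : 1 ≤ n) :
    ∃ c : ℤ[X], c ≠ 0 ∧ ∀ (Ω : Type*) [Field Ω] (t : Ω), aeval t c ≠ 0 →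
      ∀ x, iter t x n = x → iterDeriv t x n ≠ 1 := by
  set F : ℤ[X][X] := iter (C (X : ℤ[X])) X n - X with hFdef
  refine ⟨resultant F (derivative F) F.natDegree (derivative F).natDegree, ?_, ?_⟩
  · intro h0
    have h1 := congrArg (aeval (0 : ℚ)) h0
    rw [map_zero] at h1
    change ((aeval (0 : ℚ) : ℤ[X] →ₐ[ℤ] ℚ) : ℤ[X] →+* ℚ) _ = 0 at h1
    rw [← resultant_map_map] at h1
    obtain ⟨hFm, hFd⟩ := iter_sub_X_monic_natDegree (X : ℤ[X]) hn
    rw [← hFdef] at hFd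
    have hmap : F.map ((aeval (0 : ℚ) : ℤ[X] →ₐ[ℤ] ℚ) : ℤ[X] →+* ℚ) =
        iter (C 0) (X : ℚ[X]) n - X := by
      simp only [F, Polynomial.map_sub, map_X]
      rw [← coe_mapRingHom, map_iter]; simp
    rw [← derivative_map, hmap, hFd] at h1
    have hd : (iter (C 0) (X : ℚ[X]) n - X).natDegree = 2 ^ n :=
      (iter_sub_X_monic_natDegree (0 : ℚ) hn).2
    -- The resultant carries formal degrees, so the derivative must be seen to keep its degree at t
    -- = 0.
    have hdd : (derivative (iter (C 0) (X : ℚ[X]) n - X)).natDegree = (derivative F).natDegree := by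
      rw [natDegree_eq_of_degree_eq_some (degree_derivative (by rw [hd]; positivity)),
        natDegree_eq_of_degree_eq_some (degree_derivative (by rw [hFd]; positivity)), hd, hFd]
    rw [← hdd, ← hd] at h1
    exact resultant_ne_zero _ _ (isCoprime_iter_sub_X_derivative_zero hn) h1
  · intro Ω _ t hc x hx hD
    obtain ⟨hFm, hFd⟩ := iter_sub_X_monic_natDegree (X : ℤ[X]) hn
    rw [← hFdef] at hFd
    obtain ⟨p, q, -, -, hpq⟩ := exists_mul_add_mul_eq_C_resultant F (derivative F) le_rfl le_rfl
      (Or.inl (by rw [hFd]; positivity))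
    apply hc
    have h := congrArg (eval₂RingHom ((aeval t : ℤ[X] →ₐ[ℤ] Ω) : ℤ[X] →+* Ω) x) hpq
    have hF0 : eval₂RingHom ((aeval t : ℤ[X] →ₐ[ℤ] Ω) : ℤ[X] →+* Ω) x F = 0 := by
      simp only [F, map_sub, map_iter]; simp [hx]
    have hF1 : eval₂RingHom ((aeval t : ℤ[X] →ₐ[ℤ] Ω) : ℤ[X] →+* Ω) x (derivative F) = 0 := by
      simp only [F, derivative_iter, map_sub, map_iterDeriv]; simp [hD]
    rw [map_add, map_mul, map_mul, hF0, hF1] at h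
    simpa using h.symm

-- At t = 1 the critical orbit 0, 1, 2, 5, ... is strictly increasing over ℤ, so the difference of
-- two of its terms is a nonzero polynomial in t.
open Polynomial in
lemma exists_critical_poly (a : ℕ) {b : ℕ} (hb : 1 ≤ b) :
    ∃ c : ℤ[X], c ≠ 0 ∧ ∀ (Ω : Type*) [Field Ω] (t : Ω), aeval t c ≠ 0 →
      iter t 0 (a + b) ≠ iter t 0 a := by
  refine ⟨iter X 0 (a + b) - iter X 0 a, ?_, ?_⟩
  · intro h
    have h1 := congrArg (evalRingHom (1 : ℤ)) h
    simp only [map_sub, map_iter, map_zero] at h1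
    simp only [coe_evalRingHom, eval_X] at h1
    have hmono : StrictMono (fun k => iter (1 : ℤ) 0 k) := by
      refine strictMono_nat_of_lt_succ fun k => ?_
      rw [iter_succ]; nlinarith [sq_nonneg (2 * iter (1 : ℤ) 0 k - 1)]
    have := hmono (show a < a + b by omega)
    simp only at this
    omega
  · intro Ω _ t hc h
    apply hc
    change ((aeval t : ℤ[X] →ₐ[ℤ] Ω) : ℤ[X] →+* Ω) _ = 0
    simp only [map_sub, map_iter, map_zero]; simp [h]

open Polynomial in
lemma exists_good_poly (B : ℕ) :
    ∃ c : ℤ[X], c ≠ 0 ∧ ∀ (Ω : Type*) [Field Ω] (t : Ω), aeval t c ≠ 0 → Good B t := by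
  choose! c hc0 hc using fun n (hn : 1 ≤ n) => exists_simple_poly.{_} hn
  choose! e he0 he using fun n (hn : 1 ≤ n) => exists_critical_poly.{_} B hn
  refine ⟨∏ n ∈ Finset.Icc 1 B, (c n * e n), ?_, ?_⟩
  · refine Finset.prod_ne_zero_iff.2 fun n hn => ?_
    rw [Finset.mem_Icc] at hn
    exact mul_ne_zero (hc0 n hn.1) (he0 n hn.1)
  · intro Ω _ t h
    rw [map_prod, Finset.prod_ne_zero_iff] at h
    simp only [map_mul] at h
    refine ⟨fun n h1 h2 x hx => hc n h1 Ω t ?_ x hx, fun b h1 h2 => he b h1 Ω t ?_⟩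
    · exact left_ne_zero_of_mul (h n (Finset.mem_Icc.2 ⟨h1, h2⟩))
    · exact right_ne_zero_of_mul (h b (Finset.mem_Icc.2 ⟨h1, h2⟩))

end DynModCurve

end

noncomputable section
namespace DynModCurve

/-! ### Dynatomic polynomials at good parameters -/

section Dynatomic

open Polynomial

/-- Specialization of the parameter in a polynomial over `ℤ[t]`. -/
def atParam {R : Type*} [CommRing R] (t : R) : ℤ[X][X] →+* R[X] :=
  mapRingHom ((aeval t : ℤ[X] →ₐ[ℤ] R) : ℤ[X] →+* R)

section Ring

variable {R : Type*} [CommRing R]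

lemma atParam_iterPoly (t : R) (n : ℕ) : atParam t (iterPoly n) = iter (C t) X n := by
  simp [atParam, iterPoly, map_iter]

lemma atParam_X (t : R) : atParam t X = X := by simp [atParam]

lemma aevalAeval_eq_eval (t x : R) (p : ℤ[X][X]) :
    aevalAeval t x p = (atParam t p).eval x := by
  have h : ((aevalAeval t x : ℤ[X][X] →ₐ[ℤ] R) : ℤ[X][X] →+* R) =
      (evalRingHom x).comp (atParam t) := by
    refine Polynomial.ringHom_ext' (Polynomial.ringHom_ext' (RingHom.ext_int _ _) ?_) ?_ <;>
    simp [atParam]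
  exact congrArg (fun g : ℤ[X][X] →+* R => g p) h

lemma atParam_comp (t : R) (p q : ℤ[X][X]) :
    atParam t (p.comp q) = (atParam t p).comp (atParam t q) := by
  simp [atParam, Polynomial.map_comp]

lemma iterPoly_sub_X_monic {n : ℕ} (hn : 1 ≤ n) : (iterPoly n - X).Monic :=
  (iter_sub_X_monic_natDegree (X : ℤ[X]) hn).1

/-- The product of the factors of `Φ_N` with the given exponent. -/
def dynFactor (e : ℤ) (N : ℕ) : ℤ[X][X] :=
  ∏ n ∈ N.divisors with ArithmeticFunction.moebius (N / n) = e, (iterPoly n - X)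

lemma dynFactor_monic (e : ℤ) (N : ℕ) : (dynFactor e N).Monic := by
  refine monic_prod_of_monic _ _ fun n hn => iterPoly_sub_X_monic ?_
  exact Nat.pos_of_mem_divisors (Finset.mem_filter.1 hn).1

end Ring

/-- Möbius inversion of the indicator of n = d, whose divisor sums are the indicators of d ∣ n. With
d the exact period of a point, it computes the multiplicity of that point in Φ_N. -/
lemma sum_moebius_dvd {N : ℕ} (hN : 1 ≤ N) (d : ℕ) :
    ∑ n ∈ N.divisors, ArithmeticFunction.moebius (N / n) * (if d ∣ n then 1 else 0 : ℤ) =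
      if d = N then 1 else 0 := by
  have h := (ArithmeticFunction.sum_eq_iff_sum_mul_moebius_eq (R := ℤ)
    (f := fun n => if d = n then 1 else 0) (g := fun n => if d ∣ n then 1 else 0)).1 (by
      intro n hn
      by_cases h : d ∣ n
      · simp [h, Finset.sum_ite_eq, Nat.mem_divisors, hn.ne']
      · simp [h, Finset.sum_ite_eq]) N hN
  rw [← h, ← Nat.sum_divisorsAntidiagonal' (f := fun x y =>
    (ArithmeticFunction.moebius x : ℤ) * (if d ∣ y then 1 else 0 : ℤ))]
  simp

/-- Keeps the factors of exponent 1 and -1 on separate sides, so that multiplicities can be compared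
as natural numbers. -/
lemma sum_filter_moebius (N : ℕ) (c : ℕ → ℤ) :
    ∑ n ∈ N.divisors with ArithmeticFunction.moebius (N / n) = 1, c n =
      ∑ n ∈ N.divisors, ArithmeticFunction.moebius (N / n) * c n +
      ∑ n ∈ N.divisors with ArithmeticFunction.moebius (N / n) = -1, c n := by
  rw [Finset.sum_filter, Finset.sum_filter, ← Finset.sum_add_distrib]
  refine Finset.sum_congr rfl fun n _ => ?_
  rcases ArithmeticFunction.moebius_eq_or (N / n) with h | h | h <;> simp [h]

variable {F : Type*} [Field F]

lemma rootMultiplicity_of_simple {p : F[X]} (hp : p ≠ 0) {x : F} [Decidable (p.eval x = 0)]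
    (h : p.eval x = 0 → p.derivative.eval x ≠ 0) :
    p.rootMultiplicity x = if p.eval x = 0 then 1 else 0 := by
  split_ifs with h0
  · have h1 : ¬ 1 < p.rootMultiplicity x := by
      rw [one_lt_rootMultiplicity_iff_isRoot hp]
      exact fun h2 => h h0 h2.2
    have h2 : 0 < p.rootMultiplicity x := (rootMultiplicity_pos hp).2 h0
    omega
  · exact rootMultiplicity_eq_zero h0

/-- The quadratic map `f_t`. -/
def quad (t : F) : F → F := fun y => y ^ 2 + t

lemma iter_eq_iterate (t x : F) (k : ℕ) : iter t x k = (quad t)^[k] x := rfl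

lemma iter_eq_self_iff (t x : F) (n : ℕ) :
    iter t x n = x ↔ Function.minimalPeriod (quad t) x ∣ n := by
  rw [← Function.isPeriodicPt_iff_minimalPeriod_dvd]; rfl

lemma eval_iter_sub_X (t x : F) (n : ℕ) :
    (iter (C t) X n - X : F[X]).eval x = iter t x n - x := by
  simp [eval_iter]

lemma eval_derivative_iter (t x : F) (n : ℕ) :
    (derivative (iter (C t) X n : F[X])).eval x = iterDeriv t x n := by
  rw [derivative_iter]
  simpa using map_iterDeriv (evalRingHom x) (C t) X n

variable {B : ℕ} {t : F}

open Classical in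
lemma Good.rootMultiplicity_iter (h : Good B t) {n : ℕ} (h1 : 1 ≤ n) (hn : n ≤ B) (x : F) :
    (iter (C t) X n - X : F[X]).rootMultiplicity x =
      if Function.minimalPeriod (quad t) x ∣ n then 1 else 0 := by
  rw [rootMultiplicity_of_simple (iter_sub_X_monic_natDegree t h1).1.ne_zero, eval_iter_sub_X]
  · simp only [sub_eq_zero, iter_eq_self_iff]
  · rw [eval_iter_sub_X, sub_eq_zero]
    intro hx
    rw [derivative_sub, eval_sub, eval_derivative_iter, derivative_X, eval_one, sub_ne_zero]
    exact h.simple n h1 hn x hx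

lemma rootMultiplicity_finset_prod {ι : Type*} (s : Finset ι) (p : ι → F[X])
    (hp : ∀ i ∈ s, p i ≠ 0) (x : F) :
    (∏ i ∈ s, p i).rootMultiplicity x = ∑ i ∈ s, (p i).rootMultiplicity x := by
  classical
  induction s using Finset.induction_on with
  | empty =>
    rw [Finset.prod_empty, Finset.sum_empty]
    exact rootMultiplicity_eq_zero (by simp)
  | insert a s ha ih =>
    have h1 : ∏ i ∈ s, p i ≠ 0 :=
      Finset.prod_ne_zero_iff.2 fun i hi => hp i (Finset.mem_insert_of_mem hi)
    rw [Finset.prod_insert ha, Finset.sum_insert ha,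
      rootMultiplicity_mul (mul_ne_zero (hp a (Finset.mem_insert_self a s)) h1),
      ih fun i hi => hp i (Finset.mem_insert_of_mem hi)]

open Classical in
lemma Good.rootMultiplicity_dynFactor (h : Good B t) (e : ℤ) {N : ℕ} (hN : N ≤ B) (x : F) :
    (atParam t (dynFactor e N)).rootMultiplicity x =
      ∑ n ∈ N.divisors with ArithmeticFunction.moebius (N / n) = e,
        if Function.minimalPeriod (quad t) x ∣ n then 1 else 0 := by
  have h1 : ∀ n ∈ N.divisors.filter (fun n => ArithmeticFunction.moebius (N / n) = e),
      1 ≤ n ∧ n ≤ B := fun n hn =>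
    ⟨Nat.pos_of_mem_divisors (Finset.mem_filter.1 hn).1,
      (Nat.divisor_le (Finset.mem_filter.1 hn).1).trans hN⟩
  simp only [dynFactor, map_prod, map_sub, atParam_iterPoly, atParam_X]
  rw [rootMultiplicity_finset_prod]
  · exact Finset.sum_congr rfl fun n hn => h.rootMultiplicity_iter (h1 n hn).1 (h1 n hn).2 x
  · exact fun n hn => (iter_sub_X_monic_natDegree t (h1 n hn).1).1.ne_zero

-- At a good parameter f^n(x) - x vanishes simply at exactly the points whose period divides n, and
-- `sum_moebius_dvd` cancels everything but exact period N.
open Classical in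
lemma Good.rootMultiplicity_dynFactor_one (h : Good B t) {N : ℕ} (h1 : 1 ≤ N) (hN : N ≤ B) (x : F) :
    (atParam t (dynFactor 1 N)).rootMultiplicity x =
      (if Function.minimalPeriod (quad t) x = N then 1 else 0) +
        (atParam t (dynFactor (-1) N)).rootMultiplicity x := by
  rw [h.rootMultiplicity_dynFactor _ hN, h.rootMultiplicity_dynFactor _ hN]
  have e := sum_filter_moebius N (fun n => if Function.minimalPeriod (quad t) x ∣ n then 1 else 0)
  rw [sum_moebius_dvd h1] at e
  exact_mod_cast e

lemma atParam_ne_zero {R : Type*} [CommRing R] [Nontrivial R] (t : R) {p : ℤ[X][X]}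
    (hp : p.Monic) : atParam t p ≠ 0 :=
  (hp.map _).ne_zero

lemma aeval_apply_X {R : Type*} [CommRing R] (j : ℤ[X] →+* R) (p : ℤ[X]) :
    (aeval (j X) : ℤ[X] →ₐ[ℤ] R) p = j p := by
  have h : ((aeval (j X) : ℤ[X] →ₐ[ℤ] R) : ℤ[X] →+* R) = j :=
    Polynomial.ringHom_ext' (RingHom.ext_int _ _) (by simp)
  exact congrArg (fun g : ℤ[X] →+* R => g p) h

/-- The image of t in an algebraic closure of Frac ℤ[t] is a root of no nonzero integer polynomial,
hence good for every bound. -/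
lemma exists_generic : ∃ (F : Type) (_ : Field F) (_ : IsAlgClosed F) (_ : CharZero F) (τ : F),
    Function.Injective (aeval τ : ℤ[X] →ₐ[ℤ] F) ∧ ∀ B, Good B τ := by
  obtain ⟨F, _, _, j, hj⟩ : ∃ (F : Type) (_ : Field F) (_ : IsAlgClosed F) (j : ℤ[X] →+* F),
      Function.Injective j :=
    ⟨AlgebraicClosure (FractionRing ℤ[X]), inferInstance, inferInstance,
      (algebraMap (FractionRing ℤ[X]) _).comp (algebraMap ℤ[X] (FractionRing ℤ[X])),
      (algebraMap (FractionRing ℤ[X]) _).injective.comp (IsFractionRing.injective _ _)⟩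
  have : CharZero F := ⟨fun m n h => by
    have h1 : j (m : ℤ[X]) = j (n : ℤ[X]) := by simpa using h
    exact_mod_cast hj h1⟩
  have hinj : Function.Injective (aeval (j X) : ℤ[X] →ₐ[ℤ] F) := fun p q h => hj (by
    rwa [aeval_apply_X, aeval_apply_X] at h)
  refine ⟨F, inferInstance, inferInstance, this, j X, hinj, fun B => ?_⟩
  obtain ⟨c, hc, hg⟩ := exists_good_poly.{0} B
  exact hg F (j X) ((map_ne_zero_iff _ hinj).2 hc)

/-- Divisibility by a monic polynomial descends from an algebraic closure of Frac ℤ[t] to ℤ[t][x],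
and over the closure it is a comparison of root multiplicities. All the exact divisions in the
definition of the dynatomic polynomials come from here. -/
lemma dvd_of_generic {p q : ℤ[X][X]} (hp : p.Monic) (hq : q.Monic)
    (H : ∀ (F : Type) [Field F] [CharZero F] (τ : F), (∀ B, Good B τ) →
      ∀ x, (atParam τ p).rootMultiplicity x ≤ (atParam τ q).rootMultiplicity x) : p ∣ q := by
  obtain ⟨F, _, _, _, τ, hinj, hg⟩ := exists_generic
  rw [← map_dvd_map ((aeval τ : ℤ[X] →ₐ[ℤ] F) : ℤ[X] →+* F) hinj hp]
  change atParam τ p ∣ atParam τ q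
  classical
  rw [IsAlgClosed.dvd_iff_roots_le_roots (atParam_ne_zero τ hp) (atParam_ne_zero τ hq),
    Multiset.le_iff_count]
  intro x
  rw [count_roots, count_roots]
  exact H F τ hg x

lemma dynFactor_dvd {N : ℕ} (hN : 1 ≤ N) : dynFactor (-1) N ∣ dynFactor 1 N := by
  classical
  refine dvd_of_generic (dynFactor_monic _ _) (dynFactor_monic _ _) fun F _ _ τ hg x => ?_
  rw [(hg N).rootMultiplicity_dynFactor_one hN le_rfl]
  omega

lemma dvd_imp_mul_divByMonic {R : Type*} [CommRing R] {p q : R[X]} (hp : p.Monic) (h : p ∣ q) :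
    p * (q /ₘ p) = q := by
  have := modByMonic_add_div q p
  rwa [(modByMonic_eq_zero_iff_dvd hp).2 h, zero_add] at this

lemma dynFactor_mul_dynatomic {N : ℕ} (hN : 1 ≤ N) :
    dynFactor (-1) N * dynatomic N = dynFactor 1 N :=
  dvd_imp_mul_divByMonic (dynFactor_monic _ _) (dynFactor_dvd hN)

lemma dynatomic_monic {N : ℕ} (hN : 1 ≤ N) : (dynatomic N).Monic :=
  (dynFactor_monic (-1) N).of_mul_monic_left (dynFactor_mul_dynatomic hN ▸ dynFactor_monic 1 N)

open Classical in
lemma Good.rootMultiplicity_dynatomic (h : Good B t) {N : ℕ} (h1 : 1 ≤ N) (hN : N ≤ B) (x : F) :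
    (atParam t (dynatomic N)).rootMultiplicity x =
      if Function.minimalPeriod (quad t) x = N then 1 else 0 := by
  have e := h.rootMultiplicity_dynFactor_one h1 hN x
  rw [← dynFactor_mul_dynatomic h1, map_mul, rootMultiplicity_mul, add_comm] at e
  · exact Nat.add_right_cancel e
  · exact mul_ne_zero (atParam_ne_zero t (dynFactor_monic _ _))
      (atParam_ne_zero t (dynatomic_monic h1))

lemma Good.eval_dynatomic_eq_zero_iff (h : Good B t) {N : ℕ} (h1 : 1 ≤ N) (hN : N ≤ B) (x : F) :
    (atParam t (dynatomic N)).eval x = 0 ↔ Function.minimalPeriod (quad t) x = N := by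
  classical
  have e := h.rootMultiplicity_dynatomic h1 hN x
  have := rootMultiplicity_pos (atParam_ne_zero t (dynatomic_monic h1)) (x := x)
  rw [IsRoot.def] at this
  rw [← this, e]
  split_ifs with h2 <;> simp [h2]

lemma Good.eval_derivative_dynatomic_ne_zero (h : Good B t) {N : ℕ} (h1 : 1 ≤ N)
    (hN : N ≤ B) {x : F} (hx : (atParam t (dynatomic N)).eval x = 0) :
    (derivative (atParam t (dynatomic N))).eval x ≠ 0 := by
  classical
  intro h0
  have := (one_lt_rootMultiplicity_iff_isRoot (atParam_ne_zero t (dynatomic_monic h1))).2 ⟨hx, h0⟩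
  rw [h.rootMultiplicity_dynatomic h1 hN x] at this
  split_ifs at this <;> omega

/-- A preperiodic orbit passing through 0 would make the critical point itself preperiodic with the
same bounds. -/
lemma Good.iter_ne_zero (h : Good B t) {M N : ℕ} (hM : M ≤ B) (h1 : 1 ≤ N) (hN : N ≤ B) {x : F}
    (hx : iter t x (M + N) = iter t x M) (k : ℕ) : iter t x k ≠ 0 := by
  intro h0
  apply h.critical' hM h1 hN
  rw [← h0, iter_iter, iter_iter]
  have e : ∀ j, iter t x (M + N + j) = iter t x (M + j) := fun j => by
    rw [iter_add, hx, ← iter_add]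
  rw [show k + (M + N) = M + N + k by ring, e, add_comm]

lemma Good.iterDeriv_ne_zero [CharZero F] (h : Good B t) {M N : ℕ} (hM : M ≤ B) (h1 : 1 ≤ N)
    (hN : N ≤ B) {x : F} (hx : iter t x (M + N) = iter t x M) (n : ℕ) : iterDeriv t x n ≠ 0 :=
  Finset.prod_ne_zero_iff.2 fun k _ => mul_ne_zero two_ne_zero (h.iter_ne_zero hM h1 hN hx k)

lemma iter_add_minimalPeriod (t x : F) (M : ℕ) {N : ℕ}
    (h : Function.minimalPeriod (quad t) (iter t x M) = N) : iter t x (M + N) = iter t x M := by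
  rw [iter_add, iter_eq_self_iff, h]

-- By the chain rule the derivative of Φ_N ∘ f^M is the product of (f^M)'(x), nonzero because the
-- orbit avoids 0, and Φ_N'(f^M(x)), nonzero because Φ_N has simple roots. So the composite has
-- simple roots too.
open Classical in
lemma Good.rootMultiplicity_dynatomic_comp [CharZero F] (h : Good B t) {M N : ℕ} (hM : M ≤ B)
    (h1 : 1 ≤ N) (hN : N ≤ B) (x : F) :
    (atParam t ((dynatomic N).comp (iterPoly M))).rootMultiplicity x =
      if Function.minimalPeriod (quad t) (iter t x M) = N then 1 else 0 := by
  have hm : (atParam t ((dynatomic N).comp (iterPoly M))) ≠ 0 := by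
    refine atParam_ne_zero t ((dynatomic_monic h1).comp (iter_monic_natDegree _ _).1 ?_)
    rw [iterPoly, (iter_monic_natDegree _ _).2]; positivity
  have hev : (atParam t ((dynatomic N).comp (iterPoly M))).eval x =
      (atParam t (dynatomic N)).eval (iter t x M) := by
    rw [atParam_comp, eval_comp, atParam_iterPoly, eval_iter]
  rw [rootMultiplicity_of_simple hm, hev]
  · simp only [h.eval_dynatomic_eq_zero_iff h1 hN]
  · rw [hev]
    intro h0
    rw [atParam_comp, derivative_comp, eval_mul, eval_comp, atParam_iterPoly, eval_derivative_iter,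
      eval_iter]
    refine mul_ne_zero ?_ (h.eval_derivative_dynatomic_ne_zero h1 hN h0)
    exact h.iterDeriv_ne_zero hM h1 hN
      (iter_add_minimalPeriod t x M ((h.eval_dynatomic_eq_zero_iff h1 hN _).1 h0)) M

lemma minimalPeriod_iter_succ {t x : F} {M N : ℕ} (h1 : 1 ≤ N)
    (h : Function.minimalPeriod (quad t) (iter t x M) = N) :
    Function.minimalPeriod (quad t) (iter t x (M + 1)) = N := by
  rw [iter_eq_iterate, Function.iterate_succ_apply', ← iter_eq_iterate,
    Function.minimalPeriod_apply, h]
  exact Function.minimalPeriod_pos_iff_mem_periodicPts.1 (by omega)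

lemma dynatomic_comp_monic {N : ℕ} (h1 : 1 ≤ N) (M : ℕ) :
    ((dynatomic N).comp (iterPoly M)).Monic := by
  refine (dynatomic_monic h1).comp (iter_monic_natDegree _ _).1 ?_
  rw [iterPoly, (iter_monic_natDegree _ _).2]; positivity

lemma dynatomic_comp_dvd {N : ℕ} (h1 : 1 ≤ N) (M : ℕ) :
    (dynatomic N).comp (iterPoly M) ∣ (dynatomic N).comp (iterPoly (M + 1)) := by
  classical
  refine dvd_of_generic (dynatomic_comp_monic h1 _) (dynatomic_comp_monic h1 _)
    fun F _ _ τ hg x => ?_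
  rw [(hg (M + N)).rootMultiplicity_dynatomic_comp (by omega) h1 (by omega),
    (hg (M + 1 + N)).rootMultiplicity_dynatomic_comp (by omega) h1 (by omega)]
  split_ifs with h2 h3
  · rfl
  · exact absurd (minimalPeriod_iter_succ h1 h2) h3
  · omega
  · omega

lemma genDynatomic_succ_mul {N : ℕ} (h1 : 1 ≤ N) (M : ℕ) :
    (dynatomic N).comp (iterPoly M) * genDynatomic (M + 1) N =
      (dynatomic N).comp (iterPoly (M + 1)) :=
  dvd_imp_mul_divByMonic (dynatomic_comp_monic h1 M) (dynatomic_comp_dvd h1 M)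

lemma genDynatomic_monic {N : ℕ} (h1 : 1 ≤ N) : ∀ M, (genDynatomic M N).Monic
  | 0 => dynatomic_monic h1
  | M + 1 => (dynatomic_comp_monic h1 M).of_mul_monic_left
      (genDynatomic_succ_mul h1 M ▸ dynatomic_comp_monic h1 (M + 1))

lemma genDynatomic_dvd {N : ℕ} (h1 : 1 ≤ N) (M : ℕ) :
    genDynatomic M N ∣ (dynatomic N).comp (iterPoly M) := by
  cases M with
  | zero => simp [genDynatomic, iterPoly]
  | succ M => exact ⟨_, (by rw [← genDynatomic_succ_mul h1 M, mul_comm])⟩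

lemma dynatomic_dvd {N : ℕ} (h1 : 1 ≤ N) : dynatomic N ∣ iterPoly N - X := by
  classical
  refine dvd_of_generic (dynatomic_monic h1) (iterPoly_sub_X_monic h1) fun F _ _ τ hg x => ?_
  rw [(hg N).rootMultiplicity_dynatomic h1 le_rfl, map_sub, atParam_X, atParam_iterPoly,
    (hg N).rootMultiplicity_iter h1 le_rfl]
  split_ifs with h2 h3 <;> first | omega | exact absurd h2.dvd h3

/-- A point of generalized dynatomic type is preperiodic. -/
lemma iter_eq_of_eval_genDynatomic {R : Type*} [CommRing R] {t x : R} {M N : ℕ} (h1 : 1 ≤ N)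
    (h : aevalAeval t x (genDynatomic M N) = 0) : iter t x (M + N) = iter t x M := by
  obtain ⟨q, hq⟩ := genDynatomic_dvd h1 M
  obtain ⟨r, hr⟩ := dynatomic_dvd h1
  have h2 : (atParam t (dynatomic N)).eval (iter t x M) = 0 := by
    rw [← eval_iter, ← atParam_iterPoly, ← eval_comp, ← atParam_comp, hq, map_mul, eval_mul,
      ← aevalAeval_eq_eval, h, zero_mul]
  have h3 := congrArg (fun p => (atParam t p).eval (iter t x M)) hr
  simp only [map_mul, eval_mul, h2, zero_mul, map_sub, atParam_X, atParam_iterPoly, eval_sub,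
    eval_X, eval_iter, iter_iter] at h3
  exact sub_eq_zero.1 h3

lemma aevalAeval_dynatomic_iter {R : Type*} [CommRing R] {t x : R} {M N : ℕ} (h1 : 1 ≤ N)
    (h : aevalAeval t x (genDynatomic M N) = 0) :
    (atParam t (dynatomic N)).eval (iter t x M) = 0 := by
  obtain ⟨q, hq⟩ := genDynatomic_dvd h1 M
  rw [← eval_iter, ← atParam_iterPoly, ← eval_comp, ← atParam_comp, hq, map_mul, eval_mul,
      ← aevalAeval_eq_eval, h, zero_mul]

/-- `x` has preperiod `M` and eventual period `N ≥ 1` under `f`. -/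
structure HasPortrait {α : Type*} (f : α → α) (x : α) (M N : ℕ) : Prop where
  pos : 1 ≤ N
  period : Function.minimalPeriod f (f^[M] x) = N
  not_periodic : ∀ m < M, f^[m] x ∉ Function.periodicPts f

/-- Subtracting multiplicities, x is a root for M + 1 iff f^(M+1)(x) has exact period N and f^M(x)
does not. The latter says that f^M(x) is not periodic, since a periodic point has the same period as
its image. -/
lemma Good.eval_genDynatomic_eq_zero_iff [CharZero F] (h : Good B t) {M N : ℕ} (hM : M ≤ B)
    (h1 : 1 ≤ N) (hN : N ≤ B) (x : F) :
    aevalAeval t x (genDynatomic M N) = 0 ↔ HasPortrait (quad t) x M N := by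
  classical
  rw [aevalAeval_eq_eval]
  cases M with
  | zero =>
    rw [genDynatomic, h.eval_dynatomic_eq_zero_iff h1 hN]
    exact ⟨fun h2 => ⟨h1, h2, by simp⟩, fun h2 => h2.period⟩
  | succ M =>
    have e := h.rootMultiplicity_dynatomic_comp hM h1 hN x
    rw [← genDynatomic_succ_mul h1 M, map_mul, rootMultiplicity_mul (mul_ne_zero
      (atParam_ne_zero t (dynatomic_comp_monic h1 M)) (atParam_ne_zero t (genDynatomic_monic h1 _))),
      h.rootMultiplicity_dynatomic_comp (by omega) h1 hN x] at e
    have hpos := rootMultiplicity_pos (atParam_ne_zero t (genDynatomic_monic h1 (M + 1))) (x := x)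
    rw [IsRoot.def] at hpos
    rw [← hpos]
    constructor
    · intro h2
      have h3 : Function.minimalPeriod (quad t) (iter t x (M + 1)) = N := by
        by_contra h3; rw [if_neg h3] at e; omega
      have h4 : Function.minimalPeriod (quad t) (iter t x M) ≠ N := by
        intro h4; rw [if_pos h4, if_pos h3] at e; omega
      refine ⟨h1, h3, fun m hm hp => h4 ?_⟩
      have hp' : iter t x M ∈ Function.periodicPts (quad t) := by
        obtain ⟨c, rfl⟩ := Nat.exists_eq_add_of_le (Nat.lt_succ_iff.1 hm)
        rw [iter_add]
        obtain ⟨n, hn, hp⟩ := hp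
        exact ⟨n, hn, hp.apply_iterate c⟩
      rw [← h3, iter_eq_iterate t x (M + 1), Function.iterate_succ_apply', ← iter_eq_iterate,
        Function.minimalPeriod_apply hp']
    · intro h2
      have h3 : Function.minimalPeriod (quad t) (iter t x (M + 1)) = N := h2.period
      have h4 : Function.minimalPeriod (quad t) (iter t x M) ≠ N := fun h4 =>
        h2.not_periodic M (by omega) (Function.minimalPeriod_pos_iff_mem_periodicPts.1 (by
          rw [← iter_eq_iterate, h4]; omega))
      rw [if_pos h3, if_neg h4] at e
      omega

open Classical in
lemma Good.ncard_iter_eq_self [IsAlgClosed F] (h : Good B t) {n : ℕ} (h1 : 1 ≤ n) (hn : n ≤ B) :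
    {x | iter t x n = x}.Finite ∧ {x | iter t x n = x}.ncard = 2 ^ n := by
  obtain ⟨hm, hd⟩ := iter_sub_X_monic_natDegree t h1
  have hs : {x | iter t x n = x} = ((iter (C t) X n - X : F[X]).roots.toFinset : Set F) := by
    ext x
    simp [hm.ne_zero, eval_iter, sub_eq_zero]
  have hnd : (iter (C t) X n - X : F[X]).roots.Nodup := by
    rw [Multiset.nodup_iff_count_le_one]
    intro x
    rw [count_roots, h.rootMultiplicity_iter h1 hn]
    split_ifs <;> omega
  rw [hs]
  refine ⟨Finset.finite_toSet _, ?_⟩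
  rw [Set.ncard_coe_finset, Multiset.toFinset_card_of_nodup hnd,
    ← (IsAlgClosed.splits (iter (C t) X n - X : F[X])).natDegree_eq_card_roots, hd]

lemma Good.finite_minimalPeriod [IsAlgClosed F] (h : Good B t) {N : ℕ} (h1 : 1 ≤ N) (hN : N ≤ B) :
    {x | Function.minimalPeriod (quad t) x = N}.Finite :=
  (h.ncard_iter_eq_self h1 hN).1.subset fun x hx => by
    rw [Set.mem_ofPred_eq, iter_eq_self_iff, hx]

/-- The number of points of exact period `N` is `N * R(N)`. -/
lemma Good.ncard_minimalPeriod [IsAlgClosed F] (h : Good B t) {N : ℕ} (h1 : 1 ≤ N) (hN : N ≤ B) :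
    ({x | Function.minimalPeriod (quad t) x = N}.ncard : ℚ) = N * numCycles N := by
  classical
  -- Inversion is done on the divisor-closed set {1, ..., B}, since goodness controls only these
  -- periods.
  have key := (ArithmeticFunction.sum_eq_iff_sum_mul_moebius_eq_on (R := ℚ)
    (f := fun n => ({x | Function.minimalPeriod (quad t) x = n}.ncard : ℚ)) (g := fun n => 2 ^ n)
    {n | n ≤ B ∧ 1 ≤ n} (fun m n hmn hn => ⟨(Nat.le_of_dvd hn.2 hmn).trans hn.1,
      Nat.pos_of_dvd_of_pos hmn hn.2⟩)).1 (by
      rintro n - ⟨hn, hn1⟩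
      have hU : {x | iter t x n = x} =
          ⋃ d ∈ n.divisors, {x | Function.minimalPeriod (quad t) x = d} := by
        ext x
        simp [iter_eq_self_iff, (show n ≠ 0 by omega)]
      have hfin : ∀ d ∈ n.divisors, {x | Function.minimalPeriod (quad t) x = d}.Finite :=
        fun d hd => h.finite_minimalPeriod (Nat.pos_of_mem_divisors hd)
          ((Nat.divisor_le hd).trans hn)
      have hc := Set.Finite.ncard_biUnion n.divisors.finite_toSet
        (s := fun d => {x | Function.minimalPeriod (quad t) x = d}) hfin (by
          intro a _ b _ hab
          refine Set.disjoint_left.2 fun x hx hx' => hab ?_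
          exact hx.symm.trans hx')
      rw [finsum_mem_coe_finset] at hc
      simp only [Finset.mem_coe] at hc
      rw [← Nat.cast_sum, ← hc, ← hU, (h.ncard_iter_eq_self hn1 hn).2]
      simp) N h1 ⟨hN, h1⟩
  rw [← key, numCycles, Nat.sum_divisorsAntidiagonal' (f := fun x y =>
    ((ArithmeticFunction.moebius x : ℤ) : ℚ) * 2 ^ y)]
  field_simp

end Dynatomic

end DynModCurve

end

noncomputable section
namespace DynModCurve

/-! ### Admissible graphs as dynamical systems -/

namespace DGraph

universe v
variable {V : Type v} {G : DGraph V} {P Q R : V} {S : Set V}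

lemma Admissible.adj_next (hG : G.Admissible) (hP : P ∈ G.verts) : G.Adj P (G.next P) := by
  have h : ∃ Q, G.Adj P Q := by
    obtain ⟨Q, hQ⟩ := Set.ncard_eq_one.1 (hG.outDegree P hP)
    exact ⟨Q, show Q ∈ {Q | G.Adj P Q} by rw [hQ]; rfl⟩
  rw [next, dif_pos h]
  exact h.choose_spec

lemma Admissible.eq_next (hG : G.Admissible) (h : G.Adj P Q) : Q = G.next P := by
  obtain ⟨R, hR⟩ := Set.ncard_eq_one.1 (hG.outDegree P (G.left_mem h))
  have h1 : Q ∈ {Q | G.Adj P Q} := h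
  have h2 : G.next P ∈ {Q | G.Adj P Q} := hG.adj_next (G.left_mem h)
  rw [hR] at h1 h2
  exact h1.trans h2.symm

lemma Admissible.adj_iff (hG : G.Admissible) : G.Adj P Q ↔ P ∈ G.verts ∧ G.next P = Q :=
  ⟨fun h => ⟨G.left_mem h, (hG.eq_next h).symm⟩, fun h => h.2 ▸ hG.adj_next h.1⟩

lemma Admissible.next_mem (hG : G.Admissible) (hP : P ∈ G.verts) : G.next P ∈ G.verts :=
  G.right_mem (hG.adj_next hP)

lemma Admissible.iterate_mem (hG : G.Admissible) (hP : P ∈ G.verts) (k : ℕ) :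
    G.next^[k] P ∈ G.verts := by
  induction k with
  | zero => exact hP
  | succ k ih => rw [Function.iterate_succ_apply']; exact hG.next_mem ih

lemma Admissible.exists_opp (hG : G.Admissible) (hP : P ∈ G.verts) :
    ∃ Q ∈ G.verts, Q ≠ P ∧ G.next Q = G.next P ∧
      ∀ R ∈ G.verts, G.next R = G.next P → R = P ∨ R = Q := by
  have hfin : {R | G.Adj R (G.next P)}.Finite :=
    hG.finite.subset fun R hR => G.left_mem hR
  have hP' : P ∈ {R | G.Adj R (G.next P)} := hG.adj_next hP
  rcases hG.inDegree _ (hG.next_mem hP) with h | h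
  · rw [Set.ncard_eq_zero hfin] at h
    rw [h] at hP'
    exact absurd hP' (Set.notMem_empty _)
  · obtain ⟨x, y, hxy, he⟩ := Set.ncard_eq_two.1 h
    have key : ∀ x y, x ≠ y → {R | G.Adj R (G.next P)} = {x, y} → P = x →
        ∃ Q ∈ G.verts, Q ≠ P ∧ G.next Q = G.next P ∧
          ∀ R ∈ G.verts, G.next R = G.next P → R = P ∨ R = Q := by
      rintro x y hxy he rfl
      have hy : y ∈ {R | G.Adj R (G.next P)} := by rw [he]; simp
      refine ⟨y, G.left_mem hy, hxy.symm, (hG.eq_next hy).symm, fun R hR hR' => ?_⟩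
      have : R ∈ {R | G.Adj R (G.next P)} := by
        change G.Adj R (G.next P); rw [← hR']; exact hG.adj_next hR
      rw [he] at this
      exact this
    have hP2 := hP'
    rw [he] at hP2
    rcases hP2 with h1 | h1
    · exact key x y hxy he h1
    · exact key y x hxy.symm (by rw [he, Set.pair_comm]) h1

lemma Admissible.opp_spec (hG : G.Admissible) (hP : P ∈ G.verts) :
    G.opp P ∈ G.verts ∧ G.opp P ≠ P ∧ G.next (G.opp P) = G.next P := by
  obtain ⟨Q, h1, h2, h3, -⟩ := hG.exists_opp hP
  have h : ∃ Q ∈ G.verts, Q ≠ P ∧ G.next Q = G.next P := ⟨Q, h1, h2, h3⟩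
  rw [opp, dif_pos h]
  exact h.choose_spec

lemma Admissible.opp_mem (hG : G.Admissible) (hP : P ∈ G.verts) : G.opp P ∈ G.verts :=
  (hG.opp_spec hP).1

lemma Admissible.opp_ne (hG : G.Admissible) (hP : P ∈ G.verts) : G.opp P ≠ P :=
  (hG.opp_spec hP).2.1

lemma Admissible.next_opp (hG : G.Admissible) (hP : P ∈ G.verts) :
    G.next (G.opp P) = G.next P :=
  (hG.opp_spec hP).2.2

lemma Admissible.eq_or_eq_opp (hG : G.Admissible) (hP : P ∈ G.verts) (hR : R ∈ G.verts)
    (h : G.next R = G.next P) : R = P ∨ R = G.opp P := by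
  obtain ⟨Q, h1, h2, h3, h4⟩ := hG.exists_opp hP
  rcases h4 R hR h with h5 | h5
  · exact Or.inl h5
  · refine Or.inr ?_
    rcases h4 _ (hG.opp_mem hP) (hG.next_opp hP) with h6 | h6
    · exact absurd h6 (hG.opp_ne hP)
    · rw [h5, h6]

lemma Admissible.opp_opp (hG : G.Admissible) (hP : P ∈ G.verts) : G.opp (G.opp P) = P := by
  have h := hG.opp_mem hP
  rcases hG.eq_or_eq_opp hP (hG.opp_mem h) (by rw [hG.next_opp h, hG.next_opp hP]) with h1 | h1
  · exact h1
  · exact absurd h1 (hG.opp_ne h)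

/-- A set of vertices stable under `f` and `-`. -/
structure Closed (G : DGraph V) (S : Set V) : Prop where
  subset : S ⊆ G.verts
  next : ∀ P ∈ S, G.next P ∈ S
  opp : ∀ P ∈ S, G.opp P ∈ S

lemma Closed.iterate (hS : G.Closed S) (hP : P ∈ S) (k : ℕ) : G.next^[k] P ∈ S := by
  induction k with
  | zero => exact hP
  | succ k ih => rw [Function.iterate_succ_apply']; exact hS.next _ ih

lemma Closed.iterate_of_le (hS : G.Closed S) {k l : ℕ} (hP : G.next^[k] P ∈ S) (h : k ≤ l) :
    G.next^[l] P ∈ S := by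
  obtain ⟨c, rfl⟩ := Nat.exists_eq_add_of_le h
  rw [add_comm, Function.iterate_add_apply]
  exact hS.iterate hP c

lemma Closed.mem_of_opp_mem (hG : G.Admissible) (hS : G.Closed S) (hP : P ∈ G.verts)
    (h : G.opp P ∈ S) : P ∈ S := by
  rw [← hG.opp_opp hP]; exact hS.opp _ h

/-- A vertex of `G` with the same image as a vertex of a closed set lies in it. -/
lemma Closed.mem_of_next_eq (hG : G.Admissible) (hS : G.Closed S) (hP : P ∈ S)
    (hQ : Q ∈ G.verts) (h : G.next Q = G.next P) : Q ∈ S := by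
  rcases hG.eq_or_eq_opp (hS.subset hP) hQ h with h1 | h1
  · rwa [h1]
  · rw [h1]; exact hS.opp _ hP

lemma Admissible.closed_verts (hG : G.Admissible) : G.Closed G.verts :=
  ⟨subset_rfl, fun _ => hG.next_mem, fun _ => hG.opp_mem⟩

lemma Closed.union {T : Set V} (hS : G.Closed S) (hT : G.Closed T) : G.Closed (S ∪ T) :=
  ⟨Set.union_subset hS.subset hT.subset,
    fun P hP => hP.imp (hS.next P) (hT.next P), fun P hP => hP.imp (hS.opp P) (hT.opp P)⟩

lemma self_mem_bigOrbit (P : V) : P ∈ G.bigOrbit P := ⟨0, Or.inl rfl⟩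

lemma iterate_mem_bigOrbit (P : V) (k : ℕ) : G.next^[k] P ∈ G.bigOrbit P := ⟨k, Or.inl rfl⟩

lemma Admissible.closed_bigOrbit (hG : G.Admissible) (hP : P ∈ G.verts) :
    G.Closed (G.bigOrbit P) := by
  refine ⟨?_, ?_, ?_⟩
  · rintro Q ⟨k, rfl | rfl⟩
    · exact hG.iterate_mem hP k
    · exact hG.opp_mem (hG.iterate_mem hP k)
  · rintro Q ⟨k, rfl | rfl⟩
    · exact ⟨k + 1, Or.inl (by rw [Function.iterate_succ_apply'])⟩
    · exact ⟨k + 1, Or.inl (by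
        rw [hG.next_opp (hG.iterate_mem hP k), Function.iterate_succ_apply'])⟩
  · rintro Q ⟨k, rfl | rfl⟩
    · exact ⟨k, Or.inr rfl⟩
    · exact ⟨k, Or.inl (hG.opp_opp (hG.iterate_mem hP k))⟩

lemma Closed.bigOrbit_subset (hS : G.Closed S) (hP : P ∈ S) : G.bigOrbit P ⊆ S := by
  rintro Q ⟨k, rfl | rfl⟩
  · exact hS.iterate hP k
  · exact hS.opp _ (hS.iterate hP k)

lemma Admissible.iterate_mem_periodicPts (hG : G.Admissible) (hP : P ∈ G.verts) :
    ∃ m ≤ G.verts.ncard, ∃ N, 1 ≤ N ∧ N ≤ G.verts.ncard ∧ G.next^[m + N] P = G.next^[m] P := by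
  have hmaps : ∀ k ∈ Finset.range (G.verts.ncard + 1), G.next^[k] P ∈ hG.finite.toFinset :=
    fun k _ => by simpa using hG.iterate_mem hP k
  obtain ⟨a, ha, b, hb, hab, he⟩ := Finset.exists_ne_map_eq_of_card_lt_of_maps_to
    (by rw [Finset.card_range, Set.ncard_eq_toFinset_card _ hG.finite]; omega) hmaps
  rw [Finset.mem_range] at ha hb
  rcases lt_or_gt_of_ne hab with h | h
  · exact ⟨a, by omega, b - a, by omega, by omega, by rw [Nat.add_sub_cancel' h.le]; exact he.symm⟩
  · exact ⟨b, by omega, a - b, by omega, by omega, by rw [Nat.add_sub_cancel' h.le]; exact he⟩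

lemma iterate_add_eq {α : Type*} {f : α → α} {x : α} {m N : ℕ} (h : f^[m + N] x = f^[m] x)
    {k : ℕ} (hk : m ≤ k) : f^[k + N] x = f^[k] x := by
  obtain ⟨c, rfl⟩ := Nat.exists_eq_add_of_le hk
  rw [show m + c + N = c + (m + N) by ring, Function.iterate_add_apply, h,
    ← Function.iterate_add_apply, add_comm c m]

/-- After as many steps as there are vertices, every orbit is in a cycle. -/
lemma Admissible.exists_period (hG : G.Admissible) (hP : P ∈ G.verts) :
    ∃ N, 1 ≤ N ∧ N ≤ G.verts.ncard ∧ ∀ k, G.verts.ncard ≤ k → G.next^[k + N] P = G.next^[k] P := by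
  obtain ⟨m, hm, N, h1, hN, he⟩ := hG.iterate_mem_periodicPts hP
  exact ⟨N, h1, hN, fun k hk => iterate_add_eq he (hm.trans hk)⟩

lemma Admissible.hasPortrait (hG : G.Admissible) (hP : P ∈ G.verts) :
    HasPortrait G.next P (G.preperiod P) (G.eventualPeriod P) := by
  obtain ⟨m, hm, N, h1, hN, he⟩ := hG.iterate_mem_periodicPts hP
  have hne : {m | G.next^[m] P ∈ Function.periodicPts G.next}.Nonempty :=
    ⟨m, N, h1, by
      change G.next^[N] (G.next^[m] P) = G.next^[m] P
      rw [← Function.iterate_add_apply, add_comm, he]⟩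
  exact ⟨Function.minimalPeriod_pos_of_mem_periodicPts (Nat.sInf_mem hne), rfl,
    fun k hk => Nat.notMem_of_lt_sInf hk⟩

lemma Admissible.preperiod_le (hG : G.Admissible) (hP : P ∈ G.verts) :
    G.preperiod P ≤ G.verts.ncard := by
  obtain ⟨m, hm, N, h1, hN, he⟩ := hG.iterate_mem_periodicPts hP
  refine le_trans (Nat.sInf_le ?_) hm
  refine ⟨N, h1, ?_⟩
  change G.next^[N] (G.next^[m] P) = G.next^[m] P
  rw [← Function.iterate_add_apply, add_comm, he]

lemma Admissible.eventualPeriod_le (hG : G.Admissible) (hP : P ∈ G.verts) :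
    G.eventualPeriod P ≤ G.verts.ncard := by
  obtain ⟨N, h1, hN, he⟩ := hG.exists_period hP
  have hp := hG.hasPortrait hP
  refine (Nat.le_of_dvd h1 ?_).trans hN
  have hper : G.next^[G.preperiod P] P ∈ Function.periodicPts G.next := by
    apply Function.minimalPeriod_pos_iff_mem_periodicPts.1
    rw [hp.period]; exact hp.pos
  rw [← hp.period, ← Function.minimalPeriod_apply_iterate hper G.verts.ncard]
  apply Function.IsPeriodicPt.minimalPeriod_dvd
  change G.next^[N] (G.next^[G.verts.ncard] (G.next^[G.preperiod P] P)) =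
    G.next^[G.verts.ncard] (G.next^[G.preperiod P] P)
  rw [← Function.iterate_add_apply, ← Function.iterate_add_apply, ← Function.iterate_add_apply,
    show N + G.verts.ncard + G.preperiod P = (G.verts.ncard + G.preperiod P) + N by ring,
    he _ (by omega)]

end DGraph

/-! ### Portraits -/

section Portrait

variable {α : Type*} {f : α → α} {x : α} {M N : ℕ}

lemma HasPortrait.mem_periodicPts (h : HasPortrait f x M N) : f^[M] x ∈ Function.periodicPts f :=
  Function.minimalPeriod_pos_iff_mem_periodicPts.1 (by rw [h.period]; exact h.pos)

lemma HasPortrait.iterate_mem (h : HasPortrait f x M N) {k : ℕ} (hk : M ≤ k) :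
    f^[k] x ∈ Function.periodicPts f ∧ Function.minimalPeriod f (f^[k] x) = N := by
  obtain ⟨c, rfl⟩ := Nat.exists_eq_add_of_le hk
  have hm := h.mem_periodicPts
  rw [add_comm, Function.iterate_add_apply]
  refine ⟨?_, by rw [Function.minimalPeriod_apply_iterate hm, h.period]⟩
  obtain ⟨n, hn, hp⟩ := hm
  exact ⟨n, hn, hp.apply_iterate c⟩

lemma HasPortrait.iterate_add (h : HasPortrait f x M N) {k : ℕ} (hk : M ≤ k) (q : ℕ) :
    f^[k + N * q] x = f^[k] x := by
  rw [add_comm, Function.iterate_add_apply]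
  refine Function.isPeriodicPt_iff_minimalPeriod_dvd.2 ?_
  rw [(h.iterate_mem hk).2]
  exact dvd_mul_right _ _

lemma HasPortrait.iterate_mod (h : HasPortrait f x M N) {k : ℕ} (hk : M ≤ k) :
    f^[k] x = f^[M + (k - M) % N] x := by
  have := h.iterate_add (k := M + (k - M) % N) (by omega) ((k - M) / N)
  rw [← this]
  congr 1
  have := Nat.mod_add_div (k - M) N
  omega

lemma HasPortrait.iterate_eq_iff (h : HasPortrait f x M N) {k l : ℕ} (hkl : k ≤ l) :
    f^[k] x = f^[l] x ↔ k = l ∨ (M ≤ k ∧ N ∣ l - k) := by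
  obtain ⟨c, rfl⟩ := Nat.exists_eq_add_of_le hkl
  rw [Nat.add_sub_cancel_left]
  by_cases hk : M ≤ k
  · have h1 : f^[k] x = f^[k + c] x ↔ N ∣ c := by
      rw [eq_comm, add_comm, Function.iterate_add_apply, ← (h.iterate_mem hk).2,
        ← Function.isPeriodicPt_iff_minimalPeriod_dvd]
      rfl
    rw [h1]
    constructor
    · exact fun h2 => Or.inr ⟨hk, h2⟩
    · rintro (h2 | h2)
      · rw [show c = 0 by omega]; exact dvd_zero _
      · exact h2.2
  · constructor
    · intro h1
      by_contra h2
      refine h.not_periodic k (by omega) ⟨c, by omega, ?_⟩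
      change f^[c] (f^[k] x) = f^[k] x
      rw [← Function.iterate_add_apply, add_comm, ← h1]
    · rintro (h2 | h2)
      · rw [show c = 0 by omega]; rfl
      · omega

/-- The portrait records exactly which iterates coincide; `HasPortrait.congr` is the converse.
Together they move portraits between a graph and f_t. -/
lemma HasPortrait.iterate_eq_iff_iterate_eq {β : Type*} {g : β → β} {y : β}
    (h : HasPortrait f x M N) (h' : HasPortrait g y M N) (k l : ℕ) :
    f^[k] x = f^[l] x ↔ g^[k] y = g^[l] y := by
  rcases le_total k l with hkl | hkl
  · rw [h.iterate_eq_iff hkl, h'.iterate_eq_iff hkl]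
  · rw [eq_comm (a := f^[k] x), h.iterate_eq_iff hkl, eq_comm (a := g^[k] y),
      h'.iterate_eq_iff hkl]

lemma HasPortrait.congr {β : Type*} {g : β → β} {y : β} (h : HasPortrait f x M N)
    (H : ∀ k l, f^[k] x = f^[l] x ↔ g^[k] y = g^[l] y) : HasPortrait g y M N := by
  have hper : ∀ m n, Function.IsPeriodicPt g n (g^[m] y) ↔ Function.IsPeriodicPt f n (f^[m] x) := by
    intro m n
    change g^[n] (g^[m] y) = g^[m] y ↔ f^[n] (f^[m] x) = f^[m] x
    rw [← Function.iterate_add_apply, ← Function.iterate_add_apply, H]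
  refine ⟨h.pos, ?_, fun m hm hp => h.not_periodic m hm ?_⟩
  · rw [← h.period]
    refine Nat.dvd_antisymm ?_ ?_
    · rw [← Function.isPeriodicPt_iff_minimalPeriod_dvd, hper]
      exact Function.isPeriodicPt_minimalPeriod _ _
    · rw [← Function.isPeriodicPt_iff_minimalPeriod_dvd, ← hper]
      exact Function.isPeriodicPt_minimalPeriod _ _
  · obtain ⟨n, hn, hp⟩ := hp
    exact ⟨n, hn, (hper m n).1 hp⟩

end Portrait

/-! ### Embeddings of graphs into the graph of a quadratic polynomial -/

section Embedding

open DGraph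

universe v
variable {V : Type v} {G : DGraph V} {P : V} {S T : Set V} {F : Type*} [Field F] {t : F}
  {φ ψ : V → F}

/-- `φ` embeds the subgraph with vertex set `S` into the graph of `f_t`. -/
structure IsEmb (G : DGraph V) (S : Set V) (t : F) (φ : V → F) : Prop where
  inj : Set.InjOn φ S
  map_next : ∀ v ∈ S, φ (G.next v) = φ v ^ 2 + t

lemma IsEmb.map_iterate (h : IsEmb G S t φ) (hS : G.Closed S) (hP : P ∈ S) (k : ℕ) :
    φ (G.next^[k] P) = iter t (φ P) k := by
  induction k with
  | zero => rfl
  | succ k ih =>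
    rw [Function.iterate_succ_apply', h.map_next _ (hS.iterate hP k), ih, iter_succ]

/-- Two points with the same image under f_t differ by a sign, and injectivity rules out equality.
-/
lemma IsEmb.map_opp (h : IsEmb G S t φ) (hG : G.Admissible) (hS : G.Closed S) (hP : P ∈ S) :
    φ (G.opp P) = -φ P := by
  have h1 := h.map_next _ hP
  have h2 := h.map_next _ (hS.opp _ hP)
  rw [hG.next_opp (hS.subset hP), h1] at h2
  have h3 : (φ (G.opp P) - φ P) * (φ (G.opp P) + φ P) = 0 := by linear_combination -h2
  rcases mul_eq_zero.1 h3 with h4 | h4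
  · exact absurd (h.inj (hS.opp _ hP) hP (sub_eq_zero.1 h4)) (hG.opp_ne (hS.subset hP))
  · linear_combination h4

lemma IsEmb.mono (h : IsEmb G S t φ) (hTS : T ⊆ S) : IsEmb G T t φ :=
  ⟨h.inj.mono hTS, fun v hv => h.map_next v (hTS hv)⟩

lemma IsEmb.congr (h : IsEmb G S t φ) (hS : G.Closed S) (he : Set.EqOn ψ φ S) : IsEmb G S t ψ :=
  ⟨h.inj.congr he.symm, fun v hv => by rw [he (hS.next v hv), he hv, h.map_next v hv]⟩

lemma IsEmb.ne_zero (h : IsEmb G S t φ) (hG : G.Admissible) (hS : G.Closed S)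
    (ht : Good G.verts.ncard t) (hP : P ∈ S) : φ P ≠ 0 := by
  obtain ⟨N, h1, hN, he⟩ := hG.exists_period (hS.subset hP)
  intro h0
  apply ht.critical N h1 hN
  rw [← h0, ← h.map_iterate hS hP, ← h.map_iterate hS hP, he _ le_rfl]

lemma IsEmb.iterate_eq_iff (h : IsEmb G S t φ) (hS : G.Closed S) (hP : P ∈ S) (k l : ℕ) :
    G.next^[k] P = G.next^[l] P ↔ (quad t)^[k] (φ P) = (quad t)^[l] (φ P) := by
  rw [← iter_eq_iterate, ← iter_eq_iterate, ← h.map_iterate hS hP, ← h.map_iterate hS hP]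
  exact (h.inj.eq_iff (hS.iterate hP k) (hS.iterate hP l)).symm

lemma IsEmb.eqOn_bigOrbit (hG : G.Admissible) (hS : G.Closed S) (hφ : IsEmb G S t φ)
    (hψ : IsEmb G S t ψ) (hP : P ∈ S) (h : φ P = ψ P) : Set.EqOn φ ψ (G.bigOrbit P) := by
  rintro Q ⟨k, rfl | rfl⟩
  · rw [hφ.map_iterate hS hP, hψ.map_iterate hS hP, h]
  · rw [hφ.map_opp hG hS (hS.iterate hP k), hψ.map_opp hG hS (hS.iterate hP k),
      hφ.map_iterate hS hP, hψ.map_iterate hS hP, h]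

/-- Extension of an embedding of `S` by the orbit of a vertex `P`, with prescribed image of `P`. -/
lemma IsEmb.exists_extend (hG : G.Admissible) (hS : G.Closed S) (hφ : IsEmb G S t φ)
    (hP : P ∈ G.verts) (x : F) (hA : ∀ k, iter t x k ∈ φ '' S → G.next^[k] P ∈ S)
    (hB : ∀ k, G.next^[k] P ∈ S → iter t x k = φ (G.next^[k] P))
    (hC : ∀ k l, G.next^[k] P ∉ S → G.next^[l] P ∉ S →
      (G.next^[k] P = G.next^[l] P ↔ iter t x k = iter t x l))
    (h2 : (2 : F) ≠ 0) (hx : ∀ k, iter t x k ≠ 0) :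
    ∃ ψ, IsEmb G (S ∪ G.bigOrbit P) t ψ ∧ Set.EqOn ψ φ S ∧ ψ P = x := by
  classical
  -- The extension is first built as a relation: keep φ on S, and send ±f^k(P) to ±f_t^k(x) for
  -- those f^k(P) outside S.
  let Rel : V → F → Prop := fun v y => (v ∈ S ∧ y = φ v) ∨
    ∃ k, G.next^[k] P ∉ S ∧ ((v = G.next^[k] P ∧ y = iter t x k) ∨
      (v = G.opp (G.next^[k] P) ∧ y = -iter t x k))
  have hmem := hG.iterate_mem hP
  have hA' : ∀ k, G.next^[k] P ∈ S ↔ iter t x k ∈ φ '' S :=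
    fun k => ⟨fun h => ⟨_, h, (hB k h).symm⟩, hA k⟩
  have hC' : ∀ k l, G.next^[k] P = G.next^[l] P ↔ iter t x k = iter t x l := by
    intro k l
    by_cases hk : G.next^[k] P ∈ S <;> by_cases hl : G.next^[l] P ∈ S
    · rw [hB k hk, hB l hl]; exact (hφ.inj.eq_iff hk hl).symm
    · exact iff_of_false (fun h => hl (h ▸ hk)) fun h => hl ((hA' l).2 (h ▸ (hA' k).1 hk))
    · exact iff_of_false (fun h => hk (h ▸ hl)) fun h => hk ((hA' k).2 (h ▸ (hA' l).1 hl))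
    · exact hC k l hk hl
  -- comparison of `f^k(P)` and `-f^l(P)`
  have hD : ∀ k l, G.next^[k] P = G.opp (G.next^[l] P) ↔ iter t x k = -iter t x l := by
    intro k l
    -- On both sides, being opposite means having equal images while being different; in the field
    -- this needs 2 ≠ 0 and an orbit avoiding 0.
    have e1 : G.next^[k] P = G.opp (G.next^[l] P) ↔
        G.next^[k + 1] P = G.next^[l + 1] P ∧ G.next^[k] P ≠ G.next^[l] P := by
      rw [Function.iterate_succ_apply', Function.iterate_succ_apply']
      constructor
      · intro h
        rw [h]
        exact ⟨hG.next_opp (hmem l), hG.opp_ne (hmem l)⟩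
      · rintro ⟨h3, h4⟩
        exact (hG.eq_or_eq_opp (hmem l) (hmem k) h3).resolve_left h4
    have e2 : iter t x k = -iter t x l ↔
        iter t x (k + 1) = iter t x (l + 1) ∧ iter t x k ≠ iter t x l := by
      rw [iter_succ, iter_succ]
      constructor
      · intro h
        refine ⟨by rw [h, neg_sq], fun h3 => hx l ?_⟩
        have : 2 * iter t x l = 0 := by linear_combination h3.symm.trans h
        exact (mul_eq_zero.1 this).resolve_left h2
      · rintro ⟨h3, h4⟩
        have : (iter t x k - iter t x l) * (iter t x k + iter t x l) = 0 := by
          linear_combination h3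
        have := (mul_eq_zero.1 this).resolve_left (sub_ne_zero.2 h4)
        linear_combination this
    rw [e1, e2, hC', Ne, hC']
  have hSx : ∀ v ∈ S, ∀ k, G.next^[k] P ∉ S → φ v ≠ iter t x k ∧ φ v ≠ -iter t x k := by
    intro v hv k hk
    refine ⟨fun h => hk ((hA' k).2 ⟨v, hv, h⟩), fun h => hk ((hA' k).2 ⟨_, hS.opp v hv, ?_⟩)⟩
    rw [hφ.map_opp hG hS hv, h, neg_neg]
  have hSP : ∀ v ∈ S, ∀ k, G.next^[k] P ∉ S → v ≠ G.next^[k] P ∧ v ≠ G.opp (G.next^[k] P) := by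
    intro v hv k hk
    exact ⟨fun h => hk (h ▸ hv), fun h => hk (Closed.mem_of_opp_mem hG hS (hmem k) (h ▸ hv))⟩
  have hopp : ∀ k l, G.opp (G.next^[k] P) = G.opp (G.next^[l] P) ↔ G.next^[k] P = G.next^[l] P :=
    fun k l => ⟨fun h => by rw [← hG.opp_opp (hmem k), h, hG.opp_opp (hmem l)], fun h => by rw [h]⟩
  -- One direction of this equivalence makes `Rel` single-valued, the other makes it injective.
  have hRel : ∀ v y v' y', Rel v y → Rel v' y' → (v = v' ↔ y = y') := by
    rintro v y v' y' (⟨hv, rfl⟩ | ⟨k, hk, ⟨rfl, rfl⟩ | ⟨rfl, rfl⟩⟩)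
      (⟨hv', rfl⟩ | ⟨l, hl, ⟨rfl, rfl⟩ | ⟨rfl, rfl⟩⟩)
    · exact (hφ.inj.eq_iff hv hv').symm
    · exact iff_of_false (hSP v hv l hl).1 (hSx v hv l hl).1
    · exact iff_of_false (hSP v hv l hl).2 (hSx v hv l hl).2
    · exact iff_of_false (hSP v' hv' k hk).1.symm (hSx v' hv' k hk).1.symm
    · exact hC' k l
    · exact hD k l
    · exact iff_of_false (hSP v' hv' k hk).2.symm (hSx v' hv' k hk).2.symm
    · rw [eq_comm, hD l k, eq_comm]
    · rw [hopp, hC', neg_inj]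
  have hex : ∀ v ∈ S ∪ G.bigOrbit P, ∃ y, Rel v y := by
    intro v hv
    by_cases hvS : v ∈ S
    · exact ⟨φ v, Or.inl ⟨hvS, rfl⟩⟩
    · rcases hv.resolve_left hvS with ⟨k, rfl | rfl⟩
      · exact ⟨_, Or.inr ⟨k, hvS, Or.inl ⟨rfl, rfl⟩⟩⟩
      · exact ⟨_, Or.inr ⟨k, fun h => hvS (hS.opp _ h), Or.inr ⟨rfl, rfl⟩⟩⟩
  let ψ : V → F := fun v => if h : ∃ y, Rel v y then h.choose else 0
  have hψ : ∀ v y, Rel v y → ψ v = y := by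
    intro v y h
    have h' : ∃ y, Rel v y := ⟨y, h⟩
    simp only [ψ, dif_pos h']
    exact (hRel _ _ _ _ h'.choose_spec h).1 rfl
  have hnext : ∀ v y, Rel v y → Rel (G.next v) (y ^ 2 + t) := by
    have hstep : ∀ k, Rel (G.next^[k + 1] P) (iter t x (k + 1)) := by
      intro k
      by_cases h : G.next^[k + 1] P ∈ S
      · exact Or.inl ⟨h, hB _ h⟩
      · exact Or.inr ⟨k + 1, h, Or.inl ⟨rfl, rfl⟩⟩
    rintro v y (⟨hv, rfl⟩ | ⟨k, hk, ⟨rfl, rfl⟩ | ⟨rfl, rfl⟩⟩)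
    · exact Or.inl ⟨hS.next v hv, (hφ.map_next v hv).symm⟩
    · rw [← Function.iterate_succ_apply' G.next, ← iter_succ]; exact hstep k
    · rw [hG.next_opp (hmem k), ← Function.iterate_succ_apply' G.next, neg_sq, ← iter_succ]
      exact hstep k
  refine ⟨ψ, ⟨?_, ?_⟩, fun v hv => hψ v _ (Or.inl ⟨hv, rfl⟩), ?_⟩
  · intro v hv v' hv' h
    obtain ⟨y, hy⟩ := hex v hv
    obtain ⟨y', hy'⟩ := hex v' hv'
    rw [hψ v y hy, hψ v' y' hy'] at h
    exact (hRel _ _ _ _ hy hy').2 h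
  · intro v hv
    obtain ⟨y, hy⟩ := hex v hv
    rw [hψ v y hy, hψ _ _ (hnext v y hy)]
  · refine hψ P x ?_
    by_cases h : P ∈ S
    · exact Or.inl ⟨h, hB 0 h⟩
    · exact Or.inr ⟨0, h, Or.inl ⟨rfl, rfl⟩⟩

end Embedding

end DynModCurve

end

noncomputable section
namespace DynModCurve

/-! ### Minimal generating sets -/

namespace DGraph

universe v
variable {V : Type v} {G : DGraph V} {n : ℕ} {P : Fin n → V} {i j : Fin n}

lemma MinGenerates.mem_verts (hP : G.MinGenerates P) (i : Fin n) : P i ∈ G.verts :=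
  hP.1.1 ⟨i, rfl⟩

/-- Otherwise `P j` generates all that `P i` does, and `P i` could be dropped. -/
lemma MinGenerates.notMem_bigOrbit (hG : G.Admissible) (hP : G.MinGenerates P) (hij : i ≠ j) :
    P i ∉ G.bigOrbit (P j) := by
  classical
  intro h
  have hgen : G.Generates ↑((Finset.univ.erase i).image P) := by
    refine ⟨?_, fun Q hQ => ?_⟩
    · intro Q hQ
      obtain ⟨k, -, rfl⟩ := Finset.mem_image.1 (Finset.mem_coe.1 hQ)
      exact hP.mem_verts k
    · obtain ⟨_, ⟨k, rfl⟩, hk⟩ := hP.1.2 Q hQ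
      by_cases hki : k = i
      · subst hki
        refine ⟨P j, Finset.mem_coe.2 (Finset.mem_image.2 ⟨j, by simp [hij.symm], rfl⟩), ?_⟩
        exact (hG.closed_bigOrbit (hP.mem_verts j)).bigOrbit_subset h hk
      · exact ⟨P k, Finset.mem_coe.2 (Finset.mem_image.2 ⟨k, by simp [hki], rfl⟩), hk⟩
  have h1 := hP.2 _ hgen
  have h2 : ((Finset.univ.erase i).image P).card ≤ n - 1 := by
    refine Finset.card_image_le.trans ?_
    rw [Finset.card_erase_of_mem (Finset.mem_univ i), Finset.card_univ, Fintype.card_fin]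
  have := i.pos
  omega

lemma MinGenerates.closed_before (hG : G.Admissible) (hP : G.MinGenerates P) (i : Fin n) :
    G.Closed (G.before P i) := by
  have h := fun j => hG.closed_bigOrbit (hP.mem_verts j)
  exact ⟨fun Q ⟨j, _, hQ⟩ => (h j).subset hQ, fun Q ⟨j, hj, hQ⟩ => ⟨j, hj, (h j).next Q hQ⟩,
    fun Q ⟨j, hj, hQ⟩ => ⟨j, hj, (h j).opp Q hQ⟩⟩

/-- Take the first generator that reaches `Q`. Applied to f^κ(P_i), this produces the index j_i of
the tail equations. -/
lemma exists_mem_newVerts {Q : V} (h : Q ∈ G.before P i) : ∃ j < i, Q ∈ G.newVerts P j := by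
  induction i using WellFoundedLT.induction with
  | ind i ih =>
    obtain ⟨j, hj, hQ⟩ := h
    by_cases hb : Q ∈ G.before P j
    · obtain ⟨l, hl, hl'⟩ := ih j hj hb
      exact ⟨l, hl.trans hj, hl'⟩
    · exact ⟨j, hj, hQ, hb⟩

lemma lt_of_mem_newVerts {Q : V} (h : Q ∈ G.before P i) (hj : Q ∈ G.newVerts P j) : j < i := by
  obtain ⟨k, hk, hQ⟩ := h
  by_contra hji
  exact hj.2 ⟨k, lt_of_lt_of_le hk (not_lt.1 hji), hQ⟩

lemma kappa_mem (hi : i ∉ G.disjointIdx P) : G.next^[G.kappa P i] (P i) ∈ G.before P i := by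
  have : {k | G.next^[k] (P i) ∈ G.before P i}.Nonempty := by
    by_contra h
    exact hi fun k hk => h ⟨k, hk⟩
  exact Nat.sInf_mem this

lemma kappa_le {k : ℕ} (h : G.next^[k] (P i) ∈ G.before P i) : G.kappa P i ≤ k :=
  Nat.sInf_le h

lemma MinGenerates.notMem_before (hG : G.Admissible) (hP : G.MinGenerates P) (i : Fin n) :
    P i ∉ G.before P i := by
  rintro ⟨j, hj, h⟩
  exact hP.notMem_bigOrbit hG hj.ne' h

lemma MinGenerates.kappa_pos (hG : G.Admissible) (hP : G.MinGenerates P)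
    (hi : i ∉ G.disjointIdx P) : 1 ≤ G.kappa P i := by
  by_contra h
  have h1 := kappa_mem hi
  rw [show G.kappa P i = 0 by omega] at h1
  exact hP.notMem_before hG i h1

/-- The vertex f^κ(P_i) is f^k(P_j) or its opposite. In the first case k = 0 contradicts minimality
of the generating set, and for k > 0 the vertices f^(κ-1)(P_i) and f^(k-1)(P_j) have the same image,
so the orbit was already met before step κ. Only the opposite remains, hence the plus sign in Ψ_i.
-/
lemma MinGenerates.lambda_spec (hG : G.Admissible) (hP : G.MinGenerates P)
    (hi : i ∉ G.disjointIdx P) (hj : G.next^[G.kappa P i] (P i) ∈ G.newVerts P j) :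
    G.next^[G.lambda P i j] (P j) = G.opp (G.next^[G.kappa P i] (P i)) := by
  have hlt := lt_of_mem_newVerts (kappa_mem hi) hj
  suffices h : {l | G.next^[l] (P j) = G.opp (G.next^[G.kappa P i] (P i))}.Nonempty from
    Nat.sInf_mem h
  obtain ⟨k, hk | hk⟩ := hj.1
  · exfalso
    cases k with
    | zero =>
      refine hP.notMem_bigOrbit hG hlt.ne (i := j) (j := i) ?_
      rw [Function.iterate_zero, id] at hk
      rw [← hk]
      exact iterate_mem_bigOrbit _ _
    | succ k =>
      obtain ⟨c, hc⟩ := Nat.exists_eq_add_of_le' (hP.kappa_pos hG hi)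
      rw [hc, Function.iterate_succ_apply', Function.iterate_succ_apply'] at hk
      have h1 : G.next^[c] (P i) ∈ G.bigOrbit (P j) :=
        (hG.closed_bigOrbit (hP.mem_verts j)).mem_of_next_eq hG (iterate_mem_bigOrbit _ k)
          (hG.iterate_mem (hP.mem_verts i) c) hk
      have := kappa_le (G := G) (P := P) (i := i) ⟨j, hlt, h1⟩
      omega
  · refine ⟨k, ?_⟩
    change G.next^[k] (P j) = _
    rw [hk, hG.opp_opp (hG.iterate_mem (hP.mem_verts j) k)]

/-- Every vertex generated by the first generators flows into the orbit of one of those with index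
in `𝒟`. -/
lemma exists_disjointIdx (hG : G.Admissible) (hP : G.MinGenerates P) {Q : V}
    (h : Q ∈ G.before P i) :
    ∃ j ∈ G.disjointIdx P, j < i ∧ ∃ a c, G.next^[a] Q = G.next^[c] (P j) := by
  induction i using WellFoundedLT.induction generalizing Q with
  | ind i ih =>
    obtain ⟨j, hj, k, hk⟩ := h
    have hk' : G.next Q = G.next^[k + 1] (P j) := by
      rw [Function.iterate_succ_apply']
      rcases hk with rfl | rfl
      · rfl
      · exact hG.next_opp (hG.iterate_mem (hP.mem_verts j) k)
    by_cases hjD : j ∈ G.disjointIdx P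
    · exact ⟨j, hjD, hj, 1, k + 1, hk'⟩
    · obtain ⟨l, hl, hlj, a, c, hac⟩ := ih j hj (kappa_mem hjD)
      refine ⟨l, hl, hlj.trans hj, a + G.kappa P j + 1, c + (k + 1), ?_⟩
      rw [Function.iterate_succ_apply, hk', ← Function.iterate_add_apply,
        show a + G.kappa P j + (k + 1) = (k + 1) + (a + G.kappa P j) by ring,
        Function.iterate_add_apply, Function.iterate_add_apply G.next a, hac,
        ← Function.iterate_add_apply, add_comm c]

end DGraph

/-! ### Solutions of the defining equations -/

section Solution

open DGraph

universe v
variable {V : Type v} {G : DGraph V} {n : ℕ} {P : Fin n → V} {F : Type*} [Field F] {t : F}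
  {x : Fin n → F} {φ ψ : V → F}

/-- The point `(x, t)` satisfies the equations and inequations of the open part of `Y_G`. -/
structure IsSol (G : DGraph V) (P : Fin n → V) (t : F) (x : Fin n → F) : Prop where
  eq_disjoint : ∀ i ∈ G.disjointIdx P, Polynomial.aevalAeval t (x i)
    (genDynatomic (G.preperiod (P i)) (G.eventualPeriod (P i))) = 0
  eq_tail : ∀ i ∉ G.disjointIdx P, ∀ j, G.next^[G.kappa P i] (P i) ∈ G.newVerts P j →
    iter t (x i) (G.kappa P i) + iter t (x j) (G.lambda P i j) = 0
  ne : ∀ i ∈ G.disjointIdx P, ∀ j ∈ G.disjointIdx P, j < i →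
    G.eventualPeriod (P i) = G.eventualPeriod (P j) → ∀ k < G.eventualPeriod (P i),
    iter t (x i) (G.preperiod (P i)) ≠ iter t (x j) (G.preperiod (P j) + k)

lemma IsEmb.hasPortrait (hG : G.Admissible) {S : Set V} (hS : G.Closed S) (h : IsEmb G S t φ)
    {Q : V} (hQ : Q ∈ S) : HasPortrait (quad t) (φ Q) (G.preperiod Q) (G.eventualPeriod Q) :=
  (hG.hasPortrait (hS.subset hQ)).congr (h.iterate_eq_iff hS hQ)

lemma IsEmb.isSol [CharZero F] (hG : G.Admissible) (hP : G.MinGenerates P)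
    (ht : Good G.verts.ncard t) (h : IsEmb G G.verts t φ) : IsSol G P t (φ ∘ P) := by
  have hm := hP.mem_verts
  refine ⟨fun i _ => ?_, fun i hi j hj => ?_, fun i hi j _ hji _ k _ he => ?_⟩
  · rw [ht.eval_genDynatomic_eq_zero_iff (hG.preperiod_le (hm i)) (hG.hasPortrait (hm i)).pos
      (hG.eventualPeriod_le (hm i))]
    exact h.hasPortrait hG hG.closed_verts (hm i)
  · have h1 := h.map_opp hG hG.closed_verts (hG.iterate_mem (hm i) (G.kappa P i))
    rw [← hP.lambda_spec hG hi hj, h.map_iterate hG.closed_verts (hm j),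
      h.map_iterate hG.closed_verts (hm i)] at h1
    change iter t (φ (P i)) _ + iter t (φ (P j)) _ = 0
    rw [h1, add_neg_cancel]
  · change iter t (φ (P i)) _ = iter t (φ (P j)) _ at he
    rw [← h.map_iterate hG.closed_verts (hm j), ← h.map_iterate hG.closed_verts (hm i)] at he
    have := h.inj (hG.iterate_mem (hm i) _) (hG.iterate_mem (hm j) _) he
    exact hi (G.preperiod (P i)) ⟨j, hji, by rw [this]; exact iterate_mem_bigOrbit _ _⟩

lemma IsEmb.eqOn_verts (hG : G.Admissible) (hP : G.MinGenerates P) (hφ : IsEmb G G.verts t φ)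
    (hψ : IsEmb G G.verts t ψ) (h : ∀ i, φ (P i) = ψ (P i)) : Set.EqOn φ ψ G.verts := by
  intro Q hQ
  obtain ⟨_, ⟨i, rfl⟩, hi⟩ := hP.1.2 Q hQ
  exact IsEmb.eqOn_bigOrbit hG hG.closed_verts hφ hψ (hP.mem_verts i) (h i) hi

/-- Extension of an embedding to a generator whose orbit is disjoint from the previous ones. -/
lemma IsSol.extend_disjoint [CharZero F] (hG : G.Admissible) (hP : G.MinGenerates P)
    (ht : Good G.verts.ncard t) (hx : IsSol G P t x) {i : Fin n} (hi : i ∈ G.disjointIdx P)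
    (hφ : IsEmb G (G.before P i) t φ) (hφx : ∀ j < i, φ (P j) = x j) :
    ∃ ψ, IsEmb G (G.before P i ∪ G.bigOrbit (P i)) t ψ ∧ Set.EqOn ψ φ (G.before P i) ∧
      ψ (P i) = x i := by
  have hm := hP.mem_verts
  have hpor : ∀ i ∈ G.disjointIdx P,
      HasPortrait (quad t) (x i) (G.preperiod (P i)) (G.eventualPeriod (P i)) := fun i hi =>
    (ht.eval_genDynatomic_eq_zero_iff (hG.preperiod_le (hm i)) (hG.hasPortrait (hm i)).pos
      (hG.eventualPeriod_le (hm i)) _).1 (hx.eq_disjoint i hi)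
  have hcl := hP.closed_before hG i
  refine hφ.exists_extend hG hcl (hm i) (x i) ?_ (fun k hk => absurd hk (hi k))
    (fun k l _ _ => (hG.hasPortrait (hm i)).iterate_eq_iff_iterate_eq (hpor i hi) k l)
    two_ne_zero (ht.iter_ne_zero (hG.preperiod_le (hm i)) (hG.hasPortrait (hm i)).pos
      (hG.eventualPeriod_le (hm i)) (iter_add_minimalPeriod t _ _ (hpor i hi).period))
  -- If the orbit of x_i met the earlier image, it would merge with the orbit of some x_j, j ∈ 𝒟.
  -- The eventual periods would then agree and f^(M_i)(x_i) would lie on the cycle of x_j, which the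
  -- inequations forbid.
  rintro k ⟨u, hu, hk⟩
  exfalso
  obtain ⟨j, hj, hji, a, c, hac⟩ := exists_disjointIdx hG hP hu
  have hjb : P j ∈ G.before P i := ⟨j, hji, self_mem_bigOrbit _⟩
  have h1 : iter t (x i) (k + a) = iter t (x j) c := by
    rw [iter_add, ← hk, ← hφ.map_iterate hcl hu, hac, hφ.map_iterate hcl hjb, hφx j hji]
  have h2 : ∀ e, iter t (x i) (k + a + e) = iter t (x j) (c + e) := fun e => by
    rw [iter_add, h1, ← iter_add]
  have pi := hpor i hi
  have pj := hpor j hj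
  have hN : G.eventualPeriod (P i) = G.eventualPeriod (P j) := by
    rw [← (pi.iterate_mem (k := k + a + (G.preperiod (P i) + G.preperiod (P j))) (by omega)).2,
      ← (pj.iterate_mem (k := c + (G.preperiod (P i) + G.preperiod (P j))) (by omega)).2,
      ← iter_eq_iterate, h2, ← iter_eq_iterate]
  set N := G.eventualPeriod (P i) with hNdef
  have hN1 : 1 ≤ N := pi.pos
  -- Large enough that N q steps past the preperiod of x_i lie beyond the merging point with x_j
  -- already on its cycle; periodicity then brings x_i back to step M_i.
  set q := k + a + G.preperiod (P i) + G.preperiod (P j) with hq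
  have hqN : q ≤ N * q := Nat.le_mul_of_pos_left _ hN1
  obtain ⟨e, he⟩ : ∃ e, k + a + e = G.preperiod (P i) + N * q :=
    ⟨G.preperiod (P i) + N * q - (k + a), by omega⟩
  have h3 := h2 e
  rw [he, iter_eq_iterate, pi.iterate_add le_rfl, iter_eq_iterate,
    pj.iterate_mod (k := c + e) (by omega), ← iter_eq_iterate, ← iter_eq_iterate] at h3
  refine hx.ne i hi j hj hji hN _ ?_ h3
  rw [← hN]
  exact Nat.mod_lt _ hN1

/-- Extension of an embedding to a generator whose orbit meets the previous ones. -/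
lemma IsSol.extend_tail [CharZero F] (hG : G.Admissible) (hP : G.MinGenerates P)
    (ht : Good G.verts.ncard t) (hx : IsSol G P t x) {i : Fin n} (hi : i ∉ G.disjointIdx P)
    (hφ : IsEmb G (G.before P i) t φ) (hφx : ∀ j < i, φ (P j) = x j) :
    ∃ ψ, IsEmb G (G.before P i ∪ G.bigOrbit (P i)) t ψ ∧ Set.EqOn ψ φ (G.before P i) ∧
      ψ (P i) = x i := by
  have hm := hP.mem_verts
  have hcl := hP.closed_before hG i
  have hw := kappa_mem hi
  obtain ⟨j, hji, hj⟩ := exists_mem_newVerts hw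
  have hjb : P j ∈ G.before P i := ⟨j, hji, self_mem_bigOrbit _⟩
  set κ := G.kappa P i with hκ
  have hκ1 : 1 ≤ κ := hP.kappa_pos hG hi
  have hmin : ∀ k, G.next^[k] (P i) ∈ G.before P i ↔ κ ≤ k :=
    fun k => ⟨kappa_le, fun h => hcl.iterate_of_le hw h⟩
  have hxw : iter t (x i) κ = φ (G.next^[κ] (P i)) := by
    have h1 := hφ.map_opp hG hcl hw
    rw [← hP.lambda_spec hG hi hj, hφ.map_iterate hcl hjb, hφx j hji] at h1
    have h2 := hx.eq_tail i hi j hj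
    rw [h1] at h2
    linear_combination h2
  have hB : ∀ k, G.next^[k] (P i) ∈ G.before P i → iter t (x i) k = φ (G.next^[k] (P i)) := by
    intro k hk
    obtain ⟨c, rfl⟩ := Nat.exists_eq_add_of_le ((hmin k).1 hk)
    rw [iter_add, hxw, add_comm κ c, Function.iterate_add_apply, hφ.map_iterate hcl hw]
  -- An earlier collision with the image would run along to step κ; injectivity of φ then gives
  -- f^(κ-1)(P_i) the same image as an earlier vertex, so it would itself be an earlier vertex.
  have hA : ∀ k, iter t (x i) k ∈ φ '' G.before P i → G.next^[k] (P i) ∈ G.before P i := by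
    rintro k ⟨u, hu, hk⟩
    by_contra hkb
    rw [hmin] at hkb
    obtain ⟨c, hc⟩ : ∃ c, κ = k + (c + 1) := ⟨κ - k - 1, by omega⟩
    have h1 : φ (G.next^[c + 1] u) = φ (G.next^[κ] (P i)) := by
      rw [hφ.map_iterate hcl hu, hk, ← iter_add, ← hc, hxw]
    have h2 := hφ.inj (hcl.iterate hu _) hw h1
    rw [hc, ← add_assoc, Function.iterate_succ_apply', Function.iterate_succ_apply'] at h2
    have h3 := hcl.mem_of_next_eq hG (hcl.iterate hu c) (hG.iterate_mem (hm i) (k + c)) h2.symm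
    rw [hmin] at h3
    omega
  -- A repetition before step κ would bring the entry into the earlier part forward, on both sides.
  have key : ∀ k l, k < l → l < κ → G.next^[k] (P i) ≠ G.next^[l] (P i) ∧
      iter t (x i) k ≠ iter t (x i) l := by
    intro k l hkl hl
    obtain ⟨c, hc⟩ := Nat.exists_eq_add_of_lt hl
    constructor
    · intro h
      have : G.next^[k + (c + 1)] (P i) ∈ G.before P i := by
        rw [add_comm, Function.iterate_add_apply, h, ← Function.iterate_add_apply,
          show c + 1 + l = κ by omega]
        exact hw
      rw [hmin] at this
      omega
    · intro h
      have : iter t (x i) (k + (c + 1)) ∈ φ '' G.before P i := by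
        rw [iter_add, h, ← iter_add, show l + (c + 1) = κ by omega, hxw]
        exact ⟨_, hw, rfl⟩
      have := hA _ this
      rw [hmin] at this
      omega
  refine hφ.exists_extend hG hcl (hm i) (x i) hA hB ?_ two_ne_zero ?_
  · intro k l hk hl
    rw [hmin] at hk hl
    rcases lt_trichotomy k l with h | rfl | h
    · exact iff_of_false (key k l h (by omega)).1 (key k l h (by omega)).2
    · simp
    · exact iff_of_false (key l k h (by omega)).1.symm (key l k h (by omega)).2.symm
  · obtain ⟨m, hmB, N, h1, hN, he⟩ := hG.iterate_mem_periodicPts (hm i)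
    have hκm : κ ≤ m := by
      by_contra h
      by_cases h' : κ ≤ m + N
      · have := (hmin _).2 h'
        rw [he, hmin] at this
        omega
      · exact (key m (m + N) (by omega) (by omega)).1 he.symm
    refine ht.iter_ne_zero hmB h1 hN ?_
    rw [hB _ ((hmin _).2 hκm), hB _ ((hmin _).2 (by omega)), he]

/-- Every solution of the defining equations comes from an embedding of the graph. -/
theorem IsSol.exists_isEmb [CharZero F] (hG : G.Admissible) (hP : G.MinGenerates P)
    (ht : Good G.verts.ncard t) (hx : IsSol G P t x) :
    ∃ φ, IsEmb G G.verts t φ ∧ ∀ i, φ (P i) = x i := by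
  have key : ∀ k ≤ n, ∃ φ, IsEmb G {Q | ∃ j : Fin n, j.1 < k ∧ Q ∈ G.bigOrbit (P j)} t φ ∧
      ∀ j : Fin n, j.1 < k → φ (P j) = x j := by
    intro k
    induction k with
    | zero => exact fun _ => ⟨0, ⟨fun a ha => by simp at ha, fun a ha => by simp at ha⟩, by simp⟩
    | succ k ih =>
      intro hk
      obtain ⟨φ, hφ, hφx⟩ := ih (by omega)
      let i : Fin n := ⟨k, hk⟩
      obtain ⟨ψ, h1, h2, h3⟩ : ∃ ψ, IsEmb G (G.before P i ∪ G.bigOrbit (P i)) t ψ ∧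
          Set.EqOn ψ φ (G.before P i) ∧ ψ (P i) = x i := by
        by_cases hi : i ∈ G.disjointIdx P
        · exact hx.extend_disjoint hG hP ht hi hφ hφx
        · exact hx.extend_tail hG hP ht hi hφ hφx
      refine ⟨ψ, h1.mono ?_, fun j hj => ?_⟩
      · rintro Q ⟨j, hj, hQ⟩
        rcases Nat.lt_succ_iff_lt_or_eq.1 hj with h | h
        · exact Or.inl ⟨j, h, hQ⟩
        · exact Or.inr (by rwa [show i = j from Fin.ext h.symm])
      · rcases Nat.lt_succ_iff_lt_or_eq.1 hj with h | h
        · rw [h2 ⟨j, h, self_mem_bigOrbit _⟩, hφx j h]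
        · rw [show j = i from Fin.ext h, h3]
  obtain ⟨φ, hφ, hφx⟩ := key n le_rfl
  refine ⟨φ, hφ.mono fun Q hQ => ?_, fun i => hφx i i.2⟩
  obtain ⟨_, ⟨i, rfl⟩, hi⟩ := hP.1.2 Q hQ
  exact ⟨i, i.2, hi⟩

end Solution

end DynModCurve

end

noncomputable section
namespace DynModCurve

open DGraph

universe u v

/-! ### Counting extensions of embeddings -/

lemma Good.mono {F : Type*} [Field F] {t : F} {B C : ℕ} (h : Good C t) (hBC : B ≤ C) : Good B t :=
  ⟨fun n h1 hn => h.simple n h1 (hn.trans hBC),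
    fun _ h1 hb => h.critical' hBC h1 (hb.trans hBC)⟩

lemma encard_eq_mul_of_fibers {α β : Type*} {s : Set α} {f : α → β} {X : Set β} (hX : X.Finite)
    (hs : Set.MapsTo f s X) {d : ℕ} (h : ∀ x ∈ X, {a ∈ s | f a = x}.encard = d) :
    s.encard = (X.ncard * d : ℕ) := by
  classical
  have hsfin : s.Finite := by
    have : s ⊆ ⋃ x ∈ X, {a ∈ s | f a = x} := fun a ha => by
      simp only [Set.mem_iUnion]
      exact ⟨f a, hs ha, ha, rfl⟩
    refine Set.Finite.subset (hX.biUnion fun x hx => ?_) this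
    exact Set.finite_of_encard_eq_coe (h x hx)
  rw [← hsfin.cast_ncard_eq, Nat.cast_inj, Set.ncard_eq_toFinset_card s hsfin,
    Set.ncard_eq_toFinset_card X hX]
  rw [Finset.card_eq_sum_card_fiberwise (f := f) (t := hX.toFinset)
    (fun a ha => by simpa using hs (by simpa using ha))]
  rw [Finset.sum_const_nat (m := d)]
  intro x hx
  have := h x (by simpa using hx)
  have hfin : {a ∈ s | f a = x}.Finite := Set.finite_of_encard_eq_coe this
  rw [← hfin.cast_ncard_eq, Nat.cast_inj, Set.ncard_eq_toFinset_card _ hfin] at this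
  rw [← this]
  congr 1
  ext a
  simp

section Count

variable {V : Type v} {G : DGraph V} {S : Set V}

lemma DGraph.bigOrbit_of_next_eq {Q : V} (h : G.next Q = Q) : G.bigOrbit Q = {Q, G.opp Q} := by
  have hk : ∀ k, G.next^[k] Q = Q := fun k => Function.iterate_fixed h k
  ext R
  simp [bigOrbit, hk]

/-- An orbit that enters S stays there, and a periodic orbit returns to its start. -/
lemma DGraph.Closed.iterate_notMem_of_periodic (hS : G.Closed S) {p : V} {N : ℕ} (hN : 1 ≤ N)
    (hp : G.next^[N] p = p) (hpS : p ∉ S) (k : ℕ) : G.next^[k] p ∉ S := by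
  intro hk
  apply hpS
  have h1 : G.next^[N * k] p = p := by
    rw [Function.iterate_mul]; exact Function.iterate_fixed hp k
  rw [← h1]
  exact hS.iterate_of_le hk (Nat.le_mul_of_pos_left _ hN)

/-- The vertices of exact period `N` lying in `S`. -/
def periodicIn (G : DGraph V) (S : Set V) (N : ℕ) : Set V :=
  {v ∈ S | Function.minimalPeriod G.next v = N}

lemma ncard_orbit {p : V} {N : ℕ} (hN : 1 ≤ N) (hp : Function.minimalPeriod G.next p = N) :
    {Q | ∃ k : ℕ, Q = G.next^[k] p}.ncard = N := by
  have hper : p ∈ Function.periodicPts G.next :=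
    Function.minimalPeriod_pos_iff_mem_periodicPts.1 (by omega)
  have : {Q | ∃ k : ℕ, Q = G.next^[k] p} = (fun k => G.next^[k] p) '' ↑(Finset.range N) := by
    ext Q
    simp only [Set.mem_ofPred_eq, Set.mem_image, Finset.coe_range, Set.mem_Iio]
    constructor
    · rintro ⟨k, rfl⟩
      exact ⟨k % N, Nat.mod_lt _ hN, by rw [← hp, Function.iterate_mod_minimalPeriod_eq]⟩
    · rintro ⟨k, -, rfl⟩
      exact ⟨k, rfl⟩
  rw [this, Set.InjOn.ncard_image, Set.ncard_coe_finset, Finset.card_range]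
  intro a ha b hb hab
  rw [Finset.coe_range, Set.mem_Iio, ← hp] at ha hb
  exact Function.iterate_injOn_Iio_minimalPeriod ha hb hab

lemma ncard_periodicIn_verts_le (hG : G.Admissible) {N : ℕ} (hN : 1 ≤ N) :
    (periodicIn G G.verts N).ncard ≤ N * (G.cycles N).ncard := by
  have hcyc : (G.cycles N).Finite := by
    refine (hG.finite.image fun p => {Q | ∃ k : ℕ, Q = G.next^[k] p}).subset ?_
    rintro C ⟨p, hp, -, rfl⟩
    exact ⟨p, hp, rfl⟩
  have hsub : periodicIn G G.verts N ⊆ ⋃ C ∈ hcyc.toFinset, C := by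
    rintro p ⟨hp, hpN⟩
    simp only [Set.mem_iUnion, Set.Finite.mem_toFinset]
    exact ⟨_, ⟨p, hp, hpN, rfl⟩, 0, rfl⟩
  have hCN : ∀ C ∈ hcyc.toFinset, C.ncard = N := by
    intro C hC
    obtain ⟨p, hp, hpN, rfl⟩ := hcyc.mem_toFinset.1 hC
    exact ncard_orbit hN hpN
  have hfin : (⋃ C ∈ hcyc.toFinset, C).Finite := by
    refine hG.finite.subset ?_
    simp only [Set.iUnion_subset_iff, Set.Finite.mem_toFinset]
    rintro C ⟨p, hp, -, rfl⟩ Q ⟨k, rfl⟩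
    exact hG.iterate_mem hp k
  refine (Set.ncard_le_ncard hsub hfin).trans ((Finset.set_ncard_biUnion_le _ _).trans ?_)
  rw [Finset.sum_congr rfl hCN, Finset.sum_const, smul_eq_mul, mul_comm,
    Set.ncard_eq_toFinset_card _ hcyc]

/-- The cycle of p misses S entirely and contributes N further points. With the bound on cycles in
an admissible graph, this leaves at least N unused periodic points for the new cycle. -/
lemma ncard_periodicIn_add_le (hG : G.Admissible) (hS : G.Closed S) {p : V} (hp : p ∈ G.verts)
    (hpS : p ∉ S) {N : ℕ} (hN : 1 ≤ N) (hpN : Function.minimalPeriod G.next p = N) :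
    (periodicIn G S N).ncard + N ≤ (periodicIn G G.verts N).ncard := by
  have hper : p ∈ Function.periodicPts G.next :=
    Function.minimalPeriod_pos_iff_mem_periodicPts.1 (by omega)
  have hfin : (periodicIn G G.verts N).Finite := hG.finite.subset fun v hv => hv.1
  have h1 : periodicIn G S N ⊆ periodicIn G G.verts N := fun v hv => ⟨hS.subset hv.1, hv.2⟩
  have h2 : {Q | ∃ k : ℕ, Q = G.next^[k] p} ⊆ periodicIn G G.verts N := by
    rintro Q ⟨k, rfl⟩
    exact ⟨hG.iterate_mem hp k, by rw [Function.minimalPeriod_apply_iterate hper, hpN]⟩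
  have hper' : G.next^[N] p = p := by rw [← hpN]; exact Function.iterate_minimalPeriod
  calc (periodicIn G S N).ncard + N
      = (periodicIn G S N ∪ {Q | ∃ k : ℕ, Q = G.next^[k] p}).ncard := by
        rw [Set.ncard_union_eq _ (hfin.subset h1) (hfin.subset h2), ncard_orbit hN hpN]
        rw [Set.disjoint_left]
        rintro Q hQ ⟨k, rfl⟩
        exact hS.iterate_notMem_of_periodic hN hper' hpS k hQ.1
    _ ≤ _ := Set.ncard_le_ncard (Set.union_subset h1 h2) hfin

variable {F : Type*} [Field F] {t : F} {φ ψ : V → F}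

/-- The embeddings of `G` extending a given embedding of `S`. -/
def extensions (G : DGraph V) (S : Set V) (t : F) (φ : V → F) : Set (V → F) :=
  -- The value 0 off G makes an extension determined by its restriction to G, so that counting
  -- functions counts embeddings.
  {ψ | IsEmb G G.verts t ψ ∧ Set.EqOn ψ φ S ∧ ∀ v ∉ G.verts, ψ v = 0}

lemma encard_extensions_verts (hG : G.Admissible) (hφ : IsEmb G G.verts t φ) :
    (extensions G G.verts t φ).encard = 1 := by
  classical
  rw [Set.encard_eq_one]
  refine ⟨fun v => if v ∈ G.verts then φ v else 0, Set.eq_singleton_iff_unique_mem.2 ⟨?_, ?_⟩⟩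
  · have h : Set.EqOn (fun v => if v ∈ G.verts then φ v else 0) φ G.verts :=
      fun v hv => if_pos hv
    exact ⟨hφ.congr hG.closed_verts h, h, fun v hv => if_neg hv⟩
  · rintro ψ ⟨-, h1, h2⟩
    ext v
    by_cases hv : v ∈ G.verts
    · rw [if_pos hv, h1 hv]
    · rw [if_neg hv, h2 v hv]

/-- The number of extensions, by the value at a new vertex `p`. -/
lemma encard_extensions_eq_mul (hG : G.Admissible) (hS : G.Closed S) {p : V} (hp : p ∈ G.verts)
    {X : Set F} (hX : X.Finite)
    (h1 : ∀ ψ, IsEmb G G.verts t ψ → Set.EqOn ψ φ S → ψ p ∈ X)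
    (h2 : ∀ x ∈ X, ∃ ψ, IsEmb G (S ∪ G.bigOrbit p) t ψ ∧ Set.EqOn ψ φ S ∧ ψ p = x) {d : ℕ}
    (hd : ∀ ψ, IsEmb G (S ∪ G.bigOrbit p) t ψ →
      (extensions G (S ∪ G.bigOrbit p) t ψ).encard = d) :
    (extensions G S t φ).encard = (X.ncard * d : ℕ) := by
  have hcl := hS.union (hG.closed_bigOrbit hp)
  refine encard_eq_mul_of_fibers (f := fun ψ => ψ p) hX (fun ψ hψ => h1 ψ hψ.1 hψ.2.1) ?_
  intro x hx
  obtain ⟨χ, h3, h4, h5⟩ := h2 x hx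
  rw [← hd χ h3]
  congr 1
  ext ψ
  constructor
  · rintro ⟨⟨h6, h7, h8⟩, h9⟩
    refine ⟨h6, ?_, h8⟩
    rintro v (hv | hv)
    · rw [h7 hv, h4 hv]
    · refine IsEmb.eqOn_bigOrbit hG hcl (h6.mono hcl.subset) h3
        (Or.inr (self_mem_bigOrbit p)) ?_ hv
      rw [h5]; exact h9
  · rintro ⟨h6, h7, h8⟩
    refine ⟨⟨h6, fun v hv => ?_, h8⟩, ?_⟩
    · rw [h7 (Or.inl hv), h4 hv]
    · rw [h7 (Or.inr (self_mem_bigOrbit p)), h5]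

/-- Adding the two preimages of a vertex of `S`: two choices. -/
lemma encard_extensions_tail [IsAlgClosed F] [CharZero F] (hG : G.Admissible) (hS : G.Closed S)
    (ht : Good (G.verts.ncard + 1) t) {p : V} (hp : p ∈ G.verts) (hpS : p ∉ S)
    (hnext : G.next p ∈ S) (hφ : IsEmb G S t φ) {d : ℕ}
    (hd : ∀ ψ, IsEmb G (S ∪ G.bigOrbit p) t ψ →
      (extensions G (S ∪ G.bigOrbit p) t ψ).encard = d) :
    (extensions G S t φ).encard = (2 * d : ℕ) := by
  obtain ⟨s, hs⟩ := IsAlgClosed.exists_pow_nat_eq (φ (G.next p) - t) two_pos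
  have ht' : Good G.verts.ncard t := ht.mono (Nat.le_succ _)
  -- A zero square root would make φ(f(p)) the critical value, so 0 would be preperiodic. Its orbit
  -- starts one step before an embedded vertex, hence goodness up to the number of vertices plus
  -- one.
  have hs0 : s ≠ 0 := by
    rintro rfl
    obtain ⟨N, h1, hN, he⟩ := hG.exists_period (hS.subset hnext)
    apply ht.critical N h1 (by omega)
    have h0 : iter t 0 1 = φ (G.next p) := by rw [iter_one]; linear_combination hs
    rw [show G.verts.ncard + 1 + N = 1 + (G.verts.ncard + N) by ring, iter_add t 0 1, h0,
      add_comm G.verts.ncard 1, iter_add t 0 1, h0, ← hφ.map_iterate hS hnext,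
      ← hφ.map_iterate hS hnext, he _ le_rfl]
  have hne : s ≠ -s := fun h => hs0 (by
    have : 2 * s = 0 := by linear_combination h
    exact (mul_eq_zero.1 this).resolve_left two_ne_zero)
  rw [← Set.ncard_pair hne]
  refine encard_extensions_eq_mul hG hS hp (Set.toFinite _) ?_ ?_ hd
  · intro ψ hψ he
    have h1 := hψ.map_next p hp
    rw [he hnext] at h1
    have : (ψ p - s) * (ψ p + s) = 0 := by linear_combination -hs - h1
    rcases mul_eq_zero.1 this with h | h
    · exact Or.inl (sub_eq_zero.1 h)
    · exact Or.inr (eq_neg_of_add_eq_zero_left h)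
  · intro x hx
    have hx2 : x ^ 2 + t = φ (G.next p) := by
      rcases hx with rfl | rfl
      · linear_combination hs
      · linear_combination hs
    have hx0 : x ≠ 0 := by
      rcases hx with rfl | rfl
      · exact hs0
      · exact neg_ne_zero.2 hs0
    have hmem : ∀ k, G.next^[k + 1] p ∈ S := fun k => by
      rw [Function.iterate_succ_apply]; exact hS.iterate hnext k
    have hB : ∀ k, iter t x (k + 1) = φ (G.next^[k + 1] p) := fun k => by
      rw [iter_succ', hx2, Function.iterate_succ_apply, hφ.map_iterate hS hnext]
    refine hφ.exists_extend hG hS hp x ?_ ?_ ?_ two_ne_zero ?_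
    · rintro (_ | k) h
      · obtain ⟨u, hu, he⟩ := h
        have h1 : φ (G.next u) = φ (G.next p) := by
          rw [hφ.map_next u hu, he, ← hx2]; rfl
        exact hS.mem_of_next_eq hG hu hp (hφ.inj (hS.next u hu) hnext h1).symm
      · exact hmem k
    · rintro (_ | k) h
      · exact absurd h hpS
      · exact hB k
    · rintro (_ | k) (_ | l) hk hl
      · exact iff_of_true rfl rfl
      · exact absurd (hmem l) hl
      · exact absurd (hmem k) hk
      · exact absurd (hmem k) hk
    · rintro (_ | k)
      · exact hx0
      · rw [hB]; exact hφ.ne_zero hG hS ht' (hmem k)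

/-- Adding a new cycle. -/
lemma encard_extensions_cycle [IsAlgClosed F] [CharZero F] (hG : G.Admissible) (hS : G.Closed S)
    (ht : Good G.verts.ncard t) {p : V} (hp : p ∈ G.verts) (hpS : p ∉ S) {N : ℕ} (hN : 1 ≤ N)
    (hpN : Function.minimalPeriod G.next p = N) (hφ : IsEmb G S t φ) {d : ℕ}
    (hd : ∀ ψ, IsEmb G (S ∪ G.bigOrbit p) t ψ →
      (extensions G (S ∪ G.bigOrbit p) t ψ).encard = d) :
    (extensions G S t φ).encard =
      ((⌊(N : ℚ) * numCycles N⌋₊ - (periodicIn G S N).ncard) * d : ℕ) := by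
  have hper : p ∈ Function.periodicPts G.next :=
    Function.minimalPeriod_pos_iff_mem_periodicPts.1 (by omega)
  have hNp : G.next^[N] p = p := by rw [← hpN]; exact Function.iterate_minimalPeriod
  have hout := hS.iterate_notMem_of_periodic hN hNp hpS
  have hpor : HasPortrait G.next p 0 N := ⟨hN, hpN, by simp⟩
  have hNB : N ≤ G.verts.ncard := by
    rw [← ncard_orbit hN hpN]
    refine Set.ncard_le_ncard ?_ hG.finite
    rintro Q ⟨k, rfl⟩
    exact hG.iterate_mem hp k
  have hfin := ht.finite_minimalPeriod hN hNB
  have hmp : ∀ v ∈ S, Function.minimalPeriod (quad t) (φ v) = Function.minimalPeriod G.next v := by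
    intro v hv
    refine Nat.dvd_antisymm ?_ ?_
    · rw [← Function.isPeriodicPt_iff_minimalPeriod_dvd]
      exact ((hφ.iterate_eq_iff hS hv _ 0).1 Function.iterate_minimalPeriod)
    · rw [← Function.isPeriodicPt_iff_minimalPeriod_dvd]
      exact ((hφ.iterate_eq_iff hS hv _ 0).2 Function.iterate_minimalPeriod)
  have himg : φ '' periodicIn G S N ⊆ {x | Function.minimalPeriod (quad t) x = N} := by
    rintro _ ⟨v, hv, rfl⟩
    rw [Set.mem_ofPred_eq, hmp v hv.1, hv.2]
  -- The images available for p are the points of exact period N not yet used. The floor only turns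
  -- N R(N), which is this number of points, into a natural number.
  have hcard : ({x | Function.minimalPeriod (quad t) x = N} \ φ '' periodicIn G S N).ncard =
      ⌊(N : ℚ) * numCycles N⌋₊ - (periodicIn G S N).ncard := by
    rw [Set.ncard_sdiff himg (hfin.subset himg), ← ht.ncard_minimalPeriod hN hNB, Nat.floor_natCast,
      (hφ.inj.mono fun v hv => hv.1 : Set.InjOn φ (periodicIn G S N)).ncard_image]
  rw [← hcard]
  refine encard_extensions_eq_mul hG hS hp (hfin.subset Set.sdiff_subset) ?_ ?_ hd
  · intro ψ hψ he
    have h1 := hpor.congr (hψ.iterate_eq_iff hG.closed_verts hp)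
    refine ⟨h1.period, ?_⟩
    rintro ⟨v, hv, h2⟩
    rw [← he hv.1] at h2
    exact hpS (hψ.inj (hS.subset hv.1) hp h2 ▸ hv.1)
  · rintro x ⟨hx, hxS⟩
    have hpor' : HasPortrait (quad t) x 0 N := ⟨hN, hx, by simp⟩
    have hxN : ∀ q, iter t x (N * q) = x := fun q => by
      rw [iter_eq_self_iff, hx]; exact dvd_mul_right _ _
    refine hφ.exists_extend hG hS hp x ?_ (fun k hk => absurd hk (hout k))
      (fun k l _ _ => hpor.iterate_eq_iff_iterate_eq hpor' k l) two_ne_zero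
      (ht.iter_ne_zero (Nat.zero_le _) hN hNB (x := x) ?_)
    -- If the orbit of x meets φ(S) at step k, following it to step N k returns to x, so x would
    -- itself be the image of a used periodic vertex.
    · rintro k ⟨u, hu, he⟩
      exfalso
      obtain ⟨e, hke⟩ := Nat.exists_eq_add_of_le (Nat.le_mul_of_pos_left k hN)
      have h1 : φ (G.next^[e] u) = x := by
        rw [hφ.map_iterate hS hu, he, ← iter_add, ← hke, hxN]
      refine hxS ⟨_, ⟨hS.iterate hu e, ?_⟩, h1⟩
      rw [← hmp _ (hS.iterate hu e), h1]
      exact hx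
    · rw [zero_add, iter_zero, iter_eq_self_iff, hx]

/-- `G` is obtained from the closed subset `S` by adding a second fixed point. -/
def AddsSecond (G : DGraph V) (S : Set V) : Prop :=
  (periodicIn G S 1).ncard = 1 ∧
    ∃ Q ∈ G.verts, Q ∉ S ∧ G.next Q = Q ∧ G.verts = S ∪ {Q, G.opp Q}

lemma numCycles_one : numCycles 1 = 2 := by simp [numCycles]

/-- The number of extensions of an embedding of `S` to an embedding of `G` does not depend on the
embedding. -/
theorem exists_extension_count (hG : G.Admissible) (hS : G.Closed S) :
    ∃ d : ℕ, 1 ≤ d ∧ (d = 1 ↔ S = G.verts ∨ AddsSecond G S) ∧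
      ∀ (F : Type u) [Field F] [IsAlgClosed F] [CharZero F] (t : F),
        Good (G.verts.ncard + 1) t → ∀ φ, IsEmb G S t φ →
        (extensions G S t φ).encard = d := by
  -- Induction on the number of vertices still to be placed.
  induction hk : (G.verts \ S).ncard using Nat.strong_induction_on generalizing S with
  | _ k ih =>
  by_cases hSv : S = G.verts
  · subst hSv
    exact ⟨1, le_rfl, by simp, fun F _ _ _ t _ φ hφ => by
      simpa using encard_extensions_verts hG hφ⟩
  have hstep : ∀ p ∈ G.verts, p ∉ S → ∃ d : ℕ, 1 ≤ d ∧
      (d = 1 ↔ S ∪ G.bigOrbit p = G.verts ∨ AddsSecond G (S ∪ G.bigOrbit p)) ∧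
      ∀ (F : Type u) [Field F] [IsAlgClosed F] [CharZero F] (t : F),
        Good (G.verts.ncard + 1) t → ∀ φ, IsEmb G (S ∪ G.bigOrbit p) t φ →
        (extensions G (S ∪ G.bigOrbit p) t φ).encard = d := by
    intro p hp hpS
    refine ih _ ?_ (hS.union (hG.closed_bigOrbit hp)) rfl
    rw [← hk]
    refine Set.ncard_lt_ncard ⟨fun v hv => ⟨hv.1, fun h => hv.2 (Or.inl h)⟩, fun h => ?_⟩
      (hG.finite.subset Set.sdiff_subset)
    exact (h ⟨hp, hpS⟩).2 (Or.inr (self_mem_bigOrbit p))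
  -- Either some missing vertex maps into S and a tail is added, or the complement of S is stable
  -- under f and contains a cycle.
  by_cases hcase : ∃ p ∈ G.verts, p ∉ S ∧ G.next p ∈ S
  · obtain ⟨p, hp, hpS, hnext⟩ := hcase
    obtain ⟨d, hd1, -, hd⟩ := hstep p hp hpS
    refine ⟨2 * d, by omega, iff_of_false (by omega) ?_, fun F _ _ _ t ht φ hφ =>
      encard_extensions_tail hG hS ht hp hpS hnext hφ (hd F t ht)⟩
    rintro (h | ⟨-, Q, hQ, hQS, hfix, hv⟩)
    · exact hSv h
    · have hpQ : p ∈ S ∪ {Q, G.opp Q} := hv ▸ hp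
      apply hQS
      rcases hpQ.resolve_left hpS with rfl | h
      · rwa [hfix] at hnext
      · rw [h, hG.next_opp hQ, hfix] at hnext
        exact hnext
  · push Not at hcase
    obtain ⟨v, hv, hvS⟩ : ∃ v ∈ G.verts, v ∉ S := by
      by_contra! h
      exact hSv (hS.subset.antisymm h)
    have hit : ∀ k, G.next^[k] v ∉ S := by
      intro k
      induction k with
      | zero => exact hvS
      | succ k ih =>
        rw [Function.iterate_succ_apply']
        exact hcase _ (hG.iterate_mem hv k) ih
    have hpor := hG.hasPortrait hv
    set p := G.next^[G.preperiod v] v with hpdef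
    set N := G.eventualPeriod v with hNdef
    have hp : p ∈ G.verts := hG.iterate_mem hv _
    have hpS : p ∉ S := hit _
    have hN : 1 ≤ N := hpor.pos
    have hpN : Function.minimalPeriod G.next p = N := rfl
    obtain ⟨d, hd1, hdiff, hd⟩ := hstep p hp hpS
    -- Ensures that the number of choices for p is at least N, in particular positive.
    have hle : (periodicIn G S N).ncard + N ≤ ⌊(N : ℚ) * numCycles N⌋₊ := by
      refine Nat.le_floor ?_
      have h1 := (ncard_periodicIn_add_le hG hS hp hpS hN hpN).trans
        (ncard_periodicIn_verts_le hG hN)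
      calc (((periodicIn G S N).ncard + N : ℕ) : ℚ) ≤ ((N * (G.cycles N).ncard : ℕ) : ℚ) := by
            exact_mod_cast h1
        _ = N * ((G.cycles N).ncard : ℚ) := by push_cast; ring
        _ ≤ N * numCycles N := by
            gcongr
            exact hG.cycles_le N hN
    refine ⟨(⌊(N : ℚ) * numCycles N⌋₊ - (periodicIn G S N).ncard) * d,
      Nat.mul_pos (by omega) hd1, ?_, fun F _ _ _ t ht φ hφ =>
      encard_extensions_cycle hG hS (ht.mono (Nat.le_succ _)) hp hpS hN hpN hφ (hd F t ht)⟩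
    have hfl : ⌊((1 : ℕ) : ℚ) * numCycles 1⌋₊ = 2 := by
      rw [numCycles_one]; norm_num
    -- The first factor is at least N, so it is 1 only if N = 1 and exactly one of the two fixed
    -- points is used.
    rw [mul_eq_one, hdiff]
    constructor
    · rintro ⟨h1, h2⟩
      have hN1 : N = 1 := by omega
      rw [hN1, hfl] at h1
      have hfix : G.next p = p := by
        rw [hN1] at hpN
        exact Function.minimalPeriod_eq_one_iff_isFixedPt.1 hpN
      have hm : (periodicIn G S 1).ncard = 1 := by
        rw [hN1, hfl] at hle; omega
      refine Or.inr ⟨hm, p, hp, hpS, hfix, ?_⟩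
      rw [← bigOrbit_of_next_eq hfix]
      -- After p is added there are already two fixed points, so the remaining count of 1 cannot
      -- come from adding another.
      refine (h2.resolve_right fun h3 => ?_).symm
      have h4 : (insert p (periodicIn G S 1)).ncard ≤
          (periodicIn G (S ∪ G.bigOrbit p) 1).ncard := by
        refine Set.ncard_le_ncard ?_ (hG.finite.subset fun v hv =>
          (hS.union (hG.closed_bigOrbit hp)).subset hv.1)
        rintro w (rfl | hw)
        · exact ⟨Or.inr (self_mem_bigOrbit _), by rw [hpN, hN1]⟩
        · exact ⟨Or.inl hw.1, hw.2⟩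
      rw [Set.ncard_insert_of_notMem (fun h => hpS h.1)
        (hG.finite.subset fun v hv => hS.subset hv.1), hm, h3.1] at h4
      omega
    · rintro (h | ⟨hm, Q, hQ, hQS, hfix, hv⟩)
      · exact absurd h hSv
      · have hnp : G.next p = Q := by
          have hpQ : p ∈ S ∪ {Q, G.opp Q} := hv ▸ hp
          rcases hpQ.resolve_left hpS with h | h
          · rw [h, hfix]
          · rw [h, hG.next_opp hQ, hfix]
        have hpQ : p = Q := by
          have h1 : G.next^[N] p = p := Function.iterate_minimalPeriod
          obtain ⟨c, hc⟩ := Nat.exists_eq_add_of_le' hN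
          rw [hc, Function.iterate_succ_apply, hnp, Function.iterate_fixed hfix] at h1
          exact h1.symm
        have hN1 : N = 1 := by
          rw [← hpN, Function.minimalPeriod_eq_one_iff_isFixedPt, hpQ]
          exact hfix
        refine ⟨by rw [hN1, hfl, hm]; norm_num, Or.inl ?_⟩
        rw [hpQ, bigOrbit_of_next_eq hfix, hv]

end Count

/-! ### Subgraphs -/

section Subgraph

variable {V : Type v} {G H : DGraph V}

lemma DGraph.Admissible.next_eq_of_le (hG : G.Admissible) (hH : H.Admissible) (h : H ≤ G) {v : V}
    (hv : v ∈ H.verts) : H.next v = G.next v :=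
  hG.eq_next (h.2 _ _ (hH.adj_next hv))

/-- Each vertex of H shares its image with another vertex of H, since a nonzero in-degree in H is 2.
Hence H already contains the opposites taken in G. -/
lemma DGraph.Admissible.closed_of_le (hG : G.Admissible) (hH : H.Admissible) (h : H ≤ G) :
    G.Closed H.verts := by
  refine ⟨h.1, fun v hv => ?_, fun v hv => ?_⟩
  · rw [← hG.next_eq_of_le hH h hv]; exact hH.next_mem hv
  · have h1 := hH.opp_mem hv
    have h2 : G.next (H.opp v) = G.next v := by
      rw [← hG.next_eq_of_le hH h hv, ← hG.next_eq_of_le hH h h1, hH.next_opp hv]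
    rcases hG.eq_or_eq_opp (h.1 hv) (h.1 h1) h2 with h3 | h3
    · exact absurd h3 (hH.opp_ne hv)
    · rw [← h3]; exact h1

lemma DGraph.Admissible.verts_eq_iff (hG : G.Admissible) (hH : H.Admissible) (h : H ≤ G) :
    H.verts = G.verts ↔ G = H := by
  refine ⟨fun hv => ?_, fun e => by rw [e]⟩
  ext P Q
  · rw [hv]
  · rw [hG.adj_iff, hH.adj_iff, hv]
    exact and_congr_right fun hP => by rw [hG.next_eq_of_le hH h (hv ▸ hP)]

lemma isEmb_iff_of_le (hG : G.Admissible) (hH : H.Admissible) (h : H ≤ G) {F : Type*} [Field F]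
    {t : F} {φ : V → F} : IsEmb H H.verts t φ ↔ IsEmb G H.verts t φ := by
  constructor
  · exact fun e => ⟨e.inj, fun v hv => by rw [← hG.next_eq_of_le hH h hv, e.map_next v hv]⟩
  · exact fun e => ⟨e.inj, fun v hv => by rw [hG.next_eq_of_le hH h hv, e.map_next v hv]⟩

lemma addsSecond_iff_of_le (hG : G.Admissible) (hH : H.Admissible) (h : H ≤ G) :
    AddsSecond G H.verts ↔ AddsSecondFixedPoint H G := by
  have h1 : H.fixedVerts = periodicIn G H.verts 1 := by
    ext v
    change H.Adj v v ↔ v ∈ H.verts ∧ _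
    rw [hH.adj_iff, Function.minimalPeriod_eq_one_iff_isFixedPt]
    exact and_congr_right fun hv => by rw [hG.next_eq_of_le hH h hv]; rfl
  rw [AddsSecond, AddsSecondFixedPoint, h1]
  refine and_congr_right fun _ => exists_congr fun Q => ?_
  rw [hG.adj_iff]
  tauto

end Subgraph

end DynModCurve

end

noncomputable section
namespace DynModCurve

open DGraph

universe u v

/-! ### Integrality of the coordinates over the parameter -/

lemma map_aevalAeval {R S : Type*} [CommRing R] [CommRing S] [Algebra ℤ R] [Algebra ℤ S]
    (f : R →+* S) (t x : R) (p : Polynomial (Polynomial ℤ)) :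
    f (Polynomial.aevalAeval t x p) = Polynomial.aevalAeval (f t) (f x) p := by
  have h : f.comp (Polynomial.aevalAeval t x : _ →ₐ[ℤ] R).toRingHom =
      (Polynomial.aevalAeval (f t) (f x) : _ →ₐ[ℤ] S).toRingHom := by
    refine Polynomial.ringHom_ext' (Polynomial.ringHom_ext' (RingHom.ext_int _ _) ?_) ?_ <;> simp
  exact DFunLike.congr_fun h p

/-- x is a root of f^(a+b)(X) - f^a(X), which is monic over the integral closure, a ring that
contains t. -/
lemma isIntegral_of_iter_eq {R S : Type*} [CommRing R] [CommRing S] [Algebra R S] {t x : S}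
    (ht : IsIntegral R t) {a b : ℕ} (hb : 1 ≤ b) (h : iter t x (a + b) = iter t x a) :
    IsIntegral R x := by
  nontriviality S
  let t' : integralClosure R S := ⟨t, ht⟩
  have hx : IsIntegral (integralClosure R S) x := by
    have : Nontrivial (integralClosure R S) := (algebraMap (integralClosure R S) S).domain_nontrivial
    obtain ⟨h1, h2⟩ := iter_monic_natDegree t' (a + b)
    refine ⟨iter (Polynomial.C t') Polynomial.X (a + b) - iter (Polynomial.C t') Polynomial.X a,
      h1.sub_of_left (Polynomial.degree_lt_degree ?_), ?_⟩
    · rw [h2, (iter_monic_natDegree t' a).2]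
      exact Nat.pow_lt_pow_right (by norm_num) (by omega)
    · rw [Polynomial.eval₂_sub, ← Polynomial.coe_eval₂RingHom, map_iter, map_iter]
      simp only [Polynomial.coe_eval₂RingHom, Polynomial.eval₂_C, Polynomial.eval₂_X]
      exact sub_eq_zero.2 h
  exact isIntegral_trans x hx

section Equations

variable {V : Type v} {G : DGraph V} {n : ℕ} {P : Fin n → V}

/-- The defining equations force every coordinate to be preperiodic. -/
lemma exists_iter_eq (hG : G.Admissible) (hP : G.MinGenerates P) (i : Fin n) :
    ∃ a b, 1 ≤ b ∧ ∀ {R : Type u} [CommRing R] {t : R} {x : Fin n → R},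
      (∀ i ∈ G.disjointIdx P, Polynomial.aevalAeval t (x i)
        (genDynatomic (G.preperiod (P i)) (G.eventualPeriod (P i))) = 0) →
      (∀ i ∉ G.disjointIdx P, ∀ j, G.next^[G.kappa P i] (P i) ∈ G.newVerts P j →
        iter t (x i) (G.kappa P i) + iter t (x j) (G.lambda P i j) = 0) →
      iter t (x i) (a + b) = iter t (x i) a := by
  induction i using WellFoundedLT.induction with
  | ind i ih =>
    by_cases hi : i ∈ G.disjointIdx P
    · exact ⟨_, _, (hG.hasPortrait (hP.mem_verts i)).pos, fun h1 _ =>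
        iter_eq_of_eval_genDynatomic (hG.hasPortrait (hP.mem_verts i)).pos (h1 i hi)⟩
    · obtain ⟨j, hji, hj⟩ := exists_mem_newVerts (kappa_mem hi)
      obtain ⟨a, b, hb, h⟩ := ih j hji
      refine ⟨G.kappa P i + (a + 1), b, hb, fun {R} _ {t x} h1 h2 => ?_⟩
      -- One step beyond κ removes the sign in the tail equation, because f_t(-y) = f_t(y).
      have h3 : ∀ c, iter t (x i) (G.kappa P i + (c + 1)) =
          iter t (x j) (G.lambda P i j + (c + 1)) := by
        intro c
        rw [iter_add, eq_neg_of_add_eq_zero_left (h2 i hi j hj), iter_neg_succ, ← iter_add]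
      have h4 := h h1 h2
      rw [show G.kappa P i + (a + 1) + b = G.kappa P i + ((a + b) + 1) by ring, h3, h3,
        show G.lambda P i j + (a + b + 1) = (a + b) + (G.lambda P i j + 1) by ring,
        show G.lambda P i j + (a + 1) = a + (G.lambda P i j + 1) by ring, iter_add, h4, ← iter_add]

variable (K : Type u) [Field K]

lemma map_equations {R : Type*} [CommRing R] (g : Coord K n →+* R) :
    (∀ p ∈ equations K G P, g p = 0) ↔
      (∀ i ∈ G.disjointIdx P, Polynomial.aevalAeval (g (tVar K n)) (g (xVar K i))
        (genDynatomic (G.preperiod (P i)) (G.eventualPeriod (P i))) = 0) ∧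
      (∀ i ∉ G.disjointIdx P, ∀ j, G.next^[G.kappa P i] (P i) ∈ G.newVerts P j →
        iter (g (tVar K n)) (g (xVar K i)) (G.kappa P i) +
          iter (g (tVar K n)) (g (xVar K j)) (G.lambda P i j) = 0) := by
  constructor
  · intro h
    refine ⟨fun i hi => ?_, fun i hi j hj => ?_⟩
    · rw [← map_aevalAeval]
      exact h _ (Or.inl ⟨i, hi, rfl⟩)
    · rw [← map_iter, ← map_iter, ← map_add]
      exact h _ (Or.inr ⟨i, hi, j, hj, rfl⟩)
  · rintro ⟨h1, h2⟩ p (⟨i, hi, rfl⟩ | ⟨i, hi, j, hj, rfl⟩)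
    · rw [map_aevalAeval]; exact h1 i hi
    · rw [map_add, map_iter, map_iter]; exact h2 i hi j hj

lemma ker_mem_openPart_iff {F : Type*} [Field F] (g : Coord K n →+* F) :
    (⟨RingHom.ker g, RingHom.ker_isPrime g⟩ : PrimeSpectrum (Coord K n)) ∈ openPart K G P ↔
      IsSol G P (g (tVar K n)) fun i => g (xVar K i) := by
  have h1 := map_equations (G := G) (P := P) K g
  constructor
  · rintro ⟨h2, h3⟩
    obtain ⟨h4, h5⟩ := h1.1 h2
    refine ⟨h4, h5, fun i hi j hj hji he k hk h => h3 _ ⟨i, hi, j, hj, hji, he, k, hk, rfl⟩ ?_⟩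
    rw [RingHom.mem_ker, map_sub, map_iter, map_iter, h, sub_self]
  · intro h
    refine ⟨h1.2 ⟨h.eq_disjoint, h.eq_tail⟩, ?_⟩
    rintro p ⟨i, hi, j, hj, hji, he, k, hk, rfl⟩ h2
    rw [RingHom.mem_ker, map_sub, map_iter, map_iter, sub_eq_zero] at h2
    exact h.ne i hi j hj hji he k hk h2

end Equations

/-! ### No component is contained in a fibre of the parameter -/

/-- Contraction to one variable fewer keeps the ideal maximal, as polynomial rings over a field are
Jacobson, and lowers the height by one. -/
lemma height_eq_of_isMaximal (K : Type u) [Field K] (n : ℕ) (I : Ideal (MvPolynomial (Fin n) K))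
    [hI : I.IsMaximal] : I.height = n := by
  induction n with
  | zero =>
    have : I = ⊥ := by
      by_contra h
      obtain ⟨p, hp, hp0⟩ := Submodule.exists_mem_ne_zero_of_ne_bot h
      refine hI.ne_top (Ideal.eq_top_of_isUnit_mem _ hp ?_)
      rw [MvPolynomial.eq_C_of_isEmpty p] at hp0 ⊢
      exact (isUnit_iff_ne_zero.2 fun h0 => hp0 (by rw [h0, map_zero])).map MvPolynomial.C
    rw [this, Ideal.height_bot]; rfl
  | succ n ih =>
    let e := (MvPolynomial.finSuccEquiv K n).toRingEquiv
    let J : Ideal (Polynomial (MvPolynomial (Fin n) K)) := I.comap e.symm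
    have hJ : J.IsMaximal := Ideal.comap_isMaximal_of_equiv e.symm
    have hJI : I.height = J.height := (RingEquiv.height_comap e.symm I).symm
    have hm : (J.comap Polynomial.C).IsMaximal :=
      Polynomial.isMaximal_comap_C_of_isJacobsonRing J
    have : J.LiesOver (J.comap Polynomial.C) := ⟨rfl⟩
    rw [hJI, Polynomial.height_eq_height_add_one (J.comap Polynomial.C) J, ih]
    rfl

lemma height_coord_of_isMaximal (K : Type u) [Field K] {n : ℕ} (I : Ideal (Coord K n))
    [hI : I.IsMaximal] : I.height = (n + 1 : ℕ) := by
  let e := (MvPolynomial.renameEquiv K (finSuccEquiv n)).toRingEquiv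
  have : (I.comap e).IsMaximal := Ideal.comap_isMaximal_of_equiv e
  rw [← RingEquiv.height_comap e I, height_eq_of_isMaximal]

section Density

variable {V : Type v} {G : DGraph V} {n : ℕ} {P : Fin n → V} (K : Type u) [Field K]

/-- There are at most n equations in n + 1 variables, which is the input to Krull's height theorem.
The tail equation of i is unique because the sets of new vertices are disjoint. -/
lemma exists_equations_eq_range :
    ∃ Ψ : Fin n → Coord K n, equations K G P ⊆ Set.range Ψ := by
  classical
  have h : ∀ i : Fin n, ∃ q : Coord K n, ∀ p, ((i ∈ G.disjointIdx P ∧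
      p = Polynomial.aevalAeval (tVar K n) (xVar K i)
        (genDynatomic (G.preperiod (P i)) (G.eventualPeriod (P i)))) ∨
      (i ∉ G.disjointIdx P ∧ ∃ j, G.next^[G.kappa P i] (P i) ∈ G.newVerts P j ∧
        p = iter (tVar K n) (xVar K i) (G.kappa P i) +
          iter (tVar K n) (xVar K j) (G.lambda P i j))) → p = q := by
    intro i
    by_cases hi : i ∈ G.disjointIdx P
    · exact ⟨_, fun p hp => (hp.resolve_right fun h => h.1 hi).2⟩
    · obtain ⟨j, hji, hj⟩ := exists_mem_newVerts (kappa_mem hi)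
      refine ⟨iter (tVar K n) (xVar K i) (G.kappa P i) +
        iter (tVar K n) (xVar K j) (G.lambda P i j), fun p hp => ?_⟩
      obtain ⟨-, j', hj', rfl⟩ := hp.resolve_left fun h => hi h.1
      have : j' = j := by
        rcases lt_trichotomy j' j with h | h | h
        · exact absurd ⟨j', h, hj'.1⟩ hj.2
        · exact h
        · exact absurd ⟨j, h, hj.1⟩ hj'.2
      rw [this]
  choose Ψ hΨ using h
  refine ⟨Ψ, ?_⟩
  rintro p (⟨i, hi, rfl⟩ | ⟨i, hi, j, hj, rfl⟩)
  · exact ⟨i, (hΨ i _ (Or.inl ⟨hi, rfl⟩)).symm⟩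
  · exact ⟨i, (hΨ i _ (Or.inr ⟨hi, j, hj, rfl⟩)).symm⟩

variable {K}

/-- A prime ideal containing the equations and a nonzero polynomial in `t` is maximal. -/
lemma isMaximal_of_param_mem (hG : G.Admissible) (hP : G.MinGenerates P) (q : Ideal (Coord K n))
    [hq : q.IsPrime] (heq : ∀ p ∈ equations K G P, p ∈ q) {b : Polynomial K} (hb : b ≠ 0)
    (hbq : Polynomial.aeval (tVar K n) b ∈ q) : q.IsMaximal := by
  let g := Ideal.Quotient.mk q
  have ht : IsIntegral K (g (tVar K n)) := by
    rw [← isAlgebraic_iff_isIntegral]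
    refine ⟨b, hb, ?_⟩
    rw [← Ideal.Quotient.eq_zero_iff_mem] at hbq
    rw [← hbq]
    exact Polynomial.aeval_algHom_apply (Ideal.Quotient.mkₐ K q) (tVar K n) b
  have heq' : ∀ p ∈ equations K G P, g p = 0 := fun p hp =>
    Ideal.Quotient.eq_zero_iff_mem.2 (heq p hp)
  obtain ⟨h1, h2⟩ := (map_equations K g).1 heq'
  -- Modulo q, t is algebraic over K and every coordinate is preperiodic, so the quotient is a
  -- domain integral over a field.
  have hintegral : Algebra.IsIntegral K (Coord K n ⧸ q) := by
    refine ⟨fun y => ?_⟩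
    obtain ⟨p, rfl⟩ := Ideal.Quotient.mk_surjective y
    induction p using MvPolynomial.induction_on with
    | C a => exact isIntegral_algebraMap (R := K) (A := Coord K n ⧸ q) (x := a)
    | add p₁ p₂ h₁ h₂ => rw [map_add]; exact h₁.add h₂
    | mul_X p i h =>
      rw [map_mul]
      refine h.mul ?_
      rcases i with _ | i
      · exact ht
      · obtain ⟨a, b, hb, h⟩ := exists_iter_eq.{u} hG hP i
        exact isIntegral_of_iter_eq ht hb (h h1 h2)
  rw [Ideal.Quotient.maximal_ideal_iff_isField_quotient]
  exact isField_of_isIntegral_of_isField' (Field.toIsField K)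

/-- Every point of the open part specializes from a point of the open part at which `t` is
transcendental. -/
lemma exists_generic_le (hG : G.Admissible) (hP : G.MinGenerates P)
    {x : PrimeSpectrum (Coord K n)} (hx : x ∈ openPart K G P) :
    ∃ y ∈ openPart K G P, y.asIdeal ≤ x.asIdeal ∧
      ∀ b : Polynomial K, Polynomial.aeval (tVar K n) b ∈ y.asIdeal → b = 0 := by
  obtain ⟨Ψ, hΨ⟩ := exists_equations_eq_range (G := G) (P := P) K
  have hle : Ideal.span (equations K G P) ≤ x.asIdeal := Ideal.span_le.2 hx.1
  obtain ⟨q, hq, hqx⟩ := Ideal.exists_minimalPrimes_le hle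
  have hqp : q.IsPrime := hq.1.1
  have heq : ∀ p ∈ equations K G P, p ∈ q := fun p hp => hq.1.2 (Ideal.subset_span hp)
  refine ⟨⟨q, hqp⟩, ⟨heq, fun p hp hpq => hx.2 p hp (hqx hpq)⟩, hqx, fun b hb => ?_⟩
  by_contra hb0
  have := isMaximal_of_param_mem hG hP q heq hb0 hb
  have hfin : (equations K G P).Finite := (Set.finite_range Ψ).subset hΨ
  -- Krull: a minimal prime over at most n equations has height at most n, while a maximal ideal of
  -- the coordinate ring of 𝔸^(n+1) has height n + 1.
  have h1 := Ideal.height_le_card_of_mem_minimalPrimes_span hfin hq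
  rw [height_coord_of_isMaximal] at h1
  have h2 : (equations K G P).ncard ≤ n := by
    refine (Set.ncard_le_ncard hΨ (Set.finite_range Ψ)).trans ?_
    rw [← Set.image_univ]
    refine (Set.ncard_image_le Set.finite_univ).trans ?_
    rw [Set.ncard_univ, Nat.card_eq_fintype_card, Fintype.card_fin]
  have h3 := (Nat.cast_le (α := ℕ∞)).1 h1
  omega

end Density

end DynModCurve

end

noncomputable section
namespace DynModCurve

open DGraph

universe u v

/-! ### The coordinate ring of `Y₁(G)` -/

lemma aeval_eq_aeval_unique {K A : Type*} [Field K] [CommRing A] [Algebra K A] (t : A)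
    (b : MvPolynomial Unit K) :
    MvPolynomial.aeval (fun _ : Unit => t) b =
      Polynomial.aeval t (MvPolynomial.uniqueAlgEquiv K Unit b) := by
  have h : MvPolynomial.aeval (R := K) (fun _ : Unit => t) =
      (Polynomial.aeval t).comp (MvPolynomial.uniqueAlgEquiv K Unit).toAlgHom := by
    ext i
    simp
  exact DFunLike.congr_fun h b

/-- A nonzero polynomial in `t` away from which the dynamics is good. -/
lemma exists_good_param (K : Type u) [Field K] [CharZero K] (B : ℕ) :
    ∃ b : MvPolynomial Unit K, b ≠ 0 ∧ ∀ (F : Type u) [Field F] (h : MvPolynomial Unit K →+* F),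
      h b ≠ 0 → Good B (h (MvPolynomial.X ())) := by
  obtain ⟨c, hc0, hc⟩ := exists_good_poly.{u} B
  let j : Polynomial ℤ →+* MvPolynomial Unit K :=
    Polynomial.eval₂RingHom (Int.castRingHom _) (MvPolynomial.X ())
  have hj : Function.Injective j := by
    have h1 : ((MvPolynomial.uniqueAlgEquiv K Unit : MvPolynomial Unit K ≃ₐ[K] _) :
        MvPolynomial Unit K →+* Polynomial K).comp j =
        Polynomial.mapRingHom (Int.castRingHom K) := by
      refine Polynomial.ringHom_ext' (RingHom.ext_int _ _) ?_
      simp [j]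
    have h2 : Function.Injective (Polynomial.mapRingHom (Int.castRingHom K)) :=
      Polynomial.map_injective _ Int.cast_injective
    rw [← h1, RingHom.coe_comp] at h2
    exact h2.of_comp
  refine ⟨j c, (map_ne_zero_iff j hj).2 hc0, fun F _ h hb => hc F _ ?_⟩
  have h3 : h (MvPolynomial.X ()) = (h.comp j) Polynomial.X := by simp [j]
  rw [h3, aeval_apply_X]
  exact hb

section CoordRing

variable {K : Type u} [Field K] {V : Type v} {G : DGraph V} {n : ℕ} {P : Fin n → V}

variable (K G P) in
/-- The function `t` on `Y₁(G)`. -/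
def tFun : CoordRing K G P := Ideal.Quotient.mk _ (tVar K n)

variable (K G P) in
/-- The function `x_i` on `Y₁(G)`. -/
def xFun (i : Fin n) : CoordRing K G P := Ideal.Quotient.mk _ (xVar K i)

variable (K G P) in
/-- The inclusion of `K[t]` into the coordinate ring. -/
def paramHom : MvPolynomial Unit K →+* CoordRing K G P :=
  (MvPolynomial.aeval fun _ : Unit => tFun K G P).toRingHom

lemma paramHom_X (i : Unit) : paramHom K G P (MvPolynomial.X i) = tFun K G P := by
  simp [paramHom]

lemma paramHom_C (a : K) :
    paramHom K G P (MvPolynomial.C a) = algebraMap K (CoordRing K G P) a := by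
  simp [paramHom]

instance isReduced_coordRing : _root_.IsReduced (CoordRing K G P) :=
  (Ideal.isRadical_iff_quotient_reduced _).mp (PrimeSpectrum.isRadical_vanishingIdeal _)

lemma coordRing_induction {p : CoordRing K G P → Prop}
    (h : ∀ f : Coord K n, p (Ideal.Quotient.mk _ f)) (a : CoordRing K G P) : p a := by
  obtain ⟨f, rfl⟩ := Ideal.Quotient.mk_surjective a
  exact h f

/-- Two homomorphisms out of the coordinate ring agree if they agree on `K`, `t` and the `x_i`. -/
lemma coordRing_hom_ext {R : Type*} [CommRing R] {f g : CoordRing K G P →+* R}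
    (h1 : f.comp (paramHom K G P) = g.comp (paramHom K G P))
    (h2 : ∀ i, f (xFun K G P i) = g (xFun K G P i)) : f = g := by
  refine Ideal.Quotient.ringHom_ext (MvPolynomial.ringHom_ext (fun a => ?_) fun i => ?_)
  · have := DFunLike.congr_fun h1 (MvPolynomial.C a)
    rw [RingHom.comp_apply, RingHom.comp_apply, paramHom_C] at this
    exact this
  · rcases i with _ | i
    · have := DFunLike.congr_fun h1 (MvPolynomial.X ())
      rw [RingHom.comp_apply, RingHom.comp_apply, paramHom_X] at this
      exact this
    · exact h2 i

/-- A solution of the equations over a field is a point of `Y₁(G)`. -/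
lemma exists_hom_of_isSol {F : Type*} [Field F] (k : MvPolynomial Unit K →+* F) {x : Fin n → F}
    (hx : IsSol G P (k (MvPolynomial.X ())) x) :
    ∃ g : CoordRing K G P →+* F, g.comp (paramHom K G P) = k ∧ ∀ i, g (xFun K G P i) = x i := by
  let g₀ : Coord K n →+* F := MvPolynomial.eval₂Hom (k.comp MvPolynomial.C)
    fun i : Option (Fin n) => i.elim (k (MvPolynomial.X ())) x
  have hmem := (ker_mem_openPart_iff (G := G) (P := P) K g₀).2 (by simpa [g₀] using hx)
  have hker : ∀ p ∈ PrimeSpectrum.vanishingIdeal (openPart K G P), g₀ p = 0 := fun p hp =>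
    RingHom.mem_ker.1 ((PrimeSpectrum.mem_vanishingIdeal _ p).1 hp _ hmem)
  refine ⟨Ideal.Quotient.lift _ g₀ hker, ?_, fun i => ?_⟩
  · refine MvPolynomial.ringHom_ext (fun a => ?_) fun i => ?_
    · rw [RingHom.comp_apply, paramHom_C]
      change g₀ (MvPolynomial.C a) = _
      simp [g₀]
    · rw [RingHom.comp_apply, paramHom_X, tFun, Ideal.Quotient.lift_mk]
      simp [g₀]
  · rw [xFun, Ideal.Quotient.lift_mk]
    simp [g₀]

/-- A function on `Y₁(G)` vanishes if it vanishes at all geometric points with transcendental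
`t`. -/
lemma eq_zero_of_generic (hG : G.Admissible) (hP : G.MinGenerates P) {a : CoordRing K G P}
    (h : ∀ (F : Type u) [Field F] [IsAlgClosed F] (g : CoordRing K G P →+* F),
      Function.Injective (g.comp (paramHom K G P)) → g a = 0) : a = 0 := by
  obtain ⟨p, rfl⟩ := Ideal.Quotient.mk_surjective a
  rw [Ideal.Quotient.eq_zero_iff_mem, PrimeSpectrum.mem_vanishingIdeal]
  intro x hx
  obtain ⟨y, hy, hyx, hgen⟩ := exists_generic_le hG hP hx
  apply hyx
  let D := Coord K n ⧸ y.asIdeal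
  let F := AlgebraicClosure (FractionRing D)
  let j : D →+* F := (algebraMap (FractionRing D) F).comp (algebraMap D (FractionRing D))
  have hj : Function.Injective j :=
    (algebraMap (FractionRing D) F).injective.comp (IsFractionRing.injective D (FractionRing D))
  have hle : ∀ q ∈ PrimeSpectrum.vanishingIdeal (openPart K G P),
      (j.comp (Ideal.Quotient.mk y.asIdeal)) q = 0 := fun q hq => by
    rw [RingHom.comp_apply, Ideal.Quotient.eq_zero_iff_mem.2, map_zero]
    exact (PrimeSpectrum.mem_vanishingIdeal _ q).1 hq y hy
  have h0 := h F (Ideal.Quotient.lift _ (j.comp (Ideal.Quotient.mk y.asIdeal)) hle) (by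
    rw [injective_iff_map_eq_zero]
    intro b hb
    have h1 : paramHom K G P b =
        Ideal.Quotient.mk _ (MvPolynomial.aeval (fun _ : Unit => tVar K n) b) := by
      have : paramHom K G P = (Ideal.Quotient.mk _).comp
          (MvPolynomial.aeval (R := K) (fun _ : Unit => tVar K n)).toRingHom := by
        refine MvPolynomial.ringHom_ext (fun a => ?_) fun i => ?_
        · rw [paramHom_C]; simp; rfl
        · rw [paramHom_X]; simp [tFun]
      rw [this]; rfl
    rw [RingHom.comp_apply, h1, Ideal.Quotient.lift_mk, RingHom.comp_apply,
      map_eq_zero_iff j hj, Ideal.Quotient.eq_zero_iff_mem, aeval_eq_aeval_unique] at hb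
    have := hgen _ hb
    exact (map_eq_zero_iff _ (MvPolynomial.uniqueAlgEquiv K Unit).injective).1 this)
  rw [Ideal.Quotient.lift_mk, RingHom.comp_apply, map_eq_zero_iff j hj,
    Ideal.Quotient.eq_zero_iff_mem] at h0
  exact h0

/-- No component of Y₁(G) lies over a root of b: b(t) is nonzero at every geometric point with
transcendental t, and those points detect zero. -/
lemma paramHom_mem_nonZeroDivisors (hG : G.Admissible) (hP : G.MinGenerates P)
    {b : MvPolynomial Unit K} (hb : b ≠ 0) :
    paramHom K G P b ∈ nonZeroDivisors (CoordRing K G P) := by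
  rw [mem_nonZeroDivisors_iff_right]
  intro a ha
  refine eq_zero_of_generic hG hP fun F _ _ g hg => ?_
  have h1 : g a * g (paramHom K G P b) = 0 := by rw [← map_mul, ha, map_zero]
  refine (mul_eq_zero.1 h1).resolve_right fun h2 => hb ?_
  exact (map_eq_zero_iff _ hg).1 h2

lemma equations_coordRing :
    (∀ i ∈ G.disjointIdx P, Polynomial.aevalAeval (tFun K G P) (xFun K G P i)
        (genDynatomic (G.preperiod (P i)) (G.eventualPeriod (P i))) = 0) ∧
      (∀ i ∉ G.disjointIdx P, ∀ j, G.next^[G.kappa P i] (P i) ∈ G.newVerts P j →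
        iter (tFun K G P) (xFun K G P i) (G.kappa P i) +
          iter (tFun K G P) (xFun K G P j) (G.lambda P i j) = 0) :=
  (map_equations K (Ideal.Quotient.mk _)).1 fun p hp => by
    rw [Ideal.Quotient.eq_zero_iff_mem, PrimeSpectrum.mem_vanishingIdeal]
    exact fun x hx => hx.1 p hp

/-- These functions vanish nowhere on the open part, which is dense in Y₁(G) by definition. -/
lemma nonEquations_mem_nonZeroDivisors {p : Coord K n} (hp : p ∈ nonEquations K G P) :
    (Ideal.Quotient.mk _ p : CoordRing K G P) ∈ nonZeroDivisors (CoordRing K G P) := by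
  rw [mem_nonZeroDivisors_iff_right]
  refine coordRing_induction fun f hf => ?_
  rw [← map_mul, Ideal.Quotient.eq_zero_iff_mem, PrimeSpectrum.mem_vanishingIdeal] at hf
  rw [Ideal.Quotient.eq_zero_iff_mem, PrimeSpectrum.mem_vanishingIdeal]
  exact fun x hx => (x.isPrime.mem_or_mem (hf x hx)).resolve_right (hx.2 p hp)

/-- If two roots of `p` differ by a nonzerodivisor, then at every point where they coincide the
derivative vanishes. -/
lemma eval_derivative_eq_zero_of_nonZeroDivisor {A F : Type*} [CommRing A] [Field F] (g : A →+* F)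
    {p : Polynomial A} {y w : A} (hy : p.eval y = 0) (hw : p.eval w = 0)
    (hd : y - w ∈ nonZeroDivisors A) (hg : g y = g w) : g (p.derivative.eval w) = 0 := by
  obtain ⟨k, hk⟩ := p.binomExpansion w (y - w)
  rw [add_sub_cancel, hy, hw] at hk
  have h1 : (p.derivative.eval w + k * (y - w)) * (y - w) = 0 := by linear_combination -hk
  have h2 := (mul_right_mem_nonZeroDivisors_eq_zero_iff hd).1 h1
  have h3 := congrArg g h2
  rw [map_add, map_mul, map_sub, hg, sub_self, mul_zero, add_zero, map_zero] at h3
  exact h3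

lemma eval_dynatomic_iter_add {R : Type*} [CommRing R] {t x : R} {N : ℕ} (h1 : 1 ≤ N) {M : ℕ}
    (h : (atParam t (dynatomic N)).eval (iter t x M) = 0) (k : ℕ) :
    (atParam t (dynatomic N)).eval (iter t x (M + k)) = 0 := by
  induction k with
  | zero => exact h
  | succ k ih =>
    obtain ⟨q, hq⟩ := dynatomic_comp_dvd h1 (M + k)
    rw [← eval_iter, ← atParam_iterPoly, ← Polynomial.eval_comp, ← atParam_comp] at ih ⊢
    rw [← add_assoc, hq, map_mul, Polynomial.eval_mul, ih, zero_mul]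

lemma atParam_map {R S : Type*} [CommRing R] [CommRing S] (g : R →+* S) (t : R)
    (p : Polynomial (Polynomial ℤ)) : (atParam t p).map g = atParam (g t) p := by
  have h : (Polynomial.mapRingHom g).comp (atParam t) = atParam (g t) := by
    refine Polynomial.ringHom_ext' (Polynomial.ringHom_ext' (RingHom.ext_int _ _) ?_) ?_ <;>
      simp [atParam]
  exact DFunLike.congr_fun h p

/-- A point of `Y₁(G)` at a good parameter satisfies the inequations. -/
lemma isSol_of_hom (hG : G.Admissible) (hP : G.MinGenerates P) {F : Type*} [Field F]
    (g : CoordRing K G P →+* F) (hg : Good G.verts.ncard (g (tFun K G P))) :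
    IsSol G P (g (tFun K G P)) fun i => g (xFun K G P i) := by
  have hm := hP.mem_verts
  have h0 := (map_equations (G := G) (P := P) K (g.comp (Ideal.Quotient.mk _))).1 fun p hp => by
    rw [RingHom.comp_apply, Ideal.Quotient.eq_zero_iff_mem.2, map_zero]
    rw [PrimeSpectrum.mem_vanishingIdeal]
    exact fun x hx => hx.1 p hp
  refine ⟨h0.1, h0.2, fun i hi j hj hji he k hk heq => ?_⟩
  set N := G.eventualPeriod (P i) with hN
  have hN1 : 1 ≤ N := (hG.hasPortrait (hm i)).pos
  have hNB : N ≤ G.verts.ncard := hG.eventualPeriod_le (hm i)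
  set t := tFun K G P
  set y := iter t (xFun K G P i) (G.preperiod (P i)) with hy
  set w := iter t (xFun K G P j) (G.preperiod (P j) + k) with hw
  -- Both `y` and `w` are roots of Φ_N over the whole curve and differ by a nonzerodivisor. If they
  -- met at this point, their common value would be a multiple root of Φ_N, which a good parameter
  -- excludes.
  have hy0 : (atParam t (dynatomic N)).eval y = 0 :=
    aevalAeval_dynatomic_iter hN1 (equations_coordRing.1 i hi)
  have hw0 : (atParam t (dynatomic N)).eval w = 0 :=
    eval_dynatomic_iter_add hN1
      (aevalAeval_dynatomic_iter hN1 (by rw [he]; exact equations_coordRing.1 j hj)) k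
  have hd : y - w ∈ nonZeroDivisors (CoordRing K G P) := by
    have := nonEquations_mem_nonZeroDivisors (K := K) (G := G) (P := P)
      ⟨i, hi, j, hj, hji, he, k, hk, rfl⟩
    rwa [map_sub, map_iter, map_iter] at this
  have hgyw : g y = g w := by rw [hy, hw, map_iter, map_iter]; exact heq
  have h1 := eval_derivative_eq_zero_of_nonZeroDivisor g hy0 hw0 hd hgyw
  rw [← Polynomial.eval_map_apply, ← Polynomial.derivative_map, atParam_map] at h1
  refine hg.eval_derivative_dynatomic_ne_zero hN1 hNB ?_ h1
  rw [← atParam_map, Polynomial.eval_map_apply, hw0, map_zero]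

lemma charZero_of_hom [CharZero K] {F : Type*} [Field F] (g : CoordRing K G P →+* F) :
    CharZero F :=
  charZero_of_injective_ringHom ((g.comp (algebraMap K (CoordRing K G P))).injective)

/-- Points of `Y₁(G)` at good parameters are embeddings of `G`. -/
lemma exists_isEmb_of_hom [CharZero K] (hG : G.Admissible) (hP : G.MinGenerates P) {F : Type*}
    [Field F] (g : CoordRing K G P →+* F) (hg : Good G.verts.ncard (g (tFun K G P))) :
    ∃ φ, IsEmb G G.verts (g (tFun K G P)) φ ∧ ∀ i, φ (P i) = g (xFun K G P i) :=
  have := charZero_of_hom g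
  (isSol_of_hom hG hP g hg).exists_isEmb hG hP hg

lemma exists_hom_of_isEmb [CharZero K] (hG : G.Admissible) (hP : G.MinGenerates P) {F : Type*}
    [Field F] (k : MvPolynomial Unit K →+* F) (hk : Good G.verts.ncard (k (MvPolynomial.X ())))
    {φ : V → F} (hφ : IsEmb G G.verts (k (MvPolynomial.X ())) φ) :
    ∃ g : CoordRing K G P →+* F, g.comp (paramHom K G P) = k ∧
      ∀ i, g (xFun K G P i) = φ (P i) :=
  have : CharZero F := charZero_of_injective_ringHom (k.comp MvPolynomial.C).injective
  exists_hom_of_isSol k (hφ.isSol hG hP hk)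

lemma good_of_generic [CharZero K] {F : Type u} [Field F] {k : MvPolynomial Unit K →+* F}
    (hk : Function.Injective k) (B : ℕ) : Good B (k (MvPolynomial.X ())) := by
  obtain ⟨b, hb0, hb⟩ := exists_good_param K B
  exact hb F k ((map_ne_zero_iff k hk).2 hb0)

lemma hom_tFun {R : Type*} [CommRing R] (g : CoordRing K G P →+* R) :
    g (tFun K G P) = g.comp (paramHom K G P) (MvPolynomial.X ()) := by
  rw [RingHom.comp_apply, paramHom_X]

/-- The functions `x_i` have the expected portrait. -/
lemma iter_xFun [CharZero K] (hG : G.Admissible) (hP : G.MinGenerates P) (i : Fin n) :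
    iter (tFun K G P) (xFun K G P i) (G.preperiod (P i) + G.eventualPeriod (P i)) =
      iter (tFun K G P) (xFun K G P i) (G.preperiod (P i)) := by
  rw [← sub_eq_zero]
  refine eq_zero_of_generic hG hP fun F _ _ g hg => ?_
  have hgood : Good G.verts.ncard (g (tFun K G P)) := by
    rw [hom_tFun]; exact good_of_generic hg _
  obtain ⟨φ, hφ, hφx⟩ := exists_isEmb_of_hom hG hP g hgood
  have h1 := (hφ.hasPortrait hG hG.closed_verts (hP.mem_verts i)).period
  rw [map_sub, map_iter, map_iter, sub_eq_zero, ← hφx]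
  exact iter_add_minimalPeriod _ _ _ h1

lemma iterDeriv_add {R : Type*} [CommRing R] (t x : R) (a b : ℕ) :
    iterDeriv t x (a + b) = iterDeriv t x a * iterDeriv t (iter t x a) b := by
  simp only [iterDeriv, Finset.prod_range_add, iter_iter]

/-- The functions `x_i` are separable over good parameters. -/
lemma hom_iterDeriv_ne_zero [CharZero K] (hG : G.Admissible) (hP : G.MinGenerates P) {F : Type*}
    [Field F] (g : CoordRing K G P →+* F) (hg : Good G.verts.ncard (g (tFun K G P))) (i : Fin n) :
    g (iterDeriv (tFun K G P) (xFun K G P i) (G.preperiod (P i) + G.eventualPeriod (P i)) -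
      iterDeriv (tFun K G P) (xFun K G P i) (G.preperiod (P i))) ≠ 0 := by
  have := charZero_of_hom g
  have hm := hP.mem_verts i
  have h0 := congrArg g (iter_xFun (K := K) hG hP i)
  rw [map_iter, map_iter] at h0
  have hpos := (hG.hasPortrait hm).pos
  -- By the chain rule the difference is (f^M)'(x) · ((f^N)'(f^M(x)) - 1): the orbit avoids 0, and
  -- the periodic point is simple.
  rw [map_sub, map_iterDeriv, map_iterDeriv, iterDeriv_add, ← mul_sub_one]
  refine mul_ne_zero (hg.iterDeriv_ne_zero (hG.preperiod_le hm) hpos (hG.eventualPeriod_le hm)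
    h0 _) (sub_ne_zero.2 ?_)
  refine hg.simple _ hpos (hG.eventualPeriod_le hm) _ ?_
  rw [iter_iter, h0]

end CoordRing

/-! ### Functoriality of the coordinate ring and its fibres -/

section Functoriality

variable {V : Type v} {G H : DGraph V} {n m : ℕ} {P : Fin n → V} {Q : Fin m → V}
  {K : Type u} [Field K] [CharZero K]

/-- Each generator of H is ±f^k(P_i) in G, so its coordinate must be ±f_t^k(x_i). That these
functions satisfy the relations of Y₁(H) is checked at generic points, where they come from
restricting an embedding of G. The last clause says that on points the map is restriction. -/
lemma exists_coordRing_hom (hG : G.Admissible) (hH : H.Admissible) (hHG : H ≤ G)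
    (hP : G.MinGenerates P) (hQ : H.MinGenerates Q) :
    ∃ ι : CoordRing K H Q →+* CoordRing K G P,
      ι.comp (paramHom K H Q) = paramHom K G P ∧
      ∀ (F : Type u) [Field F] (g : CoordRing K G P →+* F) (φ : V → F),
        IsEmb G G.verts (g (tFun K G P)) φ → (∀ i, φ (P i) = g (xFun K G P i)) →
        ∀ j, g (ι (xFun K H Q j)) = φ (Q j) := by
  have hex : ∀ j, ∃ e : CoordRing K G P,
      ∀ (F : Type u) [Field F] (g : CoordRing K G P →+* F) (φ : V → F),
        IsEmb G G.verts (g (tFun K G P)) φ → (∀ i, φ (P i) = g (xFun K G P i)) →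
        g e = φ (Q j) := by
    intro j
    obtain ⟨_, ⟨i, rfl⟩, k, hk | hk⟩ := hP.1.2 _ (hHG.1 (hQ.mem_verts j))
    · refine ⟨iter (tFun K G P) (xFun K G P i) k, fun F _ g φ hφ hφx => ?_⟩
      rw [map_iter, hk, hφ.map_iterate hG.closed_verts (hP.mem_verts i), hφx]
    · refine ⟨-iter (tFun K G P) (xFun K G P i) k, fun F _ g φ hφ hφx => ?_⟩
      rw [map_neg, map_iter, hk, hφ.map_opp hG hG.closed_verts (hG.iterate_mem (hP.mem_verts i) k),
        hφ.map_iterate hG.closed_verts (hP.mem_verts i), hφx]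
  choose e he using hex
  let ι₀ : Coord K m →+* CoordRing K G P := MvPolynomial.eval₂Hom (algebraMap K _)
    fun i : Option (Fin m) => i.elim (tFun K G P) e
  have hι₀t : ι₀ (tVar K m) = tFun K G P := by simp [ι₀]
  have hι₀x : ∀ j, ι₀ (xVar K j) = e j := fun j => by simp [ι₀]
  have hι₀C : ∀ a, ι₀ (MvPolynomial.C a) = algebraMap K _ a := fun a => by simp [ι₀]
  have hker : ∀ p ∈ PrimeSpectrum.vanishingIdeal (openPart K H Q), ι₀ p = 0 := by
    intro p hp
    refine eq_zero_of_generic hG hP fun F _ _ g hg => ?_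
    have := charZero_of_hom g
    have hgood : ∀ B, Good B (g (tFun K G P)) := fun B => by
      rw [hom_tFun]; exact good_of_generic hg _
    obtain ⟨φ, hφ, hφx⟩ := exists_isEmb_of_hom hG hP g (hgood _)
    have hφH : IsEmb H H.verts (g (tFun K G P)) φ :=
      (isEmb_iff_of_le hG hH hHG).2 (hφ.mono hHG.1)
    have hsol := hφH.isSol hH hQ (hgood _)
    refine (PrimeSpectrum.mem_vanishingIdeal _ p).1 hp _
      ((ker_mem_openPart_iff (G := H) (P := Q) K (g.comp ι₀)).2 ?_)
    convert hsol using 1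
    · rw [RingHom.comp_apply, hι₀t]
    · ext j
      rw [RingHom.comp_apply, hι₀x, he j F g φ hφ hφx]; rfl
  refine ⟨Ideal.Quotient.lift _ ι₀ hker, ?_, fun F _ g φ hφ hφx j => ?_⟩
  · refine MvPolynomial.ringHom_ext (fun a => ?_) fun i => ?_
    · rw [RingHom.comp_apply, paramHom_C, paramHom_C]
      exact hι₀C a
    · rw [RingHom.comp_apply, paramHom_X, paramHom_X, tFun, Ideal.Quotient.lift_mk, hι₀t]
  · rw [xFun, Ideal.Quotient.lift_mk, hι₀x, he j F g φ hφ hφx]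

/-- The fibres of `Y₁(G) → Y₁(H)` over good parameters are the sets of extensions of
embeddings. -/
lemma encard_fibre_coordRing (hG : G.Admissible) (hH : H.Admissible) (hHG : H ≤ G)
    (hP : G.MinGenerates P) (hQ : H.MinGenerates Q) {ι : CoordRing K H Q →+* CoordRing K G P}
    (h1 : ι.comp (paramHom K H Q) = paramHom K G P)
    (h2 : ∀ (F : Type u) [Field F] (g : CoordRing K G P →+* F) (φ : V → F),
        IsEmb G G.verts (g (tFun K G P)) φ → (∀ i, φ (P i) = g (xFun K G P i)) →
        ∀ j, g (ι (xFun K H Q j)) = φ (Q j))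
    {F : Type u} [Field F] (g : CoordRing K H Q →+* F)
    (hg : Good G.verts.ncard (g (tFun K H Q))) :
    ∃ φ, IsEmb G H.verts (g (tFun K H Q)) φ ∧ {f : CoordRing K G P →+* F | f.comp ι = g}.encard =
      (extensions G H.verts (g (tFun K H Q)) φ).encard := by
  classical
  have hcard : H.verts.ncard ≤ G.verts.ncard := Set.ncard_le_ncard hHG.1 hG.finite
  obtain ⟨φ, hφ, hφx⟩ := exists_isEmb_of_hom hH hQ g (hg.mono hcard)
  refine ⟨φ, (isEmb_iff_of_le hG hH hHG).1 hφ, ?_⟩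
  have hcomp : ∀ f : CoordRing K G P →+* F, f.comp ι = g →
      f.comp (paramHom K G P) = g.comp (paramHom K H Q) := fun f hf => by
    rw [← h1, ← hf, RingHom.comp_assoc]
  have ht : ∀ f : CoordRing K G P →+* F, f.comp ι = g → f (tFun K G P) = g (tFun K H Q) :=
    fun f hf => by rw [hom_tFun, hcomp f hf, ← hom_tFun]
  have hEx : ∀ f : CoordRing K G P →+* F, f.comp ι = g →
      ∃ ψ, IsEmb G G.verts (g (tFun K H Q)) ψ ∧ (∀ i, ψ (P i) = f (xFun K G P i)) ∧
        ∀ v ∉ G.verts, ψ v = 0 := by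
    intro f hf
    obtain ⟨ψ, hψ, hψx⟩ := exists_isEmb_of_hom hG hP f (by rw [ht f hf]; exact hg)
    have he : Set.EqOn (fun v => if v ∈ G.verts then ψ v else 0) ψ G.verts := fun v hv => if_pos hv
    refine ⟨fun v => if v ∈ G.verts then ψ v else 0, ?_, fun i => ?_, fun v hv => if_neg hv⟩
    · rw [← ht f hf]
      exact hψ.congr hG.closed_verts he
    · rw [he (hP.mem_verts i), hψx]
  choose! Ψ hΨ1 hΨ2 hΨ3 using hEx
  -- The fibre is carried by `Ψ` onto the set of extensions; it is injective since a homomorphism is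
  -- determined by its values on K, t and the x_i.
  have hinj : Set.InjOn Ψ {f : CoordRing K G P →+* F | f.comp ι = g} := by
    intro f hf f' hf' he
    refine coordRing_hom_ext ((hcomp f hf).trans (hcomp f' hf').symm) fun i => ?_
    rw [← hΨ2 f hf, ← hΨ2 f' hf', he]
  rw [← hinj.encard_image]
  congr 1
  ext ψ
  constructor
  · rintro ⟨f, hf, rfl⟩
    refine ⟨hΨ1 f hf, ?_, hΨ3 f hf⟩
    have hH' : IsEmb H H.verts (g (tFun K H Q)) (Ψ f) :=
      (isEmb_iff_of_le hG hH hHG).2 ((hΨ1 f hf).mono hHG.1)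
    refine hH'.eqOn_verts hH hQ hφ fun j => ?_
    rw [hφx, ← h2 F f (Ψ f) (by rw [ht f hf]; exact hΨ1 f hf) (hΨ2 f hf) j]
    exact DFunLike.congr_fun hf (xFun K H Q j)
  · rintro ⟨hψ1, hψ2, hψ3⟩
    have htk : (g.comp (paramHom K H Q)) (MvPolynomial.X ()) = g (tFun K H Q) := (hom_tFun g).symm
    obtain ⟨f, hf1, hf2⟩ := exists_hom_of_isEmb (P := P) hG hP (g.comp (paramHom K H Q))
      (by rw [htk]; exact hg) (φ := ψ) (by rw [htk]; exact hψ1)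
    have hft : f (tFun K G P) = g (tFun K H Q) := by rw [hom_tFun, hf1, htk]
    have hfι : f.comp ι = g := by
      refine coordRing_hom_ext (by rw [RingHom.comp_assoc, h1, hf1]) fun j => ?_
      rw [RingHom.comp_apply, h2 F f ψ (by rw [hft]; exact hψ1) (fun i => (hf2 i).symm) j,
        hψ2 (hQ.mem_verts j), hφx]
    refine ⟨f, hfι, ?_⟩
    ext v
    by_cases hv : v ∈ G.verts
    · exact (hΨ1 f hfι).eqOn_verts hG hP hψ1 (fun i => by rw [hΨ2 f hfι, hf2]) hv
    · rw [hΨ3 f hfι v hv, hψ3 v hv]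

end Functoriality

end DynModCurve

end

noncomputable section
namespace DynModCurve

/-! ### Étale algebras over normal domains are integrally closed -/

section Etale

open scoped nonZeroDivisors TensorProduct

/-- L is S ⊗ Frac R, and forming the integral closure commutes with smooth base change. So the
closure of S in L is the image of S tensored with the closure of R in Frac R, which is R. -/
lemma mem_range_of_isIntegral_of_etale {R S L : Type*} [CommRing R] [IsDomain R]
    [IsIntegrallyClosed R] [CommRing S] [CommRing L] [Algebra R S] [Algebra.Etale R S]
    [Algebra S L] [IsLocalization (Algebra.algebraMapSubmonoid S R⁰) L] {z : L}
    (hz : IsIntegral S z) : z ∈ (algebraMap S L).range := by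
  let E := FractionRing R
  let e : S ⊗[R] E ≃ₐ[S] L :=
    IsLocalization.algEquiv (Algebra.algebraMapSubmonoid S R⁰) (S ⊗[R] E) L
  have hw : IsIntegral S (e.symm z) := hz.map e.symm
  obtain ⟨y, hy⟩ := (TensorProduct.toIntegralClosure_bijective_of_smooth (R := R) (S := S)
    (B := E)).2 ⟨e.symm z, hw⟩
  have hy' : (TensorProduct.toIntegralClosure R S E y : S ⊗[R] E) = e.symm z := by rw [hy]
  have key : ∀ y : S ⊗[R] integralClosure R E,
      ∃ s : S, (TensorProduct.toIntegralClosure R S E y : S ⊗[R] E) = algebraMap S _ s := by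
    intro y
    induction y with
    | zero => exact ⟨0, by simp⟩
    | add a b ha hb =>
      obtain ⟨s, hs⟩ := ha
      obtain ⟨s', hs'⟩ := hb
      exact ⟨s + s', by rw [map_add, map_add, ← hs, ← hs']; rfl⟩
    | tmul s c =>
      obtain ⟨r, hr⟩ := IsIntegrallyClosed.isIntegral_iff.1 c.2
      refine ⟨s * algebraMap R S r, ?_⟩
      have h1 : (TensorProduct.toIntegralClosure R S E (s ⊗ₜ c) : S ⊗[R] E) = s ⊗ₜ (c : E) := rfl
      rw [h1, ← hr, Algebra.TensorProduct.algebraMap_apply, Algebra.algebraMap_eq_smul_one,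
        ← TensorProduct.smul_tmul, Algebra.smul_def, mul_comm]
      rfl
  obtain ⟨s, hs⟩ := key y
  refine ⟨s, ?_⟩
  rw [hs] at hy'
  rw [← e.commutes s, hy', e.apply_symm_apply]

variable {R A S : Type*} [CommRing R] [CommRing A] [CommRing S] [Algebra R A] [Algebra A S]
  [Algebra R S] [IsScalarTower R A S]

/-- From f(x) = 0 one gets f'(x) dx = 0, and f'(x) is a unit, so the differentials of the generators
vanish. The Leibniz rule extends this to sums, products and fractions. -/
lemma formallyUnramified_of_adjoin (M : Submonoid A) [IsLocalization M S]
    {s : Set A} (hs : Algebra.adjoin R s = ⊤)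
    (h : ∀ x ∈ s, ∃ f : Polynomial R, Polynomial.aeval x f = 0 ∧
      IsUnit (algebraMap A S (Polynomial.aeval x (Polynomial.derivative f)))) :
    Algebra.FormallyUnramified R S := by
  let D := KaehlerDifferential.D R S
  have hDA : ∀ a : A, D (algebraMap A S a) = 0 := by
    intro a
    have ha : a ∈ Algebra.adjoin R s := hs ▸ Algebra.mem_top
    induction ha using Algebra.adjoin_induction with
    | mem x hx =>
      obtain ⟨f, hf, hu⟩ := h x hx
      have h1 := Derivation.map_aeval D f (algebraMap A S x)
      rw [Polynomial.aeval_algebraMap_apply, hf, map_zero, map_zero,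
        Polynomial.aeval_algebraMap_apply] at h1
      exact (hu.smul_eq_zero).1 h1.symm
    | algebraMap r =>
      rw [← IsScalarTower.algebraMap_apply]; exact D.map_algebraMap r
    | add x y _ _ hx hy => rw [map_add, map_add, hx, hy, add_zero]
    | mul x y _ _ hx hy =>
      rw [map_mul, Derivation.leibniz, hx, hy, smul_zero, smul_zero, add_zero]
  have hD : ∀ a, D a = 0 := by
    intro a
    obtain ⟨⟨c, m⟩, hm⟩ := IsLocalization.surj M a
    have h1 := congrArg D hm
    rw [hDA, Derivation.leibniz, hDA, smul_zero, zero_add] at h1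
    exact ((IsLocalization.map_units S m).smul_eq_zero).1 h1
  refine ⟨?_⟩
  rw [← not_nontrivial_iff_subsingleton]
  intro hn
  have h1 : (⊤ : Submodule S (KaehlerDifferential R S)) = ⊥ := by
    rw [← KaehlerDifferential.span_range_derivation, Submodule.span_eq_bot]
    rintro _ ⟨a, rfl⟩
    exact hD a
  exact top_ne_bot h1

/-- A torsion-free algebra over a Dedekind domain, generated by elements that are simple roots after
inverting `b`, becomes étale after inverting `b`. -/
lemma etale_away [IsDedekindDomain R] {b : R} [IsLocalization.Away (algebraMap R A b) S]
    (htf : ∀ r : R, r ≠ 0 → algebraMap R A r ∈ A⁰) {s : Set A} (hsf : s.Finite)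
    (hs : Algebra.adjoin R s = ⊤)
    (h : ∀ x ∈ s, ∃ f : Polynomial R, Polynomial.aeval x f = 0 ∧
      IsUnit (algebraMap A S (Polynomial.aeval x (Polynomial.derivative f)))) :
    Algebra.Etale R S := by
  have hA : Algebra.FiniteType R A := ⟨⟨hsf.toFinset, by simpa using hs⟩⟩
  have hS : Algebra.FiniteType A S :=
    have := IsLocalization.Away.finitePresentation (S := S) (algebraMap R A b)
    inferInstance
  have hRS : Algebra.FiniteType R S := Algebra.FiniteType.trans hA hS
  have hfp : Algebra.FinitePresentation R S := Algebra.FinitePresentation.of_finiteType.1 hRS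
  have htor : Module.IsTorsionFree R S := by
    constructor
    intro r hr x y hxy
    have hr0 : r ≠ 0 := hr.ne_zero
    obtain ⟨⟨a, m⟩, hm⟩ := IsLocalization.surj (Submonoid.powers (algebraMap R A b)) (x - y)
    have hr' : algebraMap R S r * (x - y) = 0 := by
      rw [mul_sub, ← Algebra.smul_def, ← Algebra.smul_def]; exact sub_eq_zero.2 hxy
    have h1 : algebraMap A S (algebraMap R A r * a) = 0 := by
      rw [map_mul, ← hm, ← IsScalarTower.algebraMap_apply, ← mul_assoc, hr', zero_mul]
    obtain ⟨c, hc⟩ := (IsLocalization.map_eq_zero_iff (Submonoid.powers (algebraMap R A b)) S _).1 h1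
    have h2 : (c : A) * a = 0 := by
      have h3 : ((c : A) * a) * algebraMap R A r = 0 := by linear_combination hc
      exact (mul_right_mem_nonZeroDivisors_eq_zero_iff (htf r hr0)).1 h3
    have h4 : algebraMap A S a = 0 :=
      (IsLocalization.map_eq_zero_iff (Submonoid.powers (algebraMap R A b)) S _).2 ⟨c, h2⟩
    rw [h4] at hm
    exact sub_eq_zero.1 (((IsLocalization.map_units S m).mul_left_eq_zero).1 hm)
  have hunr : Algebra.FormallyUnramified R S :=
    formallyUnramified_of_adjoin (Submonoid.powers (algebraMap R A b)) hs h
  -- Torsion-free over a Dedekind domain is flat; flat, unramified and finitely presented is étale.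
  exact Algebra.Etale.of_formallyUnramified_of_flat

/-- The total ring of fractions is obtained by inverting the nonzero elements of the base. -/
lemma isLocalization_fractionRing [IsDomain R] {L : Type*} [CommRing L] [Algebra A L]
    [Algebra S L] [IsScalarTower A S L] [IsFractionRing A L] [Algebra.IsIntegral R A]
    (htf : ∀ r : R, r ≠ 0 → algebraMap R A r ∈ A⁰) (hinj : Function.Injective (algebraMap S L)) :
    IsLocalization (Algebra.algebraMapSubmonoid S R⁰) L := by
  refine ⟨?_, fun z => ?_, fun {x y} hxy => ⟨1, by rw [hinj hxy]⟩⟩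
  · rintro ⟨_, r, hr, rfl⟩
    have h1 := IsLocalization.map_units L (⟨_, htf r (nonZeroDivisors.ne_zero hr)⟩ : A⁰)
    rw [IsScalarTower.algebraMap_apply A S L, ← IsScalarTower.algebraMap_apply R A S] at h1
    exact h1
  · obtain ⟨⟨a, c⟩, hc⟩ := IsLocalization.surj A⁰ z
    -- A nonzerodivisor that is algebraic over R divides a nonzero element of R, so every
    -- denominator may be taken from R.
    obtain ⟨r, hr0, d, hd⟩ := (Algebra.IsIntegral.isIntegral (R := R) (c : A)).isAlgebraic
      |>.exists_nonzero_dvd c.2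
    refine ⟨⟨algebraMap A S (a * d), ⟨algebraMap R S r, r, mem_nonZeroDivisors_of_ne_zero hr0, rfl⟩⟩, ?_⟩
    change z * algebraMap S L (algebraMap R S r) = algebraMap S L (algebraMap A S (a * d))
    rw [IsScalarTower.algebraMap_apply R A S, hd, ← IsScalarTower.algebraMap_apply A S L,
      ← IsScalarTower.algebraMap_apply A S L, map_mul, map_mul, ← mul_assoc, hc]

/-- Combines the preceding results for bare ring homomorphisms: S is étale over R, and L inverts the
nonzero elements of R in S. -/
lemma mem_range_of_isIntegralElem {R A S L ι : Type*} [CommRing R] [IsDedekindDomain R]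
    [CommRing A] [CommRing S] [CommRing L] [Algebra A S] [Algebra A L] [IsFractionRing A L]
    [Finite ι] {f : R →+* A} {b : R} [IsLocalization.Away (f b) S] (hf : f.IsIntegral)
    (htf : ∀ r : R, r ≠ 0 → f r ∈ A⁰) {j : S →+* L} (hj : j.comp (algebraMap A S) = algebraMap A L)
    (hinj : Function.Injective j) {x : ι → A}
    (hgen : Subring.closure (Set.range f ∪ Set.range x) = ⊤)
    (h : ∀ i, ∃ p : Polynomial R, p.eval₂ f (x i) = 0 ∧
      IsUnit (algebraMap A S ((Polynomial.derivative p).eval₂ f (x i))))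
    {z : L} (hz : j.IsIntegralElem z) : z ∈ j.range := by
  let := f.toAlgebra
  let := ((algebraMap A S).comp f).toAlgebra
  let := j.toAlgebra
  have : IsScalarTower R A S := .of_algebraMap_eq' rfl
  have : IsScalarTower A S L := .of_algebraMap_eq' hj.symm
  have : Algebra.IsIntegral R A := ⟨hf⟩
  have : IsLocalization.Away (algebraMap R A b) S := ‹IsLocalization.Away (f b) S›
  have hadj : Algebra.adjoin R (Set.range x) = ⊤ := by
    rw [eq_top_iff]
    rintro a -
    have ha : a ∈ Subring.closure (Set.range f ∪ Set.range x) := hgen ▸ Subring.mem_top a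
    refine (Subring.closure_le (t := (Algebra.adjoin R (Set.range x)).toSubring)).2 ?_ ha
    rintro _ (⟨r, rfl⟩ | ⟨i, rfl⟩)
    · exact Subalgebra.algebraMap_mem (Algebra.adjoin R (Set.range x)) r
    · exact Algebra.subset_adjoin ⟨i, rfl⟩
  have het : Algebra.Etale R S := by
    refine etale_away (A := A) (b := b) htf (Set.finite_range x) hadj ?_
    rintro _ ⟨i, rfl⟩
    exact h i
  have hloc : IsLocalization (Algebra.algebraMapSubmonoid S R⁰) L :=
    isLocalization_fractionRing (A := A) htf hinj
  exact mem_range_of_isIntegral_of_etale (R := R) (S := S) hz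

end Etale

/-! ### The affine curve over good parameters -/

section GoodLocus

open DGraph
open scoped nonZeroDivisors

universe u v

variable {K : Type u} [Field K] {V : Type v} {G : DGraph V} {n : ℕ} {P : Fin n → V}

variable (K G P) in
/-- The coordinate ring of the part of `Y₁(G)` over the locus `b(t) ≠ 0`. -/
abbrev GoodRing (b : MvPolynomial Unit K) : Type u := Localization.Away (paramHom K G P b)

lemma paramHom_isIntegral (hG : G.Admissible) (hP : G.MinGenerates P) :
    (paramHom K G P).IsIntegral := by
  let := (paramHom K G P).toAlgebra
  refine coordRing_induction fun p => ?_
  change IsIntegral (MvPolynomial Unit K) _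
  induction p using MvPolynomial.induction_on with
  | C a =>
    have : (Ideal.Quotient.mk _ (MvPolynomial.C a) : CoordRing K G P) =
        algebraMap (MvPolynomial Unit K) _ (MvPolynomial.C a) := (paramHom_C a).symm
    rw [this]
    exact isIntegral_algebraMap
  | add p₁ p₂ h₁ h₂ => rw [map_add]; exact h₁.add h₂
  | mul_X p i h =>
    rw [map_mul]
    refine h.mul ?_
    have ht : IsIntegral (MvPolynomial Unit K) (tFun K G P) := by
      rw [← paramHom_X ()]
      exact isIntegral_algebraMap (R := MvPolynomial Unit K) (A := CoordRing K G P)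
    rcases i with _ | i
    · exact ht
    · obtain ⟨a, b, hb, h⟩ := exists_iter_eq.{u} hG hP i
      exact isIntegral_of_iter_eq ht hb (h equations_coordRing.1 equations_coordRing.2)

lemma isIntegral_awayMap {R A : Type*} [CommRing R] [CommRing A] {f : R →+* A} (hf : f.IsIntegral)
    (b : R) : (Localization.awayMap f b).IsIntegral := by
  let := f.toAlgebra
  have : Algebra.IsIntegral R A := ⟨hf⟩
  have : IsLocalization (Algebra.algebraMapSubmonoid A (Submonoid.powers b))
      (Localization.Away (f b)) := by
    have h : Algebra.algebraMapSubmonoid A (Submonoid.powers b) = Submonoid.powers (f b) :=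
      Submonoid.map_powers (algebraMap R A) b
    rw [h]
    infer_instance
  exact isIntegral_localization (R := R) (S := A) (M := Submonoid.powers b)
    (Rₘ := Localization.Away b) (Sₘ := Localization.Away (f b))

lemma isUnit_paramHom_fractionRing (hG : G.Admissible) (hP : G.MinGenerates P)
    {b : MvPolynomial Unit K} (hb : b ≠ 0) :
    IsUnit (algebraMap (CoordRing K G P) (FractionRing (CoordRing K G P)) (paramHom K G P b)) :=
  IsLocalization.map_units _ (⟨_, paramHom_mem_nonZeroDivisors hG hP hb⟩ : (CoordRing K G P)⁰)

/-- The inclusion of the coordinate ring over `b(t) ≠ 0` into the total ring of fractions. -/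
def goodToFrac (hG : G.Admissible) (hP : G.MinGenerates P) {b : MvPolynomial Unit K}
    (hb : b ≠ 0) : GoodRing K G P b →+* FractionRing (CoordRing K G P) :=
  IsLocalization.Away.lift (paramHom K G P b) (isUnit_paramHom_fractionRing hG hP hb)

lemma goodToFrac_comp (hG : G.Admissible) (hP : G.MinGenerates P) {b : MvPolynomial Unit K}
    (hb : b ≠ 0) : (goodToFrac hG hP hb).comp (algebraMap (CoordRing K G P) (GoodRing K G P b)) =
      algebraMap _ _ :=
  IsLocalization.Away.lift_comp ..

lemma goodToFrac_injective (hG : G.Admissible) (hP : G.MinGenerates P) {b : MvPolynomial Unit K}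
    (hb : b ≠ 0) : Function.Injective (goodToFrac hG hP hb) := by
  refine (IsLocalization.lift_injective_iff _).2 fun x y => ?_
  have h1 : Submonoid.powers (paramHom K G P b) ≤ (CoordRing K G P)⁰ :=
    Submonoid.powers_le.2 (paramHom_mem_nonZeroDivisors hG hP hb)
  rw [(IsLocalization.injective (GoodRing K G P b) h1).eq_iff,
    (IsFractionRing.injective (CoordRing K G P) (FractionRing (CoordRing K G P))).eq_iff]

instance : IsDedekindDomain (MvPolynomial Unit K) := by
  have : IsPrincipalIdealRing (MvPolynomial Unit K) :=
    IsPrincipalIdealRing.of_surjective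
      ((MvPolynomial.uniqueAlgEquiv K Unit).symm : Polynomial K →+* MvPolynomial Unit K)
      (MvPolynomial.uniqueAlgEquiv K Unit).symm.surjective
  infer_instance

lemma isUnit_of_forall_hom {R : Type u} [CommRing R] {a : R}
    (h : ∀ (F : Type u) [Field F] (g : R →+* F), g a ≠ 0) : IsUnit a := by
  by_contra hu
  obtain ⟨I, hI, ha⟩ := exists_max_ideal_of_mem_nonunits hu
  let := Ideal.Quotient.field I
  exact h (R ⧸ I) (Ideal.Quotient.mk I) (Ideal.Quotient.eq_zero_iff_mem.2 ha)

lemma closure_coordRing :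
    Subring.closure (Set.range (paramHom K G P) ∪ Set.range (xFun K G P)) = ⊤ := by
  rw [eq_top_iff]
  rintro a -
  revert a
  refine coordRing_induction fun p => ?_
  induction p using MvPolynomial.induction_on with
  | C a => exact Subring.subset_closure (Or.inl ⟨MvPolynomial.C a, paramHom_C a⟩)
  | add p₁ p₂ h₁ h₂ => rw [map_add]; exact add_mem h₁ h₂
  | mul_X p i h =>
    rw [map_mul]
    refine mul_mem h ?_
    rcases i with _ | i
    · exact Subring.subset_closure (Or.inl ⟨MvPolynomial.X (), paramHom_X ()⟩)
    · exact Subring.subset_closure (Or.inr ⟨i, rfl⟩)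

/-- The curve is normal over good parameters. -/
lemma mem_range_goodToFrac [CharZero K] (hG : G.Admissible) (hP : G.MinGenerates P)
    {b : MvPolynomial Unit K} (hb : b ≠ 0)
    (hgood : ∀ (F : Type u) [Field F] (h : MvPolynomial Unit K →+* F),
      h b ≠ 0 → Good G.verts.ncard (h (MvPolynomial.X ())))
    {z : FractionRing (CoordRing K G P)} (hz : (goodToFrac hG hP hb).IsIntegralElem z) :
    z ∈ (goodToFrac hG hP hb).range := by
  refine mem_range_of_isIntegralElem (f := paramHom K G P) (b := b) (x := xFun K G P)
    (paramHom_isIntegral hG hP) (fun r hr => paramHom_mem_nonZeroDivisors hG hP hr)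
    (goodToFrac_comp hG hP hb) (goodToFrac_injective hG hP hb) closure_coordRing (fun i => ?_) hz
  let τ : MvPolynomial Unit K := MvPolynomial.X ()
  -- The coordinate x_i is a root of f^(M+N)(X) - f^M(X), and the derivative of this polynomial
  -- vanishes at no point over b ≠ 0.
  refine ⟨iter (Polynomial.C τ) Polynomial.X (G.preperiod (P i) + G.eventualPeriod (P i)) -
    iter (Polynomial.C τ) Polynomial.X (G.preperiod (P i)), ?_, ?_⟩
  · rw [← Polynomial.coe_eval₂RingHom, map_sub, map_iter, map_iter]
    simp only [Polynomial.coe_eval₂RingHom, Polynomial.eval₂_C, Polynomial.eval₂_X, τ, paramHom_X]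
    rw [iter_xFun hG hP, sub_self]
  · rw [Polynomial.derivative_sub, derivative_iter, derivative_iter,
      ← Polynomial.coe_eval₂RingHom, map_sub (Polynomial.eval₂RingHom _ _), map_iterDeriv,
      map_iterDeriv]
    simp only [Polynomial.coe_eval₂RingHom, Polynomial.eval₂_C, Polynomial.eval₂_X, τ, paramHom_X]
    refine isUnit_of_forall_hom fun F _ g => ?_
    refine hom_iterDeriv_ne_zero hG hP
      (g.comp (algebraMap (CoordRing K G P) (GoodRing K G P b))) ?_ i
    rw [hom_tFun]
    refine hgood F _ ?_
    have hu : IsUnit (algebraMap (CoordRing K G P) (GoodRing K G P b) (paramHom K G P b)) :=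
      IsLocalization.Away.algebraMap_isUnit _
    exact (hu.map g).ne_zero

end GoodLocus

end DynModCurve

end

noncomputable section
namespace DynModCurve
universe u

/-! ### Relative normalization over an open part where the curve is already normal -/

section Normalization

open Scheme.Hom

/-- The relative normalization does not change under composition with an integral morphism on the
target and an isomorphism on the source. -/
lemma exists_normalization_iso {X' X Y Z : Scheme.{u}} (e : X' ⟶ X) (f : X ⟶ Y) (ρ : Y ⟶ Z)
    (g : X' ⟶ Z) [IsIso e] [QuasiCompact f] [QuasiSeparated f] [IsIntegralHom ρ] [QuasiCompact g]
    [QuasiSeparated g] (hg : g = e ≫ f ≫ ρ) :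
    ∃ α : g.normalization ≅ f.normalization, g.toNormalization ≫ α.hom = e ≫ f.toNormalization ∧
      α.hom ≫ f.fromNormalization ≫ ρ = g.fromNormalization := by
  have h1 : g = (e ≫ f.toNormalization) ≫ f.fromNormalization ≫ ρ := by simp [hg]
  have h2 : g = (e ≫ f) ≫ ρ := by simp [hg]
  have h3 : f = (inv e ≫ g.toNormalization) ≫ g.normalizationDesc (e ≫ f) ρ h2 := by simp
  have h4 : g.normalizationDesc _ _ h1 ≫ f.fromNormalization = g.normalizationDesc (e ≫ f) ρ h2 :=
    normalization.hom_ext _ _ _ ρ (by simp) (by simp) (by simp)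
  refine ⟨⟨g.normalizationDesc _ _ h1, f.normalizationDesc _ _ h3, ?_, ?_⟩, by simp, by simp⟩
  · refine normalization.hom_ext _ _ _ g.fromNormalization (by simp) ?_ (by simp)
    rw [Category.assoc, ← normalizationDesc_comp g (e ≫ f) ρ h2,
      ← Category.assoc (f.normalizationDesc _ _ h3), normalizationDesc_comp f _ _ h3, ← Category.assoc, h4]
  · refine normalization.hom_ext _ _ _ f.fromNormalization (by simp) ?_ (by simp)
    rw [Category.assoc, h4, normalizationDesc_comp f _ _ h3]

/-- Transports integral closedness of R in S to isomorphic rings, such as the global sections of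
their spectra. -/
lemma bijective_algebraMap_integralClosure {R S A B : Type*} [CommRing R] [CommRing S] [CommRing A]
    [CommRing B] (φ : R →+* S) (hφ : Function.Injective φ)
    (hclosed : ∀ z, φ.IsIntegralElem z → z ∈ φ.range) (e : A ≃+* R) (e' : B ≃+* S) (g : A →+* B)
    (hg : ∀ a, e' (g a) = φ (e a)) :
    let := g.toAlgebra
    Function.Bijective (algebraMap A (integralClosure A B)) := by
  intro inst
  refine ⟨fun x y hxy => e.injective (hφ ?_), fun y => ?_⟩
  · rw [← hg, ← hg]
    exact congr(e' ($hxy).1)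
  · obtain ⟨p, hp, hpy⟩ := y.2
    obtain ⟨r, hr⟩ := hclosed (e' y.1) ⟨p.map (e : A →+* R), hp.map _, by
      have := congr((e' : B →+* S) $hpy)
      rw [Polynomial.hom_eval₂, map_zero] at this
      rw [Polynomial.eval₂_map]
      refine Eq.trans ?_ this
      congr 1
      ext x
      exact (hg x).symm⟩
    refine ⟨e.symm r, Subtype.ext (e'.injective ?_)⟩
    change e' (g _) = _
    rw [hg, e.apply_symm_apply, hr]

/-- A ring which is integrally closed in an overring is its own normalization there. -/
lemma isIso_fromNormalization {R S : CommRingCat.{u}} (φ : R ⟶ S)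
    (hφ : Function.Injective φ.hom) (hclosed : ∀ z, φ.hom.IsIntegralElem z → z ∈ φ.hom.range) :
    IsIso (Spec.map φ).fromNormalization := by
  have : IsAffine (Spec.map φ).normalization :=
    isAffine_of_isAffineHom (Spec.map φ).fromNormalization
  let ψ := Spec.map φ
  have h1 : ψ.app ⊤ ≫ (Scheme.ΓSpecIso S).hom = (Scheme.ΓSpecIso R).hom ≫ φ :=
    Scheme.ΓSpecIso_naturality φ
  have h2 : IsIso (ψ.fromNormalization.app ⊤) := by
    rw [fromNormalization_app _ (isAffineOpen_top _)]
    let := (ψ.app ⊤).hom.toAlgebra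
    have : IsIso (CommRingCat.ofHom (algebraMap Γ(Spec R, ⊤)
        (integralClosure Γ(Spec R, ⊤) Γ(Spec S, ψ ⁻¹ᵁ ⊤)))) := by
      rw [ConcreteCategory.isIso_iff_bijective]
      exact bijective_algebraMap_integralClosure φ.hom hφ hclosed
        (Scheme.ΓSpecIso R).commRingCatIsoToRingEquiv (Scheme.ΓSpecIso S).commRingCatIsoToRingEquiv
        (ψ.app ⊤).hom fun a => congr(($h1).hom a)
    infer_instance
  have h3 := Scheme.isoSpec_hom_naturality ψ.fromNormalization
  have h4 : ψ.fromNormalization = ψ.normalization.isoSpec.hom ≫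
      Spec.map (ψ.fromNormalization.app ⊤) ≫ (Spec R).isoSpec.inv := by
    rw [← Category.assoc, Iso.eq_comp_inv]; exact h3.symm
  change IsIso ψ.fromNormalization
  have : IsIso (Spec.map (ψ.fromNormalization.app ⊤)) := inferInstance
  rw [h4]
  exact IsIso.comp_isIso' inferInstance (IsIso.comp_isIso' this inferInstance)

/-- Over an open subset over which the target is already normal, the normalization is the given
scheme. -/
lemma exists_isPullback_normalization {X Y Z W T : Scheme.{u}} (f : X ⟶ Y) (ρ : Y ⟶ Z) (i : W ⟶ Z)
    (f₁ : X ⟶ T) (s : T ⟶ W) [QuasiCompact f] [QuasiSeparated f] [IsIntegralHom ρ]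
    [IsOpenImmersion i] [QuasiCompact f₁] [QuasiSeparated f₁] [IsIntegralHom s]
    [IsIso f₁.fromNormalization] (h : f ≫ ρ = f₁ ≫ s ≫ i) :
    ∃ κ : T ⟶ f.normalization, IsPullback κ s (f.fromNormalization ≫ ρ) i ∧
      f₁ ≫ κ = f.toNormalization := by
  obtain ⟨α, hα1, hα2⟩ := exists_normalization_iso (𝟙 X) f ρ (f ≫ ρ) (by simp)
  have hq : pullback.snd (f ≫ ρ) i = pullback.fst (f ≫ ρ) i ≫ f₁ ≫ s := by
    rw [← cancel_mono i, ← pullback.condition, h]; simp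
  obtain ⟨l, hl1, hl2⟩ : ∃ l : X ⟶ pullback (f ≫ ρ) i,
      l ≫ pullback.fst _ _ = 𝟙 X ∧ l ≫ pullback.snd _ _ = f₁ ≫ s :=
    ⟨pullback.lift (𝟙 X) (f₁ ≫ s) (by simp [h]), pullback.lift_fst .., pullback.lift_snd ..⟩
  -- The composite f ≫ ρ factors through the open subscheme W, so restricting it over W leaves its
  -- source unchanged.
  have he : IsIso (pullback.fst (f ≫ ρ) i) := by
    refine ⟨l, ?_, hl1⟩
    apply pullback.hom_ext
    · rw [Category.assoc, hl1]; simp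
    · rw [Category.assoc, hl2, ← hq]; simp
  obtain ⟨γ, hγ1, hγ2⟩ := exists_normalization_iso (pullback.fst (f ≫ ρ) i) f₁ s _ hq
  -- T is its own normalization in X, which is the normalization of the restriction to W, which is
  -- the restriction of the normalization.
  refine ⟨inv f₁.fromNormalization ≫ γ.inv ≫ (f ≫ ρ).normalizationPullback i ≫
    pullback.fst _ _ ≫ α.hom, ?_, ?_⟩
  · refine IsPullback.of_iso (IsPullback.of_hasPullback (f ≫ ρ).fromNormalization i)
      (asIso (inv ((f ≫ ρ).normalizationPullback i)) ≪≫ γ ≪≫ asIso f₁.fromNormalization) α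
      (Iso.refl _) (Iso.refl _) ?_ ?_ ?_ ?_
    · simp
    · simp [hγ2]
    · simp [hα2]
    · simp
  · have h1 : f₁ ≫ inv f₁.fromNormalization = f₁.toNormalization := by simp
    have h2 : f₁.toNormalization ≫ γ.inv = inv (pullback.fst (f ≫ ρ) i) ≫
        (pullback.snd (f ≫ ρ) i).toNormalization := by
      rw [Iso.comp_inv_eq, Category.assoc, hγ1]; simp
    rw [reassoc_of% h1, reassoc_of% h2, toNormalization_normalizationPullback_fst_assoc, hα1]
    simp

end Normalization

end DynModCurve

end

noncomputable section
namespace DynModCurve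
universe u v

/-! ### Gluing morphisms along pulled-back open immersions -/

section Glue

variable {ι : Type v} {C P Q : Scheme.{u}} (c : C ⟶ P) {U : ι → Scheme.{u}} (j : ∀ k, U k ⟶ P)
  [∀ k, IsOpenImmersion (j k)]

/-- The open cover of `C` obtained by pulling back open immersions into `P`. -/
def coverOfMemRange (hc : ∀ x : C, ∃ k, c x ∈ (j k).opensRange) : C.OpenCover where
  I₀ := ι
  X k := pullback c (j k)
  f k := pullback.fst c (j k)
  mem₀ := by
    rw [Scheme.presieve₀_mem_precoverage_iff]
    refine ⟨fun x => ?_, inferInstance⟩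
    obtain ⟨k, hk⟩ := hc x
    refine ⟨k, ?_⟩
    rw [IsOpenImmersion.range_pullbackFst]
    exact hk

lemma hom_ext_of_mem_range (hc : ∀ x : C, ∃ k, c x ∈ (j k).opensRange) {f g : C ⟶ Q}
    (h : ∀ k (T : Scheme.{u}) (a : T ⟶ C) (b : T ⟶ U k), a ≫ c = b ≫ j k → a ≫ f = a ≫ g) :
    f = g :=
  (coverOfMemRange c j hc).hom_ext _ _ fun k => h k _ _ _ pullback.condition

lemma exists_glue (r : ∀ k, U k ⟶ Q)
    (hr : ∀ k l (T : Scheme.{u}) (a : T ⟶ U k) (b : T ⟶ U l), a ≫ j k = b ≫ j l →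
      a ≫ r k = b ≫ r l)
    (hc : ∀ x : C, ∃ k, c x ∈ (j k).opensRange) :
    ∃ ρ : C ⟶ Q, ∀ k (T : Scheme.{u}) (a : T ⟶ C) (b : T ⟶ U k), a ≫ c = b ≫ j k →
      a ≫ ρ = b ≫ r k := by
  let 𝒰 := coverOfMemRange c j hc
  have hf : ∀ k l, pullback.fst (pullback.fst c (j k)) (pullback.fst c (j l)) ≫
      pullback.snd c (j k) ≫ r k = pullback.snd _ _ ≫ pullback.snd c (j l) ≫ r l := fun k l => by
    rw [← Category.assoc, ← Category.assoc]
    refine hr _ _ _ _ _ ?_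
    rw [Category.assoc, Category.assoc, ← pullback.condition, ← pullback.condition]
    exact pullback.condition_assoc c
  obtain ⟨ρ, h⟩ : ∃ ρ : C ⟶ Q, ∀ k, pullback.fst c (j k) ≫ ρ = pullback.snd c (j k) ≫ r k :=
    ⟨𝒰.glueMorphisms (fun k => pullback.snd c (j k) ≫ r k) hf, 𝒰.ι_glueMorphisms _ hf⟩
  refine ⟨ρ, fun k T a b hab => ?_⟩
  have h1 : pullback.lift a b hab ≫ pullback.fst _ _ = a := pullback.lift_fst ..
  have h2 : pullback.lift a b hab ≫ pullback.snd _ _ = b := pullback.lift_snd ..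
  rw [← h1, Category.assoc, h, reassoc_of% h2]

end Glue

/-! ### Projections between Proj schemes -/

section Projection

open HomogeneousLocalization Graded

variable {A B σ τ : Type u} [CommRing A] [SetLike σ A] [AddSubgroupClass σ A]
  [CommRing B] [SetLike τ B] [AddSubgroupClass τ B] {𝒜 : ℕ → σ} {ℬ : ℕ → τ} [GradedRing 𝒜]
  [GradedRing ℬ] (θ : 𝒜 →+*ᵍ ℬ)

/-- The morphism `D₊(θ s) → D₊(s) ⊆ Proj 𝒜` induced by a homomorphism `θ` of graded rings. -/
def awayProj {d : ℕ} {s : A} (hs : s ∈ 𝒜 d) (hd : 0 < d) :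
    Spec (.of (Away ℬ (θ s))) ⟶ Proj 𝒜 :=
  Spec.map (CommRingCat.ofHom (Away.map θ s)) ≫ Proj.awayι 𝒜 s hs hd

lemma awayMap_comp_map {d e : ℕ} {s s' x : A} (hs : s ∈ 𝒜 d) (hs' : s' ∈ 𝒜 e) (hx : x = s * s') :
    (Away.map θ x).comp (awayMap 𝒜 hs' hx) =
      (awayMap ℬ (map_mem θ hs') (by rw [hx, map_mul])).comp (Away.map θ s) := by
  ext z
  obtain ⟨n, a, ha, rfl⟩ := Away.mk_surjective 𝒜 hs z
  simp [awayMap_mk, Away.map_mk]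

lemma SpecMap_awayMap_awayProj {d e : ℕ} {s s' x : A} (hs : s ∈ 𝒜 d) (hd : 0 < d) (hs' : s' ∈ 𝒜 e)
    (hx : x = s * s') :
    Spec.map (CommRingCat.ofHom (awayMap ℬ (map_mem θ hs') (f := θ s) (x := θ x)
      (by rw [hx, map_mul]))) ≫
      awayProj θ hs hd = awayProj θ (s := x) (hx ▸ SetLike.mul_mem_graded hs hs')
        (hd.trans_le (Nat.le_add_right _ _)) := by
  rw [awayProj, awayProj, ← Category.assoc, ← Spec.map_comp, ← CommRingCat.ofHom_comp,
    ← awayMap_comp_map θ hs hs' hx, CommRingCat.ofHom_comp, Spec.map_comp, Category.assoc,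
    Proj.SpecMap_awayMap_awayι]

/-- The overlap of the two charts is D₊(θ(s s')), and both maps restrict there to the one defined by
s s'. -/
lemma awayProj_compat {d e : ℕ} {s s' : A} (hs : s ∈ 𝒜 d) (hd : 0 < d) (hs' : s' ∈ 𝒜 e)
    (he : 0 < e) (T : Scheme.{u}) (a : T ⟶ Spec (.of (Away ℬ (θ s))))
    (b : T ⟶ Spec (.of (Away ℬ (θ s'))))
    (h : a ≫ Proj.awayι ℬ (θ s) (map_mem θ hs) hd = b ≫ Proj.awayι ℬ (θ s') (map_mem θ hs') he) :
    a ≫ awayProj θ hs hd = b ≫ awayProj θ hs' he := by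
  have key : pullback.fst (Proj.awayι ℬ (θ s) (map_mem θ hs) hd)
      (Proj.awayι ℬ (θ s') (map_mem θ hs') he) ≫ awayProj θ hs hd =
      pullback.snd _ _ ≫ awayProj θ hs' he := by
    rw [← Proj.pullbackAwayιIso_hom_SpecMap_awayMap_left ℬ (map_mem θ hs) hd (map_mem θ hs') he
        (map_mul θ s s'),
      ← Proj.pullbackAwayιIso_hom_SpecMap_awayMap_right ℬ (map_mem θ hs) hd (map_mem θ hs') he
        (map_mul θ s s'), Category.assoc, Category.assoc]
    congr 1
    rw [SpecMap_awayMap_awayProj θ hs hd hs' rfl,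
      SpecMap_awayMap_awayProj θ hs' he hs (mul_comm _ _)]
    rfl
  have h1 : pullback.lift a b h ≫ pullback.fst _ _ = a := pullback.lift_fst ..
  have h2 : pullback.lift a b h ≫ pullback.snd _ _ = b := pullback.lift_snd ..
  rw [← h1, Category.assoc, key, reassoc_of% h2]

/-- Identifies the preimage of D₊(s) under the glued projection with the part of C in D₊(θ s), which
shows that the projection is affine. -/
lemma awayProj_preimage_basicOpen {d e : ℕ} {s s' : A} (hs : s ∈ 𝒜 d) (hd : 0 < d)
    (hs' : s' ∈ 𝒜 e) (he : 0 < e) :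
    awayProj θ hs hd ⁻¹ᵁ Proj.basicOpen 𝒜 s' =
      Proj.awayι ℬ (θ s) (map_mem θ hs) hd ⁻¹ᵁ Proj.basicOpen ℬ (θ s') := by
  rw [awayProj, Scheme.Hom.comp_preimage, Proj.awayι_preimage_basicOpen 𝒜 hs hd hs' he,
    Proj.awayι_preimage_basicOpen ℬ (map_mem θ hs) hd (map_mem θ hs') he]
  have : Away.map θ s (Away.isLocalizationElem hs hs') =
      Away.isLocalizationElem (map_mem θ hs) (map_mem θ hs') := by
    ext
    simp [Away.isLocalizationElem, Away.map_mk]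
  rw [← this]
  rfl

/-- The degree zero part of a homomorphism of graded rings. -/
def zeroHom : 𝒜 0 →+* ℬ 0 where
  toFun a := ⟨θ a, map_mem θ a.2⟩
  map_one' := Subtype.ext (map_one θ)
  map_zero' := Subtype.ext (map_zero θ)
  map_add' a b := Subtype.ext (map_add θ a.1 b.1)
  map_mul' a b := Subtype.ext (map_mul θ a.1 b.1)

lemma awayProj_toSpecZero {d : ℕ} {s : A} (hs : s ∈ 𝒜 d) (hd : 0 < d) :
    awayProj θ hs hd ≫ Proj.toSpecZero 𝒜 = Proj.awayι ℬ (θ s) (map_mem θ hs) hd ≫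
      Proj.toSpecZero ℬ ≫ Spec.map (CommRingCat.ofHom (zeroHom θ)) := by
  rw [awayProj, Category.assoc, Proj.awayι_toSpecZero, Proj.awayι_toSpecZero_assoc,
    ← Spec.map_comp, ← Spec.map_comp, ← CommRingCat.ofHom_comp, ← CommRingCat.ofHom_comp]
  congr 2
  ext a
  change Localization.mk (θ a.1) ⟨θ 1, _⟩ = Localization.mk (θ a.1) ⟨1, _⟩
  simp

/-- A closed subscheme of `Proj ℬ` which is covered by the `D₊(θ s)` maps to `Proj 𝒜` by an integral
morphism. -/
theorem exists_integral_projection {ι : Type v} {d : ι → ℕ} {s : ι → A} (hs : ∀ k, s k ∈ 𝒜 (d k))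
    (hd : ∀ k, 0 < d k) (htop : ∀ y : Proj 𝒜, ∃ k, y ∈ Proj.basicOpen 𝒜 (s k)) {C : Scheme.{u}}
    (c : C ⟶ Proj ℬ) [IsClosedImmersion c] (hc : ∀ x : C, ∃ k, c x ∈ Proj.basicOpen ℬ (θ (s k)))
    [Algebra.FiniteType (ℬ 0) B] (h0 : Function.Surjective (zeroHom θ)) :
    ∃ ρ : C ⟶ Proj 𝒜, IsIntegralHom ρ ∧ ∀ k (T : Scheme.{u}) (a : T ⟶ C)
      (b : T ⟶ Spec (.of (Away ℬ (θ (s k))))),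
      a ≫ c = b ≫ Proj.awayι ℬ (θ (s k)) (map_mem θ (hs k)) (hd k) →
      a ≫ ρ = b ≫ awayProj θ (hs k) (hd k) := by
  have hc' : ∀ x : C, ∃ k, c x ∈
      (Proj.awayι ℬ (θ (s k)) (map_mem θ (hs k)) (hd k)).opensRange := by
    simpa only [Proj.opensRange_awayι] using hc
  obtain ⟨ρ, hρ⟩ := exists_glue c (fun k => Proj.awayι ℬ (θ (s k)) (map_mem θ (hs k)) (hd k))
    (fun k => awayProj θ (hs k) (hd k))
    (fun k l T a b => awayProj_compat θ (hs k) (hd k) (hs l) (hd l) T a b) hc'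
  -- Integral means affine and universally closed. C is universally closed over Spec 𝒜₀, being
  -- closed in Proj ℬ, and Proj 𝒜 is separated, so ρ is universally closed.
  refine ⟨ρ, IsIntegralHom.iff_universallyClosed_and_isAffineHom.2 ⟨?_, ?_⟩, hρ⟩
  · have h1 : ρ ≫ Proj.toSpecZero 𝒜 =
        c ≫ Proj.toSpecZero ℬ ≫ Spec.map (CommRingCat.ofHom (zeroHom θ)) := by
      refine hom_ext_of_mem_range c _ hc' fun k T a b hab => ?_
      rw [reassoc_of% hρ k T a b hab, reassoc_of% hab, awayProj_toSpecZero]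
    have h2 : IsClosedImmersion (Spec.map (CommRingCat.ofHom (zeroHom θ))) :=
      IsClosedImmersion.spec_of_surjective _ h0
    have h3 : UniversallyClosed (ρ ≫ Proj.toSpecZero 𝒜) := by
      rw [h1]
      infer_instance
    exact UniversallyClosed.of_comp_of_isSeparated ρ (Proj.toSpecZero 𝒜)
  · refine isAffineHom_of_forall_exists_isAffineOpen _ fun y => ?_
    obtain ⟨k, hk⟩ := htop y
    refine ⟨_, hk, Proj.isAffineOpen_basicOpen 𝒜 _ (hs k) (hd k), ?_⟩
    have : ρ ⁻¹ᵁ Proj.basicOpen 𝒜 (s k) = c ⁻¹ᵁ Proj.basicOpen ℬ (θ (s k)) := by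
      ext x
      obtain ⟨l, hl⟩ := hc' x
      let j := Proj.awayι ℬ (θ (s l)) (map_mem θ (hs l)) (hd l)
      obtain ⟨y, rfl⟩ : x ∈ Set.range (pullback.fst c j) := by
        rw [IsOpenImmersion.range_pullbackFst]
        exact hl
      have h : pullback.fst c j ⁻¹ᵁ (ρ ⁻¹ᵁ Proj.basicOpen 𝒜 (s k)) =
          pullback.fst c j ⁻¹ᵁ (c ⁻¹ᵁ Proj.basicOpen ℬ (θ (s k))) := by
        rw [← Scheme.Hom.comp_preimage, ← Scheme.Hom.comp_preimage,
          hρ l _ _ (pullback.snd c j) pullback.condition, pullback.condition,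
          Scheme.Hom.comp_preimage, Scheme.Hom.comp_preimage,
          awayProj_preimage_basicOpen θ (hs l) (hd l) (hs k) (hd k)]
      exact (iff_of_eq congr(y ∈ $h))
    rw [this]
    exact (Proj.isAffineOpen_basicOpen ℬ _ (map_mem θ (hs k)) (hd k)).preimage c

end Projection

end DynModCurve

end

noncomputable section
namespace DynModCurve
universe u v

/-! ### The standard affine chart of projective space -/

section Chart

open HomogeneousLocalization MvPolynomial

attribute [local instance] MvPolynomial.gradedAlgebra

variable {σ τ : Type} {K : Type u} [Field K]

lemma X_mem_homogeneousSubmodule (i : σ) :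
    (X i : MvPolynomial σ K) ∈ homogeneousSubmodule σ K 1 :=
  isHomogeneous_X K i

lemma chart_eq : chart σ K = Spec.map (CommRingCat.ofHom (dehomAway σ K)) ≫
    Proj.awayι (homogeneousSubmodule (Option σ) K) (X none)
      (X_mem_homogeneousSubmodule none) one_pos :=
  rfl

lemma dehom_X_none : dehom σ K (X none) = 1 := by simp [dehom]

lemma dehom_X_some (i : σ) : dehom σ K (X (some i)) = X i := by simp [dehom]

lemma dehom_C (a : K) : dehom σ K (C a) = C a := by simp [dehom]

lemma dehomAway_mk
    (hz : (X none : MvPolynomial (Option σ) K) ∈ homogeneousSubmodule (Option σ) K 1) (n : ℕ) (a : MvPolynomial (Option σ) K) (ha : a ∈ homogeneousSubmodule (Option σ) K (n • 1)) :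
    dehomAway σ K (Away.mk _ hz n a ha) = dehom σ K a := by
  let L := IsLocalization.Away.lift
    (S := Localization.Away (X none : MvPolynomial (Option σ) K)) (X none) (g := dehom σ K)
    (by simp [dehom])
  change L (Localization.mk a ⟨X none ^ n, _⟩) = _
  have h1 : ∀ p, L (algebraMap _ _ p) = dehom σ K p := IsLocalization.Away.lift_eq _ _
  rw [Localization.mk_eq_mk']
  have h3 := congr(L $(IsLocalization.mk'_spec
    (Localization.Away (X none : MvPolynomial (Option σ) K)) a
    (⟨X none ^ n, n, rfl⟩ : Submonoid.powers (X none : MvPolynomial (Option σ) K))))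
  rw [map_mul, h1, h1, map_pow, dehom_X_none, one_pow, mul_one] at h3
  exact h3

lemma aeval_smul_of_isHomogeneous {ι R S : Type*} [CommRing R] [CommRing S] [Algebra R S]
    {p : MvPolynomial ι R} {n : ℕ} (hp : p.IsHomogeneous n) (u : S) (g : ι → S) :
    aeval (fun i => u * g i) p = u ^ n * aeval g p := by
  rw [aeval_def, aeval_def, eval₂_eq, eval₂_eq, Finset.mul_sum]
  refine Finset.sum_congr rfl fun d hd => ?_
  have h1 : ∑ i ∈ d.support, d i = n := hp.degree_eq_sum_deg_support hd ▸ rfl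
  rw [← h1, ← Finset.prod_pow_eq_pow_sum]
  simp only [mul_pow, Finset.prod_mul_distrib]
  ring

/-- Injectivity follows from the substitution X_i ↦ X_i / X_0, which recovers a homogeneous fraction
of degree 0; constants and the X_i / X_0 give surjectivity. -/
lemma dehomAway_bijective : Function.Bijective (dehomAway σ K) := by
  have hz : (X none : MvPolynomial (Option σ) K) ∈ homogeneousSubmodule (Option σ) K 1 :=
    X_mem_homogeneousSubmodule none
  constructor
  · let L := Localization.Away (X none : MvPolynomial (Option σ) K)
    let w : L := IsLocalization.Away.invSelf (X none : MvPolynomial (Option σ) K)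
    have hw : w * algebraMap (MvPolynomial (Option σ) K) L (X none) = 1 := by
      rw [mul_comm]
      exact IsLocalization.Away.mul_invSelf (X none : MvPolynomial (Option σ) K)
    let ψ : MvPolynomial σ K →ₐ[K] L :=
      aeval fun i => w * algebraMap (MvPolynomial (Option σ) K) L (X (some i))
    have h1 : ∀ p, ψ (dehom σ K p) =
        aeval (fun o => w * algebraMap (MvPolynomial (Option σ) K) L (X o)) p := by
      intro p
      refine DFunLike.congr_fun (?_ : (ψ.comp (aeval fun o : Option σ => o.elim 1 X)) = _) p
      refine algHom_ext fun o => ?_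
      rcases o with _ | i
      · simp [hw]
      · simp [ψ]
    have h2 : ∀ y, ψ (dehomAway σ K y) = y.val := by
      intro y
      obtain ⟨n, a, ha, rfl⟩ := Away.mk_surjective _ hz y
      rw [dehomAway_mk, h1, aeval_smul_of_isHomogeneous ha, Away.val_mk, Localization.mk_eq_mk',
        IsLocalization.eq_mk'_iff_mul_eq]
      have h3 : aeval (fun o => algebraMap (MvPolynomial (Option σ) K) L (X o)) a =
          algebraMap (MvPolynomial (Option σ) K) L a := by
        refine DFunLike.congr_fun
          (?_ : _ = IsScalarTower.toAlgHom K (MvPolynomial (Option σ) K) L) a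
        exact algHom_ext fun o => by simp
      rw [h3, map_pow, smul_eq_mul, mul_one, mul_right_comm, ← mul_pow, hw, one_pow, one_mul]
    intro y y' h
    apply HomogeneousLocalization.val_injective
    rw [← h2, ← h2, h]
  · intro p
    change p ∈ (dehomAway σ K).range
    induction p using MvPolynomial.induction_on with
    | C a =>
      exact ⟨Away.mk _ hz 0 (C a) (by simp), by rw [dehomAway_mk, dehom_C]⟩
    | add p q hp hq => exact add_mem hp hq
    | mul_X p i hp =>
      exact mul_mem hp ⟨Away.mk _ hz 1 (X (some i)) (by simpa using isHomogeneous_X K (some i)),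
        by rw [dehomAway_mk, dehom_X_some]⟩

instance : IsOpenImmersion (chart σ K) := by
  have : IsIso (CommRingCat.ofHom (dehomAway σ K)) :=
    (ConcreteCategory.isIso_iff_bijective _).2 dehomAway_bijective
  rw [chart_eq]
  infer_instance

lemma chart_preimage_basicOpen {m : ℕ} {F : MvPolynomial (Option σ) K} (hF : F.IsHomogeneous m)
    (hm : 0 < m) :
    chart σ K ⁻¹ᵁ Proj.basicOpen (homogeneousSubmodule (Option σ) K) F =
      PrimeSpectrum.basicOpen (dehom σ K F) := by
  rw [chart_eq, Scheme.Hom.comp_preimage, Proj.awayι_preimage_basicOpen _ _ _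
    ((mem_homogeneousSubmodule _ _).2 hF) hm]
  have h : dehomAway σ K (Away.isLocalizationElem (X_mem_homogeneousSubmodule none)
      ((mem_homogeneousSubmodule _ _).2 hF)) = dehom σ K F := by
    rw [Away.isLocalizationElem, dehomAway_mk, pow_one]
  rw [← h]
  rfl

lemma adjoin_range_X : Algebra.adjoin (homogeneousSubmodule σ K 0)
    (Set.range (X : σ → MvPolynomial σ K)) = ⊤ := by
  rw [eq_top_iff]
  rintro p -
  induction p using MvPolynomial.induction_on with
  | C a =>
    exact Subalgebra.algebraMap_mem _ (⟨C a, isHomogeneous_C _ a⟩ : homogeneousSubmodule σ K 0)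
  | add p q hp hq => exact add_mem hp hq
  | mul_X p i hp => exact mul_mem hp (Algebra.subset_adjoin ⟨i, rfl⟩)

lemma exists_mem_basicOpen_X (y : ProjSpace σ K) :
    ∃ o, y ∈ Proj.basicOpen (homogeneousSubmodule (Option σ) K) (X o) := by
  have h := Proj.iSup_basicOpen_eq_top' (homogeneousSubmodule (Option σ) K)
    (fun o => (X o : MvPolynomial (Option σ) K))
    (fun o => ⟨1, X_mem_homogeneousSubmodule o⟩) adjoin_range_X
  simpa using (h ▸ trivial : y ∈ ⨆ o, Proj.basicOpen (homogeneousSubmodule (Option σ) K) (X o))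

/-- The homomorphism of graded polynomial rings which is induced by a map of affine coordinates. -/
def renameGraded (e : σ → τ) :
    homogeneousSubmodule (Option σ) K →+*ᵍ homogeneousSubmodule (Option τ) K where
  toRingHom := (rename (Option.map e)).toRingHom
  map_mem h := IsHomogeneous.rename_isHomogeneous h

lemma renameGraded_X (e : σ → τ) (o : Option σ) :
    renameGraded (K := K) e (X o) = X (o.map e) :=
  rename_X ..

lemma zeroHom_renameGraded_surjective (e : σ → τ) :
    Function.Surjective (zeroHom (renameGraded (K := K) e)) := by
  rintro ⟨p, hp⟩
  have h := totalDegree_eq_zero_iff_eq_C.1 ((totalDegree_zero_iff_isHomogeneous _).2 hp)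
  refine ⟨⟨C (coeff 0 p), isHomogeneous_C _ _⟩, Subtype.ext ?_⟩
  exact (rename_C _ _).trans h.symm

lemma finiteType_degreeZero [Finite σ] :
    Algebra.FiniteType (homogeneousSubmodule σ K 0) (MvPolynomial σ K) :=
  ⟨⟨(Set.finite_range X).toFinset, by rw [Set.Finite.coe_toFinset]; exact adjoin_range_X⟩⟩

lemma dehom_renameGraded (e : σ → τ) (p : MvPolynomial (Option σ) K) :
    dehom τ K (renameGraded e p) = rename e (dehom σ K p) := by
  refine DFunLike.congr_fun (?_ : ((aeval fun o : Option τ => o.elim 1 X).comp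
    (rename (Option.map e)) : _ →ₐ[K] _) =
    (rename e).comp (aeval fun o : Option σ => o.elim 1 X)) p
  refine algHom_ext fun o => ?_
  rcases o with _ | i <;> simp

end Chart

end DynModCurve

end

noncomputable section
namespace DynModCurve
universe u v

/-! ### The projective closure and its projection to the t-line -/

section ProjClosure

open HomogeneousLocalization MvPolynomial

attribute [local instance] MvPolynomial.gradedAlgebra

/-- The homogenization `z^(2^k) f_{t/z}^k(x/z)` of an iterate. -/
def homIter {R : Type*} [CommRing R] (z t x : R) : ℕ → R
  | 0 => x
  | k + 1 => homIter z t x k ^ 2 + t * z ^ (2 ^ (k + 1) - 1)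

lemma map_homIter {R S : Type*} [CommRing R] [CommRing S] (g : R →+* S) (z t x : R) (k : ℕ) :
    g (homIter z t x k) = homIter (g z) (g t) (g x) k := by
  induction k with
  | zero => rfl
  | succ k ih => simp [homIter, ih]

lemma homIter_one {R : Type*} [CommRing R] (t x : R) (k : ℕ) : homIter 1 t x k = iter t x k := by
  induction k with
  | zero => rfl
  | succ k ih => rw [homIter, ih, iter_succ]; simp

lemma homIter_zero {R : Type*} [CommRing R] (x : R) (k : ℕ) : homIter 0 0 x k = x ^ 2 ^ k := by
  induction k with
  | zero => simp [homIter]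
  | succ k ih => rw [homIter, ih, zero_mul, add_zero, ← pow_mul, pow_succ]

variable {K : Type u} [Field K]

lemma isHomogeneous_homIter {σ : Type*} (z t x : σ) (k : ℕ) :
    (homIter (X z) (X t) (X x) k : MvPolynomial σ K).IsHomogeneous (2 ^ k) := by
  induction k with
  | zero => exact isHomogeneous_X K x
  | succ k ih =>
    refine IsHomogeneous.add ?_ ?_
    · rw [pow_succ]
      exact ih.pow 2
    · convert (isHomogeneous_X K t).mul ((isHomogeneous_X K z).pow (2 ^ (k + 1) - 1)) using 1
      have := Nat.one_le_two_pow (n := k + 1)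
      omega

variable {V : Type v} {G : DGraph V} {n : ℕ} {P : Fin n → V}

/-- The projective closure does not meet the center of the projection to the `t`-line. -/
lemma exists_mem_basicOpen_projClosure (hG : G.Admissible) (hP : G.MinGenerates P)
    (x : ProjClosure K G P) : ∃ k : Option Unit, (toProjSpace K G P).imageι x ∈
      Proj.basicOpen (homogeneousSubmodule (Option (Option (Fin n))) K)
        (X (k.map fun _ => none)) := by
  obtain ⟨o, ho⟩ := exists_mem_basicOpen_X ((toProjSpace K G P).imageι x)
  rcases o with _ | _ | i
  · exact ⟨none, ho⟩
  · exact ⟨some (), ho⟩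
  by_contra! hcon
  have hz := hcon none
  have ht := hcon (some ())
  obtain ⟨a, b, hb, hab⟩ := exists_iter_eq.{u} hG hP i
  -- The homogenization of f^(a+b)(x_i) - f^a(x_i) with X_0 as homogenizing variable. It vanishes on
  -- the closure, and where X_0 = t = 0 it reduces to x_i^(2^(a+b)); so x_i vanishes there as well,
  -- for every i.
  let F : MvPolynomial (Option (Option (Fin n))) K :=
    homIter (X none) (X (some none)) (X (some (some i))) (a + b) -
      X none ^ (2 ^ (a + b) - 2 ^ a) * homIter (X none) (X (some none)) (X (some (some i))) a
  have hF : F.IsHomogeneous (2 ^ (a + b)) := by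
    refine (isHomogeneous_homIter _ _ _ _).sub ?_
    have h1 : 2 ^ (a + b) = 1 * (2 ^ (a + b) - 2 ^ a) + 2 ^ a := by
      rw [one_mul, Nat.sub_add_cancel (Nat.pow_le_pow_right two_pos (Nat.le_add_right a b))]
    rw [h1]
    simpa using ((isHomogeneous_X K none).pow (2 ^ (a + b) - 2 ^ a)).mul
      (isHomogeneous_homIter none (some none) (some (some i)) a)
  have hF0 : toProjSpace K G P ⁻¹ᵁ
      Proj.basicOpen (homogeneousSubmodule (Option (Option (Fin n))) K) F = ⊥ := by
    rw [toProjSpace, Scheme.Hom.comp_preimage, chart_preimage_basicOpen hF (by positivity)]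
    have : Ideal.Quotient.mk (PrimeSpectrum.vanishingIdeal (openPart K G P)) (dehom _ K F) = 0 := by
      simp only [F, map_sub, map_mul, map_pow, map_homIter, dehom_X_none, dehom_X_some,
        homIter_one, one_pow, one_mul, map_iter]
      exact sub_eq_zero.2 (hab (equations_coordRing (K := K)).1 equations_coordRing.2)
    change PrimeSpectrum.basicOpen (Ideal.Quotient.mk
      (PrimeSpectrum.vanishingIdeal (openPart K G P)) (dehom _ K F)) = ⊥
    rw [this, PrimeSpectrum.basicOpen_zero]
  have hFx : (toProjSpace K G P).imageι x ∉
      Proj.basicOpen (homogeneousSubmodule (Option (Option (Fin n))) K) F := by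
    intro hx
    have h1 : x ∈ (toProjSpace K G P).imageι ⁻¹ᵁ
      Proj.basicOpen (homogeneousSubmodule (Option (Option (Fin n))) K) F := hx
    -- Y₁(G) is dense in its closure, so an open set meeting the closure meets Y₁(G), where F is
    -- zero.
    obtain ⟨y, hy⟩ := (toProjClosure K G P).denseRange.exists_mem_open
      ((toProjSpace K G P).imageι ⁻¹ᵁ
        Proj.basicOpen (homogeneousSubmodule (Option (Option (Fin n))) K) F).isOpen ⟨x, h1⟩
    have h2 : y ∈ toProjClosure K G P ⁻¹ᵁ (toProjSpace K G P).imageι ⁻¹ᵁ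
      Proj.basicOpen (homogeneousSubmodule (Option (Option (Fin n))) K) F := hy
    rw [← Scheme.Hom.comp_preimage, Scheme.Hom.toImage_imageι, hF0] at h2
    exact h2
  rw [Proj.mem_basicOpen, not_not] at hz ht hFx
  rw [Proj.mem_basicOpen] at ho
  apply ho
  generalize (toProjSpace K G P).imageι x = p at *
  let I := p.asHomogeneousIdeal.toIdeal
  have hI : I.IsPrime := p.isPrime
  have h1 : Ideal.Quotient.mk I F = 0 := Ideal.Quotient.eq_zero_iff_mem.2 hFx
  have hz' : Ideal.Quotient.mk I (X none) = 0 := Ideal.Quotient.eq_zero_iff_mem.2 hz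
  have ht' : Ideal.Quotient.mk I (X (some none)) = 0 := Ideal.Quotient.eq_zero_iff_mem.2 ht
  have hpos : 2 ^ (a + b) - 2 ^ a ≠ 0 := by
    have := Nat.pow_lt_pow_right (a := 2) (by norm_num) (show a < a + b by omega)
    omega
  simp only [F, map_sub, map_mul, map_homIter, map_pow, hz', ht', homIter_zero, zero_pow hpos,
    zero_mul, sub_zero] at h1
  exact Ideal.Quotient.eq_zero_iff_mem.1 (pow_eq_zero_iff (by positivity) |>.1 h1)

/-- The projection to the `t`-line extends to an integral morphism on the projective closure. -/
theorem exists_projClosure_proj (hG : G.Admissible) (hP : G.MinGenerates P) :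
    ∃ ρ : ProjClosure K G P ⟶ P1 K, IsIntegralHom ρ ∧
      toProjClosure K G P ≫ ρ = affineProj K G P := by
  let e : Unit → Option (Fin n) := fun _ => none
  have := finiteType_degreeZero (K := K) (σ := Option (Option (Fin n)))
  obtain ⟨ρ, hρ, h⟩ := exists_integral_projection (renameGraded (K := K) e)
    (s := fun o : Option Unit => X o) (d := fun _ => 1) (fun o => X_mem_homogeneousSubmodule o)
    (fun _ => one_pos) exists_mem_basicOpen_X (toProjSpace K G P).imageι
    (fun x => by simpa only [renameGraded_X] using exists_mem_basicOpen_projClosure hG hP x)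
    (zeroHom_renameGraded_surjective e)
  refine ⟨ρ, hρ, ?_⟩
  have key : ∀ (z : MvPolynomial (Option (Option (Fin n))) K) (hz : renameGraded e (X none) = z)
      (hzm : z ∈ homogeneousSubmodule (Option (Option (Fin n))) K 1)
      (b : Y₁ K G P ⟶ Spec (.of (Away (homogeneousSubmodule (Option (Option (Fin n))) K) z))),
      toProjClosure K G P ≫ (toProjSpace K G P).imageι = b ≫ Proj.awayι _ z hzm one_pos →
      ∃ η : Away (homogeneousSubmodule (Option Unit) K) (X none) →+*
        Away (homogeneousSubmodule (Option (Option (Fin n))) K) z,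
        (∀ m p hp, ∃ hp', η (Away.mk _ (X_mem_homogeneousSubmodule none) m p hp) =
          Away.mk _ hzm m (renameGraded e p) hp') ∧
        toProjClosure K G P ≫ ρ = b ≫ Spec.map (CommRingCat.ofHom η) ≫
          Proj.awayι _ (X none) (X_mem_homogeneousSubmodule none) one_pos := by
    rintro z rfl hzm b hb
    exact ⟨Away.map (renameGraded e) (X none), fun m p hp => ⟨_, Away.map_mk ..⟩, h none _ _ b hb⟩
  obtain ⟨η, hη, h1⟩ := key (X none) (renameGraded_X e none) (X_mem_homogeneousSubmodule none)
    (Spec.map (CommRingCat.ofHom (Ideal.Quotient.mk _)) ≫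
      Spec.map (CommRingCat.ofHom (dehomAway (Option (Fin n)) K)))
    (by rw [Scheme.Hom.toImage_imageι, toProjSpace, chart_eq, Category.assoc])
  rw [h1, affineProj, chart_eq, ← Category.assoc, ← Category.assoc]
  congr 1
  simp only [← Spec.map_comp, ← CommRingCat.ofHom_comp]
  congr 2
  refine RingHom.ext fun y => ?_
  obtain ⟨m, p, hp, rfl⟩ := Away.mk_surjective _ (X_mem_homogeneousSubmodule none) y
  obtain ⟨hp', hη'⟩ := hη m p hp
  simp only [RingHom.comp_apply]
  rw [hη', dehomAway_mk, dehomAway_mk, dehom_renameGraded]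
  generalize dehom Unit K p = q
  refine DFunLike.congr_fun (?_ : ((Ideal.Quotient.mkₐ K _).comp (rename e) :
    MvPolynomial Unit K →ₐ[K] CoordRing K G P) = aeval _) q
  exact algHom_ext fun i => by simp [e]

end ProjClosure

end DynModCurve

end

noncomputable section
namespace DynModCurve
universe u v

/-! ### Degrees from geometric fibres over a dense open part -/

section Degree

/-- A morphism of positive degree is dominant. -/
lemma HasDegree.isDominant {X Y : Scheme.{u}} {π : X ⟶ Y} {d : ℕ} (h : HasDegree π d)
    (hd : 1 ≤ d) : IsDominant π := by
  obtain ⟨U, hU, h⟩ := h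
  refine ⟨hU.mono fun y hy => ?_⟩
  let Ω := AlgebraicClosure (Y.residueField y)
  let y' : Spec (.of Ω) ⟶ Y :=
    Spec.map (CommRingCat.ofHom (algebraMap (Y.residueField y) Ω)) ≫ Y.fromSpecResidueField y
  have h1 : ∀ z, y' z = y := fun z => by
    have : y' z ∈ Set.range (Y.fromSpecResidueField y) := ⟨_, rfl⟩
    simpa [eq_comm] using this
  have h2 := h Ω y' (by rintro _ ⟨z, rfl⟩; rw [h1]; exact hy)
  obtain ⟨x, hx⟩ : {x : Spec (.of Ω) ⟶ X | x ≫ π = y'}.Nonempty := by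
    rw [← Set.encard_ne_zero, h2]
    exact_mod_cast (by omega : d ≠ 0)
  let z : Spec (.of Ω) := (⊥ : PrimeSpectrum Ω)
  refine ⟨x z, ?_⟩
  have hx' : x ≫ π = y' := hx
  refine Eq.trans ?_ (h1 z)
  rw [← hx']
  rfl

variable {N N' Z W T T' : Scheme.{u}} {p : N ⟶ Z} {p' : N' ⟶ Z} {i : W ⟶ Z} {κ : T ⟶ N} {s : T ⟶ W}
  {κ' : T' ⟶ N'} {s' : T' ⟶ W} {π : N ⟶ N'} {g : T ⟶ T'}

/-- T and T' are the parts of N and N' over W, so a point of N over a point of T' also lies over W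
and lifts uniquely to T. -/
lemma encard_fibre_eq [Mono i] (h : IsPullback κ s p i) (h' : IsPullback κ' s' p' i)
    (hπ : π ≫ p' = p) (hκ : κ ≫ π = g ≫ κ') {S : Scheme.{u}} (y : S ⟶ T') :
    {x : S ⟶ N | x ≫ π = y ≫ κ'}.encard = {x : S ⟶ T | x ≫ g = y}.encard := by
  have hm : Mono κ := ⟨fun a b hab => h.hom_ext hab (by
    rw [← cancel_mono i, Category.assoc, Category.assoc, ← h.w, reassoc_of% hab])⟩
  have hm' : Mono κ' := ⟨fun a b hab => h'.hom_ext hab (by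
    rw [← cancel_mono i, Category.assoc, Category.assoc, ← h'.w, reassoc_of% hab])⟩
  have : {x : S ⟶ N | x ≫ π = y ≫ κ'} = (fun x => x ≫ κ) '' {x : S ⟶ T | x ≫ g = y} := by
    ext x
    constructor
    · intro (hx : x ≫ π = y ≫ κ')
      have h1 : x ≫ p = (y ≫ s') ≫ i := by
        rw [← hπ, reassoc_of% hx, Category.assoc, h'.w]
      refine ⟨h.lift x (y ≫ s') h1, ?_, h.lift_fst ..⟩
      change _ = _
      rw [← cancel_mono κ', Category.assoc, ← hκ, ← hx]
      exact (h.lift_fst_assoc x (y ≫ s') h1 π)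
    · rintro ⟨x, rfl, rfl⟩
      simp [hκ]
  rw [this]
  exact Function.Injective.encard_image (fun a b hab => (cancel_mono κ).1 hab) _

/-- If over a dense open subset the morphism `π` is `g`, and `g` has constant fibres, then `π` has a
degree. -/
lemma hasDegree_of_isPullback [IsOpenImmersion i] (h : IsPullback κ s p i)
    (h' : IsPullback κ' s' p' i) (hπ : π ≫ p' = p) (hκ : κ ≫ π = g ≫ κ') (hd : DenseRange κ')
    {d : ℕ} (hg : ∀ (Ω : Type u) [Field Ω] [IsAlgClosed Ω] (y : Spec (.of Ω) ⟶ T'),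
      {x : Spec (.of Ω) ⟶ T | x ≫ g = y}.encard = d) : HasDegree π d := by
  have : IsOpenImmersion κ' := MorphismProperty.of_isPullback h'.flip ‹IsOpenImmersion i›
  refine ⟨κ'.opensRange, hd, fun Ω _ _ y hy => ?_⟩
  have h1 := IsOpenImmersion.lift_fac κ' y hy
  rw [← h1, encard_fibre_eq h h' hπ hκ]
  exact hg Ω _

end Degree

/-! ### Extending a morphism to the normalization -/

section Descent

/-- Functoriality of the normalization. -/
lemma exists_normalization_map {X Y Z N' W T T' : Scheme.{u}} (f : X ⟶ Y) (ρ : Y ⟶ Z)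
    [QuasiCompact f] [QuasiSeparated f] {p' : N' ⟶ Z} {i : W ⟶ Z} {κ : T ⟶ f.normalization} {s : T ⟶ W}
    {κ' : T' ⟶ N'} {s' : T' ⟶ W} {f₁ : X ⟶ T} {g : T ⟶ T'} [IsIntegralHom p']
    [N'.IsSeparated] [IsReduced T] [IsDominant f₁]
    (h : f ≫ ρ = f₁ ≫ s ≫ i) (hκ' : κ' ≫ p' = s' ≫ i) (hg : g ≫ s' = s)
    (hκ : f₁ ≫ κ = f.toNormalization) :
    ∃ π : f.normalization ⟶ N', π ≫ p' = f.fromNormalization ≫ ρ ∧ κ ≫ π = g ≫ κ' := by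
  have h1 : f ≫ ρ = (f₁ ≫ g ≫ κ') ≫ p' := by
    rw [h, Category.assoc, Category.assoc, hκ', reassoc_of% hg]
  -- The base change of the integral p' to Y is integral and receives X, so the universal property
  -- of the normalization of Y in X maps the normalization to it.
  let l : X ⟶ pullback ρ p' := pullback.lift f (f₁ ≫ g ≫ κ') h1
  have hl : f = l ≫ pullback.fst ρ p' := (pullback.lift_fst ..).symm
  have hl' : l ≫ pullback.snd ρ p' = f₁ ≫ g ≫ κ' := pullback.lift_snd ..
  refine ⟨f.normalizationDesc l (pullback.fst ρ p') hl ≫ pullback.snd ρ p', ?_, ?_⟩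
  · rw [Category.assoc, ← pullback.condition, ← Category.assoc,
      Scheme.Hom.normalizationDesc_comp]
  -- Morphisms from the reduced T to the separated N' are determined by their composites with the
  -- dominant f₁.
  · refine ext_of_isDominant f₁ ?_
    rw [reassoc_of% hκ, Scheme.Hom.toNormalization_normalizationDesc_assoc, hl']

end Descent

/-! ### Counting points of spectra by ring homomorphisms -/

section RingHoms

/-- Homomorphisms from a localization extending a given one. -/
lemma encard_localization_hom {A A' F : Type*} [CommRing A] [CommRing A'] [CommRing F]
    {ι : A →+* A'} {a : A} {a' : A'} (ha : ι a = a')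
    {ι' : Localization.Away a →+* Localization.Away a'}
    (hι : ι'.comp (algebraMap A _) = (algebraMap A' _).comp ι) (y : Localization.Away a →+* F) :
    {h : Localization.Away a' →+* F | h.comp ι' = y}.encard =
      {f : A' →+* F | f.comp ι = y.comp (algebraMap A _)}.encard := by
  have : {f : A' →+* F | f.comp ι = y.comp (algebraMap A _)} =
      (fun h => h.comp (algebraMap A' (Localization.Away a'))) ''
        {h : Localization.Away a' →+* F | h.comp ι' = y} := by
    ext f
    constructor
    · intro (hf : f.comp ι = y.comp (algebraMap A _))
      have hu : IsUnit (f a') := by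
        rw [← ha, ← RingHom.comp_apply, hf]
        exact (IsLocalization.Away.algebraMap_isUnit a).map y
      have h1 := IsLocalization.Away.lift_comp (S := Localization.Away a') a' hu
      refine ⟨IsLocalization.Away.lift a' hu, ?_, h1⟩
      refine IsLocalization.ringHom_ext (Submonoid.powers a) ?_
      rw [RingHom.comp_assoc, hι, ← RingHom.comp_assoc, h1, hf]
    · rintro ⟨h, rfl, rfl⟩
      change (h.comp _).comp ι = (h.comp ι').comp _
      rw [RingHom.comp_assoc, RingHom.comp_assoc, hι]
  rw [this]
  exact (Function.Injective.encard_image (fun h h' hh =>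
    IsLocalization.ringHom_ext (Submonoid.powers a') hh) _).symm

lemma exists_localization_hom {A A' : Type*} [CommRing A] [CommRing A'] {ι : A →+* A'} {a : A}
    {a' : A'} (ha : ι a = a') : ∃ ι' : Localization.Away a →+* Localization.Away a',
      ι'.comp (algebraMap A _) = (algebraMap A' _).comp ι := by
  subst ha
  exact ⟨Localization.awayMap ι a, IsLocalization.map_comp _⟩

lemma encard_specHom {R S : Type u} [CommRing R] [CommRing S] (φ : R →+* S) {F : Type u}
    [CommRing F] (y : Spec (.of F) ⟶ Spec (.of R)) :
    {x : Spec (.of F) ⟶ Spec (.of S) | x ≫ Spec.map (CommRingCat.ofHom φ) = y}.encard =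
      {h : S →+* F | h.comp φ = (Spec.preimage y).hom}.encard := by
  have : {x : Spec (.of F) ⟶ Spec (.of S) | x ≫ Spec.map (CommRingCat.ofHom φ) = y} =
      (fun h : S →+* F => Spec.map (CommRingCat.ofHom h)) ''
        {h : S →+* F | h.comp φ = (Spec.preimage y).hom} := by
    ext x
    constructor
    · intro (hx : x ≫ _ = y)
      refine ⟨(Spec.preimage x).hom, ?_, by simp⟩
      change _ = _
      rw [← hx, Spec.preimage_comp, Spec.preimage_map]
      rfl
    · rintro ⟨h, hh, rfl⟩
      change _ ≫ _ = y
      rw [← Spec.map_comp, ← CommRingCat.ofHom_comp, hh]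
      simp
  rw [this]
  refine Function.Injective.encard_image (fun h h' hh => ?_) _
  exact congr(($(Spec.map_injective hh)).hom)

end RingHoms

end DynModCurve

end

noncomputable section
namespace DynModCurve
universe u v

/-! ### The part of X₁(G) over good parameters -/

section Curves

attribute [local instance] MvPolynomial.gradedAlgebra

variable {K : Type u} [Field K] {V : Type v} {G : DGraph V} {n : ℕ} {P : Fin n → V}

lemma isParamProj_comp {ρ : ProjClosure K G P ⟶ P1 K}
    (hρ : toProjClosure K G P ≫ ρ = affineProj K G P) : IsParamProj K G P (normMap K G P ≫ ρ) := by
  rw [IsParamProj, ← hρ, pullback.condition_assoc]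

instance : (X₁ K G P).IsSeparated :=
  ⟨by
    rw [← terminal.comp_from (normMap K G P)]
    infer_instance⟩

variable (K) in
/-- The open subscheme `b ≠ 0` of the `t`-line. -/
def goodChart (b : MvPolynomial Unit K) : Spec (.of (Localization.Away b)) ⟶ P1 K :=
  Spec.map (CommRingCat.ofHom (algebraMap (MvPolynomial Unit K) (Localization.Away b))) ≫
    chart Unit K

instance (b : MvPolynomial Unit K) : IsOpenImmersion (goodChart K b) := by
  unfold goodChart
  infer_instance

lemma genericPoints_comp (hG : G.Admissible) (hP : G.MinGenerates P) {b : MvPolynomial Unit K}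
    (hb : b ≠ 0) {ρ : ProjClosure K G P ⟶ P1 K}
    (hρ : toProjClosure K G P ≫ ρ = affineProj K G P) :
    genericPoints K G P ≫ ρ = Spec.map (CommRingCat.ofHom (goodToFrac hG hP hb)) ≫
      Spec.map (CommRingCat.ofHom (Localization.awayMap (paramHom K G P) b)) ≫ goodChart K b := by
  have h1 : affineProj K G P = Spec.map (CommRingCat.ofHom (paramHom K G P)) ≫ chart Unit K := rfl
  rw [genericPoints, Category.assoc, hρ, h1, goodChart]
  simp only [← Category.assoc, ← Spec.map_comp, ← CommRingCat.ofHom_comp]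
  congr 3
  have h2 : (Localization.awayMap (paramHom K G P) b).comp
      (algebraMap (MvPolynomial Unit K) (Localization.Away b)) =
      (algebraMap (CoordRing K G P) (GoodRing K G P b)).comp (paramHom K G P) :=
    IsLocalization.map_comp _
  rw [h2, ← RingHom.comp_assoc, goodToFrac_comp]

instance isReduced_goodRing (b : MvPolynomial Unit K) : _root_.IsReduced (GoodRing K G P b) :=
  isReduced_localizationPreserves (Submonoid.powers (paramHom K G P b)) _ inferInstance

lemma isDominant_goodToFrac (hG : G.Admissible) (hP : G.MinGenerates P)
    {b : MvPolynomial Unit K} (hb : b ≠ 0) :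
    IsDominant (Spec.map (CommRingCat.ofHom (goodToFrac hG hP hb))) := by
  refine ⟨?_⟩
  refine (PrimeSpectrum.denseRange_comap_iff_ker_le_nilRadical (goodToFrac hG hP hb)).2 ?_
  rw [(RingHom.injective_iff_ker_eq_bot _).1 (goodToFrac_injective hG hP hb)]
  exact bot_le

/-- The part of `X₁(G)` over good parameters. -/
lemma exists_isPullback_goodRing [CharZero K] (hG : G.Admissible) (hP : G.MinGenerates P)
    {b : MvPolynomial Unit K} (hb : b ≠ 0)
    (hgood : ∀ (F : Type u) [Field F] (h : MvPolynomial Unit K →+* F),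
      h b ≠ 0 → Good G.verts.ncard (h (MvPolynomial.X ())))
    {ρ : ProjClosure K G P ⟶ P1 K} [IsIntegralHom ρ]
    (hρ : toProjClosure K G P ≫ ρ = affineProj K G P) :
    ∃ κ : Spec (.of (GoodRing K G P b)) ⟶ X₁ K G P,
      IsPullback κ (Spec.map (CommRingCat.ofHom (Localization.awayMap (paramHom K G P) b)))
        (normMap K G P ≫ ρ) (goodChart K b) ∧
      Spec.map (CommRingCat.ofHom (goodToFrac hG hP hb)) ≫ κ =
        (genericPoints K G P).toNormalization := by
  have h1 : IsIso (Spec.map (CommRingCat.ofHom (goodToFrac hG hP hb))).fromNormalization :=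
    isIso_fromNormalization _ (goodToFrac_injective hG hP hb)
      fun z hz => mem_range_goodToFrac hG hP hb hgood hz
  have h2 := isIntegral_awayMap (paramHom_isIntegral (K := K) hG hP) b
  have h3 : IsIntegralHom (Spec.map (CommRingCat.ofHom (R := Localization.Away b)
      (S := GoodRing K G P b) (Localization.awayMap (paramHom K G P) b))) := by
    rw [IsIntegralHom.SpecMap_iff]
    exact h2
  exact exists_isPullback_normalization (genericPoints K G P) ρ (goodChart K b) _ _
    (genericPoints_comp hG hP hb hρ)

end Curves

/-! ### The morphism X₁(G) → X₁(H) and its degree -/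

section Main

attribute [local instance] MvPolynomial.gradedAlgebra

variable {K : Type u} [Field K] [CharZero K] {V : Type v} {G H : DGraph V} {n m : ℕ}
  {P : Fin n → V} {Q : Fin m → V}

/-- The fibres of the map of the good parts of the curves. -/
lemma encard_fibre_goodRing (hG : G.Admissible) (hH : H.Admissible) (hHG : H ≤ G)
    (hP : G.MinGenerates P) (hQ : H.MinGenerates Q) {ι : CoordRing K H Q →+* CoordRing K G P}
    (h1 : ι.comp (paramHom K H Q) = paramHom K G P)
    (h2 : ∀ (F : Type u) [Field F] (g : CoordRing K G P →+* F) (φ : V → F),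
        IsEmb G G.verts (g (tFun K G P)) φ → (∀ i, φ (P i) = g (xFun K G P i)) →
        ∀ j, g (ι (xFun K H Q j)) = φ (Q j))
    {b : MvPolynomial Unit K}
    (hgood : ∀ (F : Type u) [Field F] (h : MvPolynomial Unit K →+* F),
      h b ≠ 0 → Good (G.verts.ncard + 1) (h (MvPolynomial.X ())))
    {ι' : GoodRing K H Q b →+* GoodRing K G P b}
    (hι' : ι'.comp (algebraMap (CoordRing K H Q) _) = (algebraMap (CoordRing K G P) _).comp ι)
    {d : ℕ} (hd : ∀ (F : Type u) [Field F] [IsAlgClosed F] [CharZero F] (t : F),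
        Good (G.verts.ncard + 1) t → ∀ φ, IsEmb G H.verts t φ →
        (extensions G H.verts t φ).encard = d)
    (Ω : Type u) [Field Ω] [IsAlgClosed Ω]
    (y : Spec (.of Ω) ⟶ Spec (.of (GoodRing K H Q b))) :
    {x : Spec (.of Ω) ⟶ Spec (.of (GoodRing K G P b)) |
      x ≫ Spec.map (CommRingCat.ofHom ι') = y}.encard = d := by
  have hb : ι (paramHom K H Q b) = paramHom K G P b := by rw [← h1]; rfl
  rw [encard_specHom, encard_localization_hom hb hι']
  generalize (Spec.preimage y).hom = y'
  let g := (y' : GoodRing K H Q b →+* Ω).comp (algebraMap (CoordRing K H Q) (GoodRing K H Q b))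
  have hg : Good (G.verts.ncard + 1) (g (tFun K H Q)) := by
    rw [hom_tFun]
    refine hgood Ω _ ?_
    have hu : IsUnit (algebraMap (CoordRing K H Q) (GoodRing K H Q b) (paramHom K H Q b)) :=
      IsLocalization.Away.algebraMap_isUnit _
    exact (hu.map y').ne_zero
  have := charZero_of_hom g
  obtain ⟨φ, hφ, hc⟩ := encard_fibre_coordRing hG hH hHG hP hQ h1 h2 g (hg.mono (Nat.le_succ _))
  exact hc.trans (hd Ω _ hg φ hφ)

/-- A single b serves both graphs, so over b ≠ 0 both curves are the spectra of their good rings and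
π is induced by the localized restriction map. Its degree is the extension count. -/
theorem exists_morphism (hG : G.Admissible) (hH : H.Admissible) (hHG : H ≤ G)
    (hP : G.MinGenerates P) (hQ : H.MinGenerates Q) :
    ∃ (πG : X₁ K G P ⟶ P1 K) (πH : X₁ K H Q ⟶ P1 K) (π : X₁ K G P ⟶ X₁ K H Q) (d : ℕ),
      IsParamProj K G P πG ∧ IsParamProj K H Q πH ∧ π ≫ πH = πG ∧ HasDegree π d ∧ 1 ≤ d ∧
      (d = 1 ↔ G = H ∨ DGraph.AddsSecondFixedPoint H G) := by
  obtain ⟨d, hd1, hd2, hd⟩ :=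
    exists_extension_count.{u} hG (hG.closed_of_le hH hHG)
  obtain ⟨b, hb, hgood⟩ := exists_good_param K (G.verts.ncard + 1)
  have hcard : H.verts.ncard ≤ G.verts.ncard := Set.ncard_le_ncard hHG.1 hG.finite
  obtain ⟨ρG, hρG, hG'⟩ := exists_projClosure_proj (K := K) hG hP
  obtain ⟨ρH, hρH, hH'⟩ := exists_projClosure_proj (K := K) hH hQ
  obtain ⟨κG, hκG, hκG'⟩ := exists_isPullback_goodRing hG hP hb
    (fun F _ h hh => (hgood F h hh).mono (Nat.le_succ _)) hG'
  obtain ⟨κH, hκH, hκH'⟩ := exists_isPullback_goodRing hH hQ hb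
    (fun F _ h hh => (hgood F h hh).mono (hcard.trans (Nat.le_succ _))) hH'
  obtain ⟨ι, h1, h2⟩ := exists_coordRing_hom (K := K) hG hH hHG hP hQ
  have hιb : ι (paramHom K H Q b) = paramHom K G P b := by rw [← h1]; rfl
  obtain ⟨ι', hι'⟩ := exists_localization_hom hιb
  have hcomp : Spec.map (CommRingCat.ofHom ι') ≫
      Spec.map (CommRingCat.ofHom (Localization.awayMap (paramHom K H Q) b)) =
      Spec.map (CommRingCat.ofHom (Localization.awayMap (paramHom K G P) b)) := by
    rw [← Spec.map_comp, ← CommRingCat.ofHom_comp]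
    congr 2
    have e1 : (Localization.awayMap (paramHom K H Q) b).comp
        (algebraMap (MvPolynomial Unit K) (Localization.Away b)) =
        (algebraMap (CoordRing K H Q) (GoodRing K H Q b)).comp (paramHom K H Q) :=
      IsLocalization.map_comp _
    have e2 : (Localization.awayMap (paramHom K G P) b).comp
        (algebraMap (MvPolynomial Unit K) (Localization.Away b)) =
        (algebraMap (CoordRing K G P) (GoodRing K G P b)).comp (paramHom K G P) :=
      IsLocalization.map_comp _
    refine IsLocalization.ringHom_ext (Submonoid.powers b) ?_
    rw [RingHom.comp_assoc, e1, e2, ← RingHom.comp_assoc, hι', RingHom.comp_assoc, h1]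
  have := isDominant_goodToFrac hG hP hb
  obtain ⟨π, hπ, hπκ⟩ := exists_normalization_map (genericPoints K G P) ρG
    (genericPoints_comp hG hP hb hG') hκH.w hcomp hκG'
  refine ⟨normMap K G P ≫ ρG, normMap K H Q ≫ ρH, π, d, isParamProj_comp hG', isParamProj_comp hH',
    hπ, hasDegree_of_isPullback hκG hκH hπ hπκ ?_
      (encard_fibre_goodRing hG hH hHG hP hQ h1 h2 hgood hι' hd), hd1, ?_⟩
  -- The part over b ≠ 0 contains the image of the generic points, which is dense in the
  -- normalization.
  · refine (genericPoints K H Q).toNormalization.denseRange.mono ?_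
    rw [← hκH']
    rintro _ ⟨x, rfl⟩
    exact ⟨_, rfl⟩
  · rw [hd2, hG.verts_eq_iff hH hHG, addsSecond_iff_of_le hG hH hHG]

end Main

end DynModCurve

end

theorem mainTheorem8 {V : Type*} (K : Type*) [Field K] [CharZero K]
    (G H : DynModCurve.DGraph V) (hG : G.Admissible) (hH : H.Admissible) (hHG : H ≤ G)
    {n m : ℕ} (P : Fin n → V) (hP : G.MinGenerates P)
    (Q : Fin m → V) (hQ : H.MinGenerates Q) :
    ∃ (πG : DynModCurve.X₁ K G P ⟶ DynModCurve.P1 K)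
      (πH : DynModCurve.X₁ K H Q ⟶ DynModCurve.P1 K)
      (π : DynModCurve.X₁ K G P ⟶ DynModCurve.X₁ K H Q) (d : ℕ),
      DynModCurve.IsParamProj K G P πG ∧ DynModCurve.IsParamProj K H Q πH ∧
      IsDominant π ∧ π ≫ πH = πG ∧ DynModCurve.HasDegree π d ∧
      (2 ≤ d ↔ G ≠ H ∧ ¬ DynModCurve.DGraph.AddsSecondFixedPoint H G) ∧
      (H.StronglyAdmissible → G ≠ H → 2 ≤ d) := by
  obtain ⟨πG, πH, π, d, hπG, hπH, hπ, hdeg, hd1, hd⟩ :=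
    DynModCurve.exists_morphism (K := K) hG hH hHG hP hQ
  have h2 : 2 ≤ d ↔ G ≠ H ∧ ¬ DynModCurve.DGraph.AddsSecondFixedPoint H G := by
    rw [ne_eq, ← not_or, ← hd]
    omega
  refine ⟨πG, πH, π, d, hπG, hπH, hdeg.isDominant hd1, hπ, hdeg, h2, fun hs hne => ?_⟩
  -- The exceptional case needs H to have exactly one fixed point, which strong admissibility
  -- excludes.
  refine h2.2 ⟨hne, fun h => ?_⟩
  have h3 := hs.fixed
  have h4 := h.1
  omega
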